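/- Let $p$ be an odd prime, let $\mathbb{Z}_{(p)}$ be the localization of $\mathbb{Z}$ at the prime ideal $(p)$, and let $R$ be a commutative $\mathbb{Z}_{(p)}$-algebra that is $p$-torsion-free (that is, $pr=0$ implies $r=0$ for $r\in R$). Let $R/\!/p$ be the differential graded $R$-algebra whose underlying graded algebra is the polynomial ring $R[x]$ with $x$ in degree $1$, and whose differential $\delta$ is the $R$-linear map of degree $-1$ that satisfies the graded Leibniz rule $\delta(ab)=\delta(a)b+(-1)^{|a|}a\,\delta(b)$ and $\delta(x)=p$; thus $\delta(x^n)=p\,x^{n-1}$ for odd $n$ and $\delta(x^n)=0$ for even $n$. For $i\in\mathbb{Z}$ let $\mathrm{HP}_i(R/\!/p)$ be the periodic cyclic homology of $R/\!/p$ over $R$, that is, the $i$-th homology of the product total complex of the periodic $(b,B)$-bicomplex built from the Hochschild complex of the differential graded algebra $R/\!/p$, where tensor products are taken over $R$. In degree $i$ this total complex is $\prod_{j\in\mathbb{Z}} C_{i+2j}$, where $C_m=\bigoplus_{n\ge 0}\bigl((R/\!/p)^{\otimes_R (n+1)}\bigr)_{m-n}$ is the module of Hochschild chains of total degree $m$,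 and its differential is $b\pm\delta+B$, with $b$ the Hochschild boundary, $\delta$ the internal differential and $B$ the Connes operator. Then $\mathrm{HP}_i(R/\!/p)=0$ for every odd $i\in\mathbb{Z}$, and for every even $i\in\mathbb{Z}$ there is an isomorphism of $R$-modules \[ \mathrm{HP}_i(R/\!/p)\;\cong\; R^{\wedge}\times R/1\times R/3\times R/5\times\cdots \;=\; R^{\wedge}\times\prod_{k\ge 0} R/(2k+1)R, \] where $R^{\wedge}=\varprojlim_n R/p^nR$ denotes the $p$-adic completion of $R$. -/

import Mathlib

open scoped DirectSum TensorProduct Polynomial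

noncomputable section

universe u v

/-! ## Non-negatively graded differential graded algebras -/

section DGA

variable {R : Type u} [CommRing R] {A : Type v} [Ring A] [Algebra R A]

/-- A differential turning the `ℕ`-graded `R`-algebra `A = ⨁ₙ 𝒜 n` into a (homologically graded,
associative, unital) differential graded `R`-algebra: an `R`-linear map of degree `-1` with square
zero that satisfies the graded Leibniz rule. -/
structure DGDifferential (𝒜 : ℕ → Submodule R A) where
  /-- the underlying linear map -/
  toLin : A →ₗ[R] A
  map_zero_deg : ∀ a ∈ 𝒜 0, toLin a = 0
  map_succ_deg : ∀ n, ∀ a ∈ 𝒜 (n + 1), toLin a ∈ 𝒜 n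
  sq_zero : ∀ a, toLin (toLin a) = 0
  leibniz : ∀ n, ∀ a ∈ 𝒜 n, ∀ b, toLin (a * b) = toLin a * b + (-1 : R) ^ n • (a * toLin b)

end DGA

/-- The module `Z / (Z ∩ B)` for two submodules `Z`, `B` of a module: the homology at a place with
cycles `Z` and boundaries `B`. -/
abbrev HomologyModule {R : Type u} [CommRing R] {M : Type v} [AddCommGroup M] [Module R M]
    (Z B : Submodule R M) : Type v :=
  ↥Z ⧸ B.submoduleOf Z

/-! ## Hochschild, cyclic and periodic cyclic chains of a differential graded algebra

`A` is a differential graded algebra over `R` with grading `𝒜` and differential `δ`; tensor products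
are over `R` and all signs follow the Koszul rule. -/

namespace DGCyclic

variable {R : Type u} [CommRing R] {A : Type v} [Ring A] [Algebra R A]

section Parity

variable (𝒜 : ℕ → Submodule R A) [GradedAlgebra 𝒜]

/-- The projection of `A` to its part of even degree. -/
def evenPart : A →ₗ[R] A :=
  DirectSum.toModule R ℕ A (fun n => if Even n then (𝒜 n).subtype else 0) ∘ₗ
    (DirectSum.decomposeLinearEquiv 𝒜).toLinearMap

/-- The projection of `A` to its part of odd degree. -/
def oddPart : A →ₗ[R] A := LinearMap.id - evenPart 𝒜

/-- The grading involution, `a ↦ (-1) ^ |a| a` for homogeneous `a`. -/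
def gradingInv : A →ₗ[R] A := evenPart 𝒜 - oddPart 𝒜

end Parity

variable (R A) in
/-- The `R`-module `A ⊗ A ⊗ ⋯ ⊗ A` with `n + 1` factors, whose elementary tensors are written
`(a₀, …, aₙ)` below. -/
abbrev Tensors (n : ℕ) : Type (max u v) := PiTensorProduct R (fun _ : Fin (n + 1) => A)

/-- The tuple obtained by multiplying the entries `i` and `i + 1`. -/
def mergeAt {n : ℕ} (i : Fin (n + 1)) (a : Fin (n + 2) → A) (k : Fin (n + 1)) : A :=
  if k < i then a k.castSucc else if k = i then a k.castSucc * a k.succ else a k.succ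

variable (R) in
theorem mergeAt_update {n : ℕ} [DecidableEq (Fin (n + 2))] (i : Fin (n + 1))
    (a : Fin (n + 2) → A) (j : Fin (n + 2)) :
    ∃ (c : Fin (n + 1)) (g : A →ₗ[R] A), ∀ x,
      mergeAt i (Function.update a j x) = Function.update (mergeAt i a) c (g x) := by
  rcases lt_trichotomy j i.castSucc with h | h | h
  · refine ⟨⟨j, by grind⟩, LinearMap.id, fun x => ?_⟩
    funext k
    simp only [mergeAt, Function.update_apply, Fin.ext_iff, Fin.lt_def] at h ⊢
    simp at h ⊢
    grind
  · refine ⟨i, LinearMap.mulRight R (a i.succ), fun x => ?_⟩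
    subst h
    funext k
    simp only [mergeAt, Function.update_apply, Fin.ext_iff, Fin.lt_def]
    simp
    grind
  · by_cases h' : j = i.succ
    · refine ⟨i, LinearMap.mulLeft R (a i.castSucc), fun x => ?_⟩
      subst h'
      funext k
      simp only [mergeAt, Function.update_apply, Fin.ext_iff, Fin.lt_def]
      simp
      grind
    · refine ⟨⟨j - 1, by grind⟩, LinearMap.id, fun x => ?_⟩
      funext k
      simp only [mergeAt, Function.update_apply, Fin.ext_iff, Fin.lt_def] at h h' ⊢
      simp at h h' ⊢
      grind

variable (R A) in
/-- The multilinear map underlying the face `dᵢ`. -/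
def faceMultilinear (n : ℕ) (i : Fin (n + 1)) :
    MultilinearMap R (fun _ : Fin (n + 2) => A) (Tensors R A n) where
  toFun a := PiTensorProduct.tprod R (mergeAt i a)
  map_update_add' a j x y := by
    obtain ⟨c, g, h⟩ := mergeAt_update R i a j
    simp only [h, map_add, MultilinearMap.map_update_add]
  map_update_smul' a j r x := by
    obtain ⟨c, g, h⟩ := mergeAt_update R i a j
    simp only [h, map_smul, MultilinearMap.map_update_smul]

variable (R A) in
/-- The face `dᵢ (a₀, …, aₙ₊₁) = (a₀, …, aᵢ aᵢ₊₁, …, aₙ₊₁)` for `0 ≤ i ≤ n`. -/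
def face (n : ℕ) (i : Fin (n + 1)) : Tensors R A (n + 1) →ₗ[R] Tensors R A n :=
  PiTensorProduct.lift (faceMultilinear R A n i)

variable (R A) in
/-- The extra degeneracy `s (a₀, …, aₙ) = (1, a₀, …, aₙ)`. -/
def extraDegeneracy (n : ℕ) : Tensors R A n →ₗ[R] Tensors R A (n + 1) :=
  PiTensorProduct.lift
    ((PiTensorProduct.tprod R : MultilinearMap R (fun _ : Fin (n + 2) => A) _).curryLeft 1)

section Grading

variable (𝒜 : ℕ → Submodule R A) [GradedAlgebra 𝒜]

/-- The Koszul sign of moving the last factor to the front: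
`(a₀, …, aₙ) ↦ (-1) ^ (|aₙ| (|a₀| + ⋯ + |aₙ₋₁|)) (a₀, …, aₙ)`. -/
def rotationSign (n : ℕ) : Tensors R A n →ₗ[R] Tensors R A n :=
  PiTensorProduct.map (fun i => if i = Fin.last n then evenPart 𝒜 else LinearMap.id) +
  PiTensorProduct.map (fun i => if i = Fin.last n then oddPart 𝒜 else gradingInv 𝒜)

/-- The signed rotation
`(a₀, …, aₙ) ↦ (-1) ^ (|aₙ| (|a₀| + ⋯ + |aₙ₋₁|)) (aₙ, a₀, …, aₙ₋₁)`. -/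
def signedRotation (n : ℕ) : Tensors R A n →ₗ[R] Tensors R A n :=
  (PiTensorProduct.reindex R (fun _ : Fin (n + 1) => A) (finRotate (n + 1))).toLinearMap ∘ₗ
    rotationSign 𝒜 n

/-- The cyclic operator `t = (-1) ^ n · signedRotation` on `n + 1` factors. -/
def cyclicOp (n : ℕ) : Tensors R A n →ₗ[R] Tensors R A n := (-1 : R) ^ n • signedRotation 𝒜 n

/-- The norm operator `N = 1 + t + ⋯ + t ^ n` on `n + 1` factors. -/
def normOp (n : ℕ) : Tensors R A n →ₗ[R] Tensors R A n :=
  ∑ i ∈ Finset.range (n + 1), cyclicOp 𝒜 n ^ i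

/-- The Hochschild boundary `b = ∑ (-1) ^ i dᵢ`, with
`dₙ₊₁ (a₀, …, aₙ₊₁) = (-1) ^ (|aₙ₊₁| (|a₀| + ⋯ + |aₙ|)) (aₙ₊₁ a₀, a₁, …, aₙ)` as last face. -/
def hochschildB (n : ℕ) : Tensors R A (n + 1) →ₗ[R] Tensors R A n :=
  ∑ i : Fin (n + 1), (-1 : R) ^ (i : ℕ) • face R A n i +
    (-1 : R) ^ (n + 1) • (face R A n 0 ∘ₗ signedRotation 𝒜 (n + 1))

/-- The Connes operator `B = (1 - t) s N`. -/
def connesB (n : ℕ) : Tensors R A n →ₗ[R] Tensors R A (n + 1) :=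
  (LinearMap.id - cyclicOp 𝒜 (n + 1)) ∘ₗ extraDegeneracy R A n ∘ₗ normOp 𝒜 n

/-- The internal differential
`(a₀, …, aₙ) ↦ ∑ᵢ (-1) ^ (|a₀| + ⋯ + |aᵢ₋₁|) (a₀, …, δ aᵢ, …, aₙ)`. -/
def internalDiff (δ : DGDifferential 𝒜) (n : ℕ) : Tensors R A n →ₗ[R] Tensors R A n :=
  ∑ i : Fin (n + 1), PiTensorProduct.map
    (fun j => if j < i then gradingInv 𝒜 else if j = i then δ.toLin else LinearMap.id)

end Grading

variable (R A) in
/-- The sum `⨁ₙ A ^ ⊗ (n + 1)` of all Hochschild chains. -/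
abbrev Chains : Type (max u v) := ⨁ n, Tensors R A n

section Degrees

variable (𝒜 : ℕ → Submodule R A)

/-- The chains of total degree `m`: they are spanned by the elementary tensors `(a₀, …, aₙ)` of
homogeneous elements with `n + |a₀| + ⋯ + |aₙ| = m`. There are none for `m < 0`. -/
def chainsOfDegree (m : ℤ) : Submodule R (Chains R A) :=
  Submodule.span R {x | ∃ (n : ℕ) (e : Fin (n + 1) → ℕ) (a : Fin (n + 1) → A),
    (∀ i, a i ∈ 𝒜 (e i)) ∧ (n : ℤ) + ∑ i, (e i : ℤ) = m ∧
      x = DirectSum.lof R ℕ (fun n => Tensors R A n) n (PiTensorProduct.tprod R a)}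

/-- The chains of degree `i` of the product total complex of the periodic `(b, B)`-bicomplex: the
product over all columns `j : ℤ` of the Hochschild chains of total degree `i + 2 j`. -/
def periodicChains (i : ℤ) : Submodule R (ℤ → Chains R A) :=
  Submodule.pi Set.univ (fun j => chainsOfDegree 𝒜 (i + 2 * j))

end Degrees

section Total

variable (𝒜 : ℕ → Submodule R A) [GradedAlgebra 𝒜] (δ : DGDifferential 𝒜)

/-- The component of `totalB` on `n + 1` factors. -/
def totalBComponent : (n : ℕ) → Tensors R A n →ₗ[R] Chains R A
  | 0 => 0
  | n + 1 => DirectSum.lof R ℕ (fun n => Tensors R A n) n ∘ₗ hochschildB 𝒜 n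

/-- The Hochschild boundary `b` on all chains (it vanishes on a single factor). -/
def totalB : Chains R A →ₗ[R] Chains R A :=
  DirectSum.toModule R ℕ _ (totalBComponent 𝒜)

/-- The internal differential on all chains, with the sign `(-1) ^ n` on `n + 1` factors. -/
def totalInternal : Chains R A →ₗ[R] Chains R A :=
  DirectSum.toModule R ℕ _ (fun n =>
    DirectSum.lof R ℕ (fun n => Tensors R A n) n ∘ₗ ((-1 : R) ^ n • internalDiff 𝒜 δ n))

/-- The differential of the Hochschild complex of a differential graded algebra (the total complex
of its Hochschild bicomplex); it has total degree `-1`. -/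
def hochschildDiff : Chains R A →ₗ[R] Chains R A := totalB 𝒜 + totalInternal 𝒜 δ

/-- The Connes operator on all chains; it has total degree `1`. -/
def totalConnes : Chains R A →ₗ[R] Chains R A :=
  DirectSum.toModule R ℕ _ (fun n =>
    DirectSum.lof R ℕ (fun n => Tensors R A n) (n + 1) ∘ₗ connesB 𝒜 n)

/-- The differential of the periodic complex: the `j`-th component of the image of `x` is
`(b ± δ) xⱼ + B xⱼ₋₁`. -/
def periodicDiff : (ℤ → Chains R A) →ₗ[R] (ℤ → Chains R A) :=
  LinearMap.pi (fun j =>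
    hochschildDiff 𝒜 δ ∘ₗ LinearMap.proj j + totalConnes 𝒜 ∘ₗ LinearMap.proj (j - 1))

/-- The cycles of degree `i` in the periodic complex. -/
def periodicCycles (i : ℤ) : Submodule R (ℤ → Chains R A) :=
  periodicChains 𝒜 i ⊓ LinearMap.ker (periodicDiff 𝒜 δ)

/-- The boundaries of degree `i` in the periodic complex. -/
def periodicBoundaries (i : ℤ) : Submodule R (ℤ → Chains R A) :=
  (periodicChains 𝒜 (i + 1)).map (periodicDiff 𝒜 δ)

/-- The periodic cyclic homology `HPᵢ(A)` over `R` of the differential graded `R`-algebra `A`: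
cycles of degree `i` modulo boundaries. -/
abbrev HP (i : ℤ) : Type (max u v) :=
  HomologyModule (periodicCycles 𝒜 δ i) (periodicBoundaries 𝒜 δ i)

end Total

end DGCyclic

/-! ## The differential graded algebra `R // p` -/

namespace KillP

open Polynomial

variable (R : Type u) [CommRing R]

/-- The grading of `R[x]` with `x` in degree `1`. -/
def grading (n : ℕ) : Submodule R R[X] := Submodule.span R {(X : R[X]) ^ n}

theorem X_pow_mem_grading (n : ℕ) : (X : R[X]) ^ n ∈ grading R n :=
  Submodule.mem_span_singleton_self _

instance grading_gradedMonoid : SetLike.GradedMonoid (grading R) where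
  one_mem := X_pow_mem_grading R 0
  mul_mem i j a b ha hb := by
    obtain ⟨r, rfl⟩ := Submodule.mem_span_singleton.1 ha
    obtain ⟨s, rfl⟩ := Submodule.mem_span_singleton.1 hb
    refine Submodule.mem_span_singleton.2 ⟨r * s, ?_⟩
    rw [smul_mul_smul_comm, pow_add]

instance grading_gradedAlgebra : GradedAlgebra (grading R) :=
  GradedAlgebra.ofAlgHom (grading R)
    (aeval (DirectSum.of (fun n => grading R n) 1 ⟨X ^ 1, X_pow_mem_grading R 1⟩))
    (by
      ext
      simp)
    (by
      rintro n ⟨a, ha⟩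
      obtain ⟨r, rfl⟩ := Submodule.mem_span_singleton.1 ha
      rw [map_smul, map_pow, aeval_X, DirectSum.ofPow, ← DirectSum.of_smul]
      refine DirectSum.of_eq_of_gradedMonoid_eq (Sigma.subtype_ext (Nat.mul_one n) ?_)
      change r • ((X : R[X]) ^ 1) ^ n = r • X ^ n
      rw [pow_one])

variable (p : ℕ)

/-- The linear map with `x ^ n ↦ p x ^ (n - 1)` for `n` odd and `x ^ n ↦ 0` for `n` even. -/
def diffLin : R[X] →ₗ[R] R[X] :=
  Polynomial.lsum (fun n => if Odd n then (p : R) • Polynomial.monomial (n - 1) else 0)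

theorem diffLin_X_pow (n : ℕ) :
    diffLin R p (X ^ n) = if Odd n then (p : R) • (X : R[X]) ^ (n - 1) else 0 := by
  rw [diffLin, Polynomial.lsum_apply, ← monomial_one_right_eq_X_pow, Polynomial.sum_monomial_index]
  · split_ifs
    · simp [monomial_one_right_eq_X_pow]
    · simp
  · simp

/-- The differential of `R // p`: it is the differential on `R[x]` with `δ x = p`. -/
def diff : DGDifferential (grading R) where
  toLin := diffLin R p
  map_zero_deg a ha := by
    obtain ⟨r, rfl⟩ := Submodule.mem_span_singleton.1 ha
    rw [map_smul, diffLin_X_pow, if_neg (by simp), smul_zero]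
  map_succ_deg n a ha := by
    obtain ⟨r, rfl⟩ := Submodule.mem_span_singleton.1 ha
    rw [map_smul, diffLin_X_pow]
    split_ifs
    · exact Submodule.smul_mem _ _ (Submodule.smul_mem _ _ (X_pow_mem_grading R n))
    · simp
  sq_zero a := by
    suffices h : diffLin R p ∘ₗ diffLin R p = 0 from LinearMap.congr_fun h a
    ext n : 2
    simp only [LinearMap.comp_apply, monomial_one_right_eq_X_pow, diffLin_X_pow]
    split_ifs with h
    · rw [map_smul, diffLin_X_pow, if_neg (by grind)]
      simp
    · simp
  leibniz n a ha b := by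
    obtain ⟨r, rfl⟩ := Submodule.mem_span_singleton.1 ha
    suffices h : diffLin R p ∘ₗ LinearMap.mulLeft R (X ^ n) =
        LinearMap.mulLeft R (diffLin R p (X ^ n)) +
          (-1 : R) ^ n • (LinearMap.mulLeft R (X ^ n) ∘ₗ diffLin R p) by
      have h' := LinearMap.congr_fun h b
      simp only [LinearMap.comp_apply, LinearMap.add_apply, LinearMap.smul_apply,
        LinearMap.mulLeft_apply] at h'
      rw [smul_mul_assoc, map_smul, h', map_smul, smul_mul_assoc, smul_add, smul_mul_assoc,
        smul_comm r]
    ext m : 2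
    simp only [LinearMap.comp_apply, LinearMap.add_apply, LinearMap.smul_apply,
      LinearMap.mulLeft_apply, monomial_one_right_eq_X_pow, diffLin_X_pow, ← pow_add]
    rcases Nat.even_or_odd n with hn | hn <;> rcases Nat.even_or_odd m with hm | hm
    · simp [hn.add hm, Nat.not_odd_iff_even.2, hn, hm]
    · obtain ⟨k, rfl⟩ := hm
      rw [if_pos (by grind), if_neg (by grind), if_pos (by grind), hn.neg_one_pow]
      simp [← pow_add, ← add_assoc]
    · obtain ⟨k, rfl⟩ := hn
      rw [if_pos (by grind), if_pos (by grind), if_neg (by grind)]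
      rw [show 2 * k + 1 + m - 1 = 2 * k + m by omega]
      simp [pow_add]
    · obtain ⟨k, rfl⟩ := hn
      obtain ⟨l, rfl⟩ := hm
      rw [if_neg (by grind), if_pos (by grind), if_pos (by grind)]
      have : (-1 : R) ^ (2 * k + 1) = -1 := by simp [pow_succ, pow_mul]
      rw [this]
      simp only [Nat.add_sub_cancel, smul_mul_assoc, mul_smul_comm, ← pow_add, neg_smul, one_smul]
      rw [show 2 * k + (2 * l + 1) = 2 * k + 1 + 2 * l by omega, add_neg_cancel]

theorem diff_X : (diff R p).toLin X = (p : R[X]) := by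
  have h := diffLin_X_pow R p 1
  simpa [diff, Algebra.smul_def] using h

end KillP

/-- The periodic cyclic homology `HPᵢ(R // p)` over `R`. -/
abbrev HPKillP (R : Type u) [CommRing R] (p : ℕ) (i : ℤ) : Type u :=
  DGCyclic.HP (KillP.grading R) (KillP.diff R p) i

instance isPrime_span_natCast (p : ℕ) [hp : Fact p.Prime] :
    (Ideal.span {(p : ℤ)}).IsPrime := by
  rw [Ideal.span_singleton_prime (by exact_mod_cast hp.out.ne_zero)]
  exact Nat.prime_iff_prime_int.1 hp.out

/-- The ring `ℤ_(p)`, the localization of `ℤ` at the prime ideal `(p)`. -/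
abbrev ZLocAt (p : ℕ) [Fact p.Prime] : Type := Localization.AtPrime (Ideal.span {(p : ℤ)})

end

/-!
The algebra `R[x]` with `x` in degree `1` is the tensor algebra on one generator, so its Hochschild
complex contracts to a two-term complex: functions `∑ aₙ xⁿ` and forms `∑ bₙ xⁿ dx` modulo graded
commutators. A chain `(x ^ e₀, …, x ^ eₙ)` is treated as a word `[e₀, …, eₙ]`; the projection to the
small complex consists of the coefficients `smallZero` (of `xⁿ`) and `smallOne` (of `xⁿ dx`), and
`contract` is an explicit homotopy for the Hochschild boundary `b` alone. It commutes with the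
internal differential only up to terms with more letters in the same total degree, so the kernel of
the projection is still acyclic for `b ± δ` (`exists_total_eq`), and then, column by column, for the
periodic differential `b ± δ + B` (`exists_periodicTotal_eq`).

It remains to compute with the small complex. Periodic chains of odd degree have coordinates `oₖ`
(of `x ^ (2 k + 1)`) and `qₖ` (of `x ^ (2 k + 1) dx`), those of even degree `uₖ` (of `x ^ (2 k)`) and
`wₖ` (of `x ^ (2 k) dx`). The differential vanishes on even chains, and on odd ones it is
`u₀ = p o₀`, `uₖ₊₁ = p oₖ₊₁ + 2 qₖ`, `wₖ = (2 k + 1) oₖ - p qₖ`. As `2` is a unit, eliminating `qₖ`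
and `uₖ₊₁` leaves the bidiagonal map
`o ↦ (p o₀, p² o₁ + 2 o₀, p² o₂ + 2 · 3 o₁, p² o₃ + 2 · 5 o₂, …)` of `∏ R` (`bidiagonal`). It is
injective because `R` is `p`-torsion-free, which gives the vanishing in odd degrees; the even groups
are its cokernel.

The cokernel is computed in `exists_cokernel_map`. Solving the recursion
`p π₀ + 2 π₁ = 0`, `p² πₖ₊₁ + 2 (2 k + 3) πₖ₊₂ = 0` gives `πₖ₊₁ = -(p / 2) (-p² / 2) ^ k / (3 · 5 ⋯ (2 k + 1))`,
which is divisible by `p ^ (k + 1)` since the product of the odd numbers has valuation at most `k`;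
so `r ↦ ∑ πₖ rₖ` is a map to `R^∧` that kills the image. Starting the same recursion at `rₖ₊₁` and
stopping after `a` steps, `a` the valuation of `2 k + 1`, gives a map to `R / (2 k + 1)`. Modulo `p`
these maps are the coordinates, so together they are surjective modulo `p`; they are surjective since
`p²` times a sequence is congruent to a multiple of its shift (`surjective_of_bidiagonal`). If all of
them kill `r`, then `r` is the image of a sequence over `R^∧`, which descends to `R` as `R` and `R^∧`
have no `p`-torsion and `R / pⁿ = R^∧ / pⁿ` (`exists_descent`).
-/

noncomputable section

/-! ### Hochschild words -/

namespace HochschildWord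

variable (R : Type u) [CommRing R]

/-- The free module on lists of natural numbers. The list `[e₀, …, eₙ]` stands for the chain
`(x ^ e₀, …, x ^ eₙ)`; the empty list has no counterpart among chains. -/
abbrev WordModule : Type u := List ℕ →₀ R

variable {R}

/-- The basis vector of a word. -/
def word (L : List ℕ) : WordModule R := Finsupp.single L 1

/-- The linear map with prescribed values on words. -/
def ofWords (f : List ℕ → WordModule R) : WordModule R →ₗ[R] WordModule R :=
  Finsupp.linearCombination R f

@[simp]
theorem ofWords_word (f : List ℕ → WordModule R) (L : List ℕ) : ofWords f (word L) = f L := by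
  simp [ofWords, word]

theorem hom_ext {M : Type*} [AddCommGroup M] [Module R M] {f g : WordModule R →ₗ[R] M}
    (h : ∀ L, f (word L) = g (word L)) : f = g := by
  ext L
  exact h L

/-- Prepending a letter. -/
def cons (a : ℕ) : WordModule R →ₗ[R] WordModule R := ofWords fun L => word (a :: L)

/-- Appending a letter. -/
def snoc (z : ℕ) : WordModule R →ₗ[R] WordModule R := ofWords fun L => word (L ++ [z])

@[simp]
theorem cons_word (a : ℕ) (L : List ℕ) : cons a (word L : WordModule R) = word (a :: L) := by
  simp [cons]

@[simp]
theorem snoc_word (z : ℕ) (L : List ℕ) : snoc z (word L : WordModule R) = word (L ++ [z]) := by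
  simp [snoc]

theorem cons_snoc (a z : ℕ) (x : WordModule R) : cons a (snoc z x) = snoc z (cons a x) := by
  refine LinearMap.congr_fun (f := cons a ∘ₗ snoc z) (g := snoc z ∘ₗ cons a) (hom_ext fun L => ?_) x
  simp

/-- The alternating sum of the inner faces of a word. -/
def barWord : List ℕ → WordModule R
  | [] => 0
  | [_] => 0
  | a :: b :: L => word ((a + b) :: L) - cons a (barWord (b :: L))

variable (R) in
/-- The bar differential `b' = ∑ (-1) ^ i dᵢ`, without the cyclic face. -/
def bar : WordModule R →ₗ[R] WordModule R := ofWords barWord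

@[simp] theorem bar_nil : bar R (word []) = 0 := by simp [bar, barWord]

@[simp] theorem bar_singleton (a : ℕ) : bar R (word [a]) = 0 := by simp [bar, barWord]

@[simp] theorem bar_cons_cons (a b : ℕ) (L : List ℕ) :
    bar R (word (a :: b :: L)) = word ((a + b) :: L) - cons a (bar R (word (b :: L))) := by
  simp [bar, barWord]

variable (R) in
/-- The face that multiplies the first two letters. -/
def firstFace : WordModule R →ₗ[R] WordModule R :=
  ofWords fun
    | a :: b :: L => word ((a + b) :: L)
    | _ => 0

@[simp] theorem firstFace_nil : firstFace R (word []) = 0 := by simp [firstFace]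

@[simp] theorem firstFace_singleton (a : ℕ) : firstFace R (word [a]) = 0 := by simp [firstFace]

@[simp] theorem firstFace_cons_cons (a b : ℕ) (L : List ℕ) :
    firstFace R (word (a :: b :: L)) = word ((a + b) :: L) := by
  simp [firstFace]

variable (R) in
/-- The cyclic operator `t` with its Koszul sign. -/
def rot : WordModule R →ₗ[R] WordModule R :=
  ofWords fun
    | [] => 0
    | a :: L => (-1 : R) ^ (L.length + (a :: L).getLast (by simp) * (a :: L).dropLast.sum) •
        word ((a :: L).getLast (by simp) :: (a :: L).dropLast)

@[simp] theorem rot_nil : rot R (word []) = 0 := by simp [rot]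

theorem rot_concat (M : List ℕ) (z : ℕ) :
    rot R (word (M ++ [z])) = (-1 : R) ^ (M.length + z * M.sum) • word (z :: M) := by
  cases M with
  | nil => simp [rot]
  | cons a M =>
    simp only [rot, List.cons_append, ofWords_word]
    have h : (a :: (M ++ [z])).dropLast = a :: M := by
      rw [← List.cons_append, List.dropLast_concat]
    rw [h]
    simp

variable (R) in
/-- The extra degeneracy: prepend the unit `1 = x ^ 0`. -/
def degen : WordModule R →ₗ[R] WordModule R :=
  ofWords fun
    | [] => 0
    | a :: L => word (0 :: a :: L)

@[simp] theorem degen_nil : degen R (word []) = 0 := by simp [degen]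

@[simp] theorem degen_cons (a : ℕ) (L : List ℕ) :
    degen R (word (a :: L)) = word (0 :: a :: L) := by simp [degen]

variable (R) in
/-- The norm operator `1 + t + ⋯ + t ^ n` on words with `n + 1` letters. -/
def norm : WordModule R →ₗ[R] WordModule R :=
  ofWords fun L => ∑ i ∈ Finset.range L.length, (rot R ^ i) (word L)

theorem norm_word (L : List ℕ) :
    norm R (word L) = ∑ i ∈ Finset.range L.length, (rot R ^ i) (word L) := by
  simp [norm]

variable (R) in
/-- The Hochschild boundary on words. -/
def hoch : WordModule R →ₗ[R] WordModule R := bar R + firstFace R ∘ₗ rot R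

variable (R) in
/-- The Connes operator on words. -/
def connes : WordModule R →ₗ[R] WordModule R :=
  (LinearMap.id - rot R) ∘ₗ degen R ∘ₗ norm R

/-- The internal differential of a word, for `δ x = p`. -/
def internalWord (p : R) : List ℕ → WordModule R
  | [] => 0
  | a :: L => (if Odd a then p • word ((a - 1) :: L) else 0) +
      (-1 : R) ^ a • cons a (internalWord p L)

/-- The internal differential on words, without the sign of the total complex. -/
def internal (p : R) : WordModule R →ₗ[R] WordModule R := ofWords (internalWord p)

@[simp] theorem internal_nil (p : R) : internal p (word []) = 0 := by simp [internal, internalWord]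

@[simp] theorem internal_cons (p : R) (a : ℕ) (L : List ℕ) :
    internal p (word (a :: L)) = (if Odd a then p • word ((a - 1) :: L) else 0) +
      (-1 : R) ^ a • cons a (internal p (word L)) := by
  simp [internal, internalWord]

variable (R) in
/-- The sign `(-1) ^ n` on words with `n + 1` letters. -/
def lengthSign : WordModule R →ₗ[R] WordModule R :=
  ofWords fun L => (-1 : R) ^ (L.length + 1) • word L

@[simp] theorem lengthSign_word (L : List ℕ) :
    lengthSign R (word L) = (-1 : R) ^ (L.length + 1) • word L := by
  simp [lengthSign]

/-- The differential of the Hochschild complex on words. -/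
def total (p : R) : WordModule R →ₗ[R] WordModule R := hoch R + internal p ∘ₗ lengthSign R

end HochschildWord

namespace HochschildWord
variable {R : Type u} [CommRing R]

/-! ### Homogeneous pieces -/

theorem neg_one_pow_of_even_iff {a b : ℕ} (h : Even a ↔ Even b) : (-1 : R) ^ a = (-1 : R) ^ b := by
  rcases Nat.even_or_odd a with ha | ha
  · rw [ha.neg_one_pow, (h.1 ha).neg_one_pow]
  · rw [ha.neg_one_pow, Odd.neg_one_pow]
    rw [← Nat.not_even_iff_odd] at ha ⊢
    exact fun hb => ha (h.2 hb)

variable (R) in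
/-- The span of the words of length `n` and letter sum `w`. -/
def piece (n : ℕ) (w : ℤ) : Submodule R (WordModule R) :=
  Submodule.span R {x | ∃ L : List ℕ, L.length = n ∧ (L.sum : ℤ) = w ∧ x = word L}

theorem word_mem_piece {L : List ℕ} {n : ℕ} {w : ℤ} (hn : L.length = n) (hw : (L.sum : ℤ) = w) :
    word L ∈ piece R n w :=
  Submodule.subset_span ⟨L, hn, hw, rfl⟩

theorem map_mem_of_mem_piece {M : Type*} [AddCommGroup M] [Module R M] {n : ℕ} {w : ℤ}
    {f : WordModule R →ₗ[R] M} {S : Submodule R M}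
    (h : ∀ L : List ℕ, L.length = n → (L.sum : ℤ) = w → f (word L) ∈ S)
    {x : WordModule R} (hx : x ∈ piece R n w) : f x ∈ S := by
  have : piece R n w ≤ S.comap f := by
    refine Submodule.span_le.2 ?_
    rintro _ ⟨L, hn, hw, rfl⟩
    exact h L hn hw
  exact this hx

theorem eq_of_mem_piece {M : Type*} [AddCommGroup M] [Module R M] {n : ℕ} {w : ℤ}
    {f g : WordModule R →ₗ[R] M}
    (h : ∀ L : List ℕ, L.length = n → (L.sum : ℤ) = w → f (word L) = g (word L))
    {x : WordModule R} (hx : x ∈ piece R n w) : f x = g x := by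
  have := map_mem_of_mem_piece (f := f - g) (S := ⊥) (fun L hn hw => by simp [h L hn hw]) hx
  simpa [sub_eq_zero] using this

theorem cons_mem_piece {n : ℕ} {w : ℤ} {x : WordModule R} (a : ℕ) (hx : x ∈ piece R n w) :
    cons a x ∈ piece R (n + 1) (a + w) := by
  refine map_mem_of_mem_piece (fun L hn hw => ?_) hx
  rw [cons_word]
  exact word_mem_piece (by simp [hn]) (by simp [hw])

theorem bar_mem_piece (L : List ℕ) : bar R (word L) ∈ piece R (L.length - 1) L.sum := by
  induction L with
  | nil => simp
  | cons a L ih =>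
    cases L with
    | nil => simp
    | cons b L =>
      rw [bar_cons_cons]
      refine Submodule.sub_mem _ (word_mem_piece (by simp) (by simp; ring)) ?_
      simpa using cons_mem_piece a ih

theorem firstFace_mem_piece (L : List ℕ) :
    firstFace R (word L) ∈ piece R (L.length - 1) L.sum := by
  match L with
  | [] => simp
  | [a] => simp
  | a :: b :: L =>
    rw [firstFace_cons_cons]
    exact word_mem_piece (by simp) (by simp; ring)

theorem rot_mem_piece {n : ℕ} {w : ℤ} {x : WordModule R} (hx : x ∈ piece R n w) :
    rot R x ∈ piece R n w := by
  refine map_mem_of_mem_piece (fun L hn hw => ?_) hx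
  rcases L.eq_nil_or_concat with rfl | ⟨M, z, rfl⟩
  · simp
  · rw [List.concat_eq_append, rot_concat]
    refine Submodule.smul_mem _ _ (word_mem_piece ?_ ?_)
    · simpa using hn
    · simp at hw ⊢
      linarith

theorem rot_pow_mem_piece {n : ℕ} {w : ℤ} {x : WordModule R} (i : ℕ) (hx : x ∈ piece R n w) :
    (rot R ^ i) x ∈ piece R n w := by
  induction i with
  | zero => simpa
  | succ i ih =>
    rw [pow_succ']
    exact rot_mem_piece ih

theorem internal_mem_piece (p : R) (L : List ℕ) :
    internal p (word L) ∈ piece R L.length (L.sum - 1) := by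
  induction L with
  | nil => simp
  | cons a L ih =>
    rw [internal_cons]
    refine Submodule.add_mem _ ?_ (Submodule.smul_mem _ _ ?_)
    · split_ifs with ha
      · refine Submodule.smul_mem _ _ (word_mem_piece (by simp) ?_)
        have : 1 ≤ a := ha.pos
        push_cast [List.sum_cons, Nat.cast_sub this]
        ring
      · exact Submodule.zero_mem _
    · have e : ((a :: L).sum : ℤ) - 1 = a + (L.sum - 1) := by
        rw [List.sum_cons, Nat.cast_add]
        ring
      rw [e]
      exact cons_mem_piece a ih

theorem rot_snoc {n : ℕ} {w : ℤ} {x : WordModule R} (z : ℕ) (hx : x ∈ piece R n w) (e : ℕ)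
    (he : Even e ↔ Even ((n : ℤ) + z * w)) : rot R (snoc z x) = (-1 : R) ^ e • cons z x := by
  refine eq_of_mem_piece (f := rot R ∘ₗ snoc z) (g := (-1 : R) ^ e • cons z) (fun L hn hw => ?_) hx
  simp only [LinearMap.comp_apply, snoc_word, rot_concat, LinearMap.smul_apply, cons_word]
  rw [neg_one_pow_of_even_iff]
  rw [he, ← hn, ← hw]
  exact_mod_cast Iff.rfl

/-! ### Faces and the cyclic operator -/

theorem bar_cons_cons' (a b : ℕ) (x : WordModule R) :
    bar R (cons a (cons b x)) = cons (a + b) x - cons a (bar R (cons b x)) := by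
  refine LinearMap.congr_fun (f := bar R ∘ₗ cons a ∘ₗ cons b)
    (g := cons (a + b) - cons a ∘ₗ bar R ∘ₗ cons b) (hom_ext fun L => ?_) x
  simp

theorem firstFace_cons_cons' (a b : ℕ) (x : WordModule R) :
    firstFace R (cons a (cons b x)) = cons (a + b) x := by
  refine LinearMap.congr_fun (f := firstFace R ∘ₗ cons a ∘ₗ cons b)
    (g := cons (a + b)) (hom_ext fun L => ?_) x
  simp

theorem bar_bar (x : WordModule R) : bar R (bar R x) = 0 := by
  refine LinearMap.congr_fun (f := bar R ∘ₗ bar R) (g := 0) (hom_ext fun L => ?_) x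
  simp only [LinearMap.comp_apply, LinearMap.zero_apply]
  induction L with
  | nil => simp
  | cons a L ih =>
    match L with
    | [] => simp
    | [b] => simp
    | b :: c :: L =>
      rw [bar_cons_cons b c, map_sub, sub_eq_zero] at ih
      rw [bar_cons_cons, bar_cons_cons b c, map_sub, bar_cons_cons, map_sub, cons_word, map_sub,
        bar_cons_cons, bar_cons_cons', ih, add_assoc]
      abel

/-- The part of `b' ∘ b' = 0` that involves the first face. -/
theorem bar_firstFace (x : WordModule R) :
    bar R (firstFace R x) + firstFace R (bar R x) = firstFace R (firstFace R x) := by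
  refine LinearMap.congr_fun (f := bar R ∘ₗ firstFace R + firstFace R ∘ₗ bar R)
    (g := firstFace R ∘ₗ firstFace R) (hom_ext fun L => ?_) x
  simp only [LinearMap.comp_apply, LinearMap.add_apply]
  match L with
  | [] => simp
  | [a] => simp
  | [a, b] => simp
  | a :: b :: c :: L =>
    rw [bar_cons_cons, bar_cons_cons b c, map_sub, firstFace_cons_cons, bar_cons_cons,
      map_sub, map_sub, firstFace_cons_cons, cons_word, firstFace_cons_cons, firstFace_cons_cons',
      add_assoc]
    abel

theorem firstFace_rot_firstFace_rot (x : WordModule R) :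
    firstFace R (rot R (firstFace R (rot R x))) =
      -firstFace R (firstFace R (rot R (rot R x))) := by
  refine LinearMap.congr_fun (f := firstFace R ∘ₗ rot R ∘ₗ firstFace R ∘ₗ rot R)
    (g := -(firstFace R ∘ₗ firstFace R ∘ₗ rot R ∘ₗ rot R)) (hom_ext fun L => ?_) x
  simp only [LinearMap.comp_apply, LinearMap.neg_apply]
  rcases L.eq_nil_or_concat with rfl | ⟨M, z, rfl⟩
  · simp
  rw [List.concat_eq_append, rot_concat]
  rcases M.eq_nil_or_concat with rfl | ⟨M, y, rfl⟩
  · have := rot_concat (R := R) [] z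
    simp at this
    simp [this]
  rw [List.concat_eq_append]
  simp only [map_smul]
  rw [← List.cons_append, rot_concat]
  cases M with
  | nil =>
    have := rot_concat (R := R) [] (z + y)
    simp at this
    simp [this]
  | cons c M =>
    simp only [map_smul, List.cons_append, firstFace_cons_cons]
    rw [← List.cons_append, ← List.cons_append, rot_concat]
    simp only [map_smul, firstFace_cons_cons, smul_smul, ← neg_smul, ← pow_add]
    rw [← add_assoc y z c, add_comm y z,
      show ∀ e : ℕ, -(-1 : R) ^ e = (-1) ^ (e + 1) by intro e; rw [pow_succ]; ring]
    congr 1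
    apply neg_one_pow_of_even_iff
    simp only [List.length_cons, List.length_append, List.sum_cons, List.sum_append,
      List.length_nil, List.sum_nil, Nat.even_add, Nat.even_mul]
    simp [-Nat.not_even_iff_odd]
    grind

theorem bar_concat (M : List ℕ) (y z : ℕ) :
    bar R (word (M ++ [y] ++ [z])) =
      snoc z (bar R (word (M ++ [y]))) + (-1 : R) ^ M.length • word (M ++ [y + z]) := by
  induction M with
  | nil => simp
  | cons a M ih =>
    cases M with
    | nil =>
      simp
      abel
    | cons b M =>
      simp only [List.cons_append, bar_cons_cons] at ih ⊢
      rw [ih]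
      simp only [map_sub, map_add, map_smul, snoc_word, cons_word, cons_snoc, List.length_cons,
        pow_succ _ (M.length + 1), List.cons_append]
      simp only [mul_neg, mul_one, neg_smul]
      abel

/-- The relations between `t` and the faces, summed over all inner faces. -/
theorem rot_bar (x : WordModule R) :
    rot R (bar R x) =
      bar R (rot R x) - firstFace R (rot R x) + firstFace R (rot R (rot R x)) := by
  refine LinearMap.congr_fun (f := rot R ∘ₗ bar R)
    (g := bar R ∘ₗ rot R - firstFace R ∘ₗ rot R + firstFace R ∘ₗ rot R ∘ₗ rot R)
    (hom_ext fun L => ?_) x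
  simp only [LinearMap.comp_apply, LinearMap.add_apply, LinearMap.sub_apply]
  rcases L.eq_nil_or_concat with rfl | ⟨M, z, rfl⟩
  · simp
  rw [List.concat_eq_append]
  rcases M.eq_nil_or_concat with rfl | ⟨M, y, rfl⟩
  · have := rot_concat (R := R) [] z
    simp at this
    simp [this]
  rw [List.concat_eq_append, rot_concat, bar_concat]
  have h := bar_mem_piece (R := R) (M ++ [y])
  rw [map_add, rot_snoc z h (M.length + z * (M.sum + y)) (by
    rw [show (M ++ [y]).length - 1 = M.length by simp, show (M ++ [y]).sum = M.sum + y by simp]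
    exact_mod_cast Iff.rfl)]
  simp only [map_smul, rot_concat]
  have h1 : bar R (word (z :: (M ++ [y]))) - firstFace R (word (z :: (M ++ [y]))) =
      -cons z (bar R (word (M ++ [y]))) := by
    cases M with
    | nil => simp
    | cons a M => simp
  rw [← smul_sub, h1, ← List.cons_append, rot_concat, map_smul, firstFace_cons_cons]
  simp only [smul_smul, smul_neg, ← neg_smul, ← pow_add]
  rw [show ∀ e : ℕ, -(-1 : R) ^ e = (-1) ^ (e + 1) by intro e; rw [pow_succ]; ring]
  congr 2
  all_goals
    apply neg_one_pow_of_even_iff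
    simp only [List.length_cons, List.length_append, List.sum_cons, List.sum_append,
        List.length_nil, List.sum_nil, Nat.even_add, Nat.even_mul]
    simp [-Nat.not_even_iff_odd]
    try grind

theorem hoch_apply (x : WordModule R) : hoch R x = bar R x + firstFace R (rot R x) := rfl

theorem hoch_hoch (x : WordModule R) : hoch R (hoch R x) = 0 := by
  have h1 := bar_firstFace (rot R x)
  have h2 := firstFace_rot_firstFace_rot x
  have h3 := congrArg (firstFace R) (rot_bar x)
  simp only [hoch_apply, map_add, map_sub, bar_bar] at h3 ⊢
  rw [h3, h2, ← h1]
  abel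

/-- `b (1 - t) = (1 - t) b'`. -/
theorem hoch_sub_rot (x : WordModule R) : hoch R (x - rot R x) = bar R x - rot R (bar R x) := by
  rw [rot_bar]
  simp only [hoch_apply, map_sub]
  abel

theorem degen_cons' (a : ℕ) (x : WordModule R) : degen R (cons a x) = cons 0 (cons a x) := by
  refine LinearMap.congr_fun (f := degen R ∘ₗ cons a)
    (g := cons 0 ∘ₗ cons a) (hom_ext fun L => ?_) x
  simp

theorem bar_degen_cons (a : ℕ) (L : List ℕ) :
    bar R (degen R (word (a :: L))) + degen R (bar R (word (a :: L))) = word (a :: L) := by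
  cases L with
  | nil => simp
  | cons b L => simp [degen_cons']

end HochschildWord

namespace HochschildWord
variable {R : Type u} [CommRing R]

/-! ### The mixed complex identities for words -/

theorem rot_pow_append (M P : List ℕ) :
    (rot R ^ P.length) (word (M ++ P)) =
      (-1 : R) ^ (M.length * P.length + M.sum * P.sum) • word (P ++ M) := by
  induction P using List.reverseRecOn generalizing M with
  | nil => simp
  | append_singleton P z ih =>
    rw [List.length_append, List.length_singleton, pow_succ, Module.End.mul_apply,
      ← List.append_assoc, rot_concat, map_smul, ← List.cons_append, ih, smul_smul, ← pow_add]
    simp only [List.append_assoc, List.singleton_append]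
    congr 1
    apply neg_one_pow_of_even_iff
    simp only [List.length_cons, List.length_append, List.sum_cons, List.sum_append,
      List.sum_nil, Nat.even_add, Nat.even_mul]
    simp [-Nat.not_even_iff_odd]
    grind

theorem rot_pow_of_mem_piece {n : ℕ} {w : ℤ} {x : WordModule R} (hx : x ∈ piece R n w) :
    (rot R ^ n) x = x := by
  refine eq_of_mem_piece (f := rot R ^ n) (g := LinearMap.id) (fun L hn _ => ?_) hx
  simpa [hn] using rot_pow_append (R := R) [] L

theorem norm_of_mem_piece {n : ℕ} {w : ℤ} {x : WordModule R} (hx : x ∈ piece R n w) :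
    norm R x = ∑ i ∈ Finset.range n, (rot R ^ i) x := by
  have := eq_of_mem_piece (f := norm R) (g := ∑ i ∈ Finset.range n, rot R ^ i)
    (fun L hn _ => by simp [norm_word, hn, LinearMap.sum_apply]) hx
  simpa [LinearMap.sum_apply] using this

theorem word_mem_piece_self (L : List ℕ) : word L ∈ piece R L.length L.sum :=
  word_mem_piece rfl rfl

theorem rot_norm (x : WordModule R) : rot R (norm R x) = norm R x := by
  refine LinearMap.congr_fun (f := rot R ∘ₗ norm R) (g := norm R) (hom_ext fun L => ?_) x
  have h := Finset.sum_range_succ' (fun i => (rot R ^ i) (word L)) L.length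
  rw [Finset.sum_range_succ, rot_pow_of_mem_piece (word_mem_piece_self L)] at h
  simp only [pow_zero, Module.End.one_apply, add_left_inj] at h
  rw [LinearMap.comp_apply, norm_word, map_sum, h]
  simp [pow_succ']

theorem norm_rot (x : WordModule R) : norm R (rot R x) = norm R x := by
  refine LinearMap.congr_fun (f := norm R ∘ₗ rot R) (g := norm R) (hom_ext fun L => ?_) x
  have h := rot_norm (word L : WordModule R)
  rw [norm_word, map_sum] at h
  rw [LinearMap.comp_apply, norm_of_mem_piece (rot_mem_piece (word_mem_piece_self L)), norm_word,
    ← h]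
  simp only [← Module.End.mul_apply, ← pow_succ, ← pow_succ']

theorem rot_pow_norm (i : ℕ) (x : WordModule R) : (rot R ^ i) (norm R x) = norm R x := by
  induction i with
  | zero => simp
  | succ i ih => rw [pow_succ', Module.End.mul_apply, ih, rot_norm]

theorem norm_rot_pow (i : ℕ) (x : WordModule R) : norm R ((rot R ^ i) x) = norm R x := by
  induction i with
  | zero => simp
  | succ i ih => rw [pow_succ', Module.End.mul_apply, norm_rot, ih]

/-- The faces of `Q ++ L` that multiply two neighbours in `L`, as conjugates of the first face
under rotation. -/
theorem bar_eq_sum_aux (Q L : List ℕ) :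
    (-1 : R) ^ Q.length • ofWords (fun L => word (Q ++ L)) (bar R (word L)) =
      ∑ q ∈ Finset.range (L.length - 1), (rot R ^ (Q.length + q))
        (firstFace R ((rot R ^ (L.length - q)) (word (Q ++ L)))) := by
  induction L generalizing Q with
  | nil => simp
  | cons a L ih =>
    cases L with
    | nil => simp
    | cons b L =>
      have h := ih (Q ++ [a])
      have e : ofWords (fun L => word (Q ++ [a] ++ L)) =
          ofWords (fun L => word (Q ++ L)) ∘ₗ cons (R := R) a := hom_ext fun L => by simp
      rw [e] at h
      simp only [List.length_cons, Nat.add_sub_cancel] at h ⊢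
      rw [Finset.sum_range_succ']
      rw [bar_cons_cons, map_sub, ofWords_word, smul_sub, sub_eq_add_neg, add_comm]
      congr 1
      · simp only [List.length_append, List.length_cons, List.length_nil, zero_add, pow_succ,
          mul_neg, mul_one, neg_smul, LinearMap.comp_apply, List.append_assoc,
          List.singleton_append] at h
        rw [h]
        refine Finset.sum_congr rfl fun q hq => ?_
        rw [add_assoc Q.length, add_comm 1 q, Nat.add_sub_add_right]
      · have h1 := rot_pow_append (R := R) Q (a :: b :: L)
        have h2 := rot_pow_append (R := R) ((a + b) :: L) Q
        simp only [List.length_cons, List.cons_append] at h1 h2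
        rw [Nat.sub_zero, Nat.add_zero, h1]
        simp only [map_smul, firstFace_cons_cons, h2, smul_smul, ← pow_add]
        congr 1
        apply neg_one_pow_of_even_iff
        simp only [List.sum_cons, Nat.even_add, Nat.even_mul]
        simp [-Nat.not_even_iff_odd]
        grind

/-- The inner faces are the conjugates of the first one under rotation. -/
theorem bar_of_mem_piece {n : ℕ} {w : ℤ} {x : WordModule R} (hx : x ∈ piece R (n + 1) w) :
    bar R x = ∑ q ∈ Finset.range n,
      (rot R ^ q) (firstFace R ((rot R ^ (n + 1 - q)) x)) := by
  have := eq_of_mem_piece (f := bar R) (g := ∑ q ∈ Finset.range n,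
      (rot R ^ q) ∘ₗ (firstFace R) ∘ₗ (rot R ^ (n + 1 - q)))
    (fun L hn _ => by
      have h := bar_eq_sum_aux (R := R) [] L
      have e : ofWords (fun L => word ([] ++ L)) = (LinearMap.id : WordModule R →ₗ[R] _) :=
        hom_ext fun L => by simp
      rw [e] at h
      simpa [hn, LinearMap.sum_apply] using h) hx
  simpa [LinearMap.sum_apply] using this

theorem firstFace_mem_piece' {n : ℕ} {w : ℤ} {x : WordModule R} (hx : x ∈ piece R (n + 1) w) :
    firstFace R x ∈ piece R n w := by
  refine map_mem_of_mem_piece (fun L hn hw => ?_) hx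
  have := firstFace_mem_piece (R := R) L
  rwa [hn, hw] at this

theorem bar_mem_piece' {n : ℕ} {w : ℤ} {x : WordModule R} (hx : x ∈ piece R (n + 1) w) :
    bar R x ∈ piece R n w := by
  refine map_mem_of_mem_piece (fun L hn hw => ?_) hx
  have := bar_mem_piece (R := R) L
  rwa [hn, hw] at this

theorem hoch_mem_piece {n : ℕ} {w : ℤ} {x : WordModule R} (hx : x ∈ piece R (n + 1) w) :
    hoch R x ∈ piece R n w :=
  Submodule.add_mem _ (bar_mem_piece' hx) (firstFace_mem_piece' (rot_mem_piece hx))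

theorem hoch_of_mem_piece {n : ℕ} {w : ℤ} {x : WordModule R} (hx : x ∈ piece R (n + 1) w) :
    hoch R x = ∑ q ∈ Finset.range (n + 1),
      (rot R ^ q) (firstFace R ((rot R ^ (n + 1 - q)) x)) := by
  rw [Finset.sum_range_succ, ← bar_of_mem_piece hx, hoch_apply, Nat.add_sub_cancel_left, pow_one,
    rot_pow_of_mem_piece (firstFace_mem_piece' (rot_mem_piece hx))]

/-- `b' N = N b`: both are `N d₀ N`, with `d₀` the first face. -/
theorem bar_norm (x : WordModule R) : bar R (norm R x) = norm R (hoch R x) := by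
  refine LinearMap.congr_fun (f := bar R ∘ₗ norm R) (g := norm R ∘ₗ hoch R)
    (hom_ext fun L => ?_) x
  cases L with
  | nil => simp [norm_word, hoch_apply]
  | cons a L =>
    simp only [LinearMap.comp_apply]
    have hL : word (a :: L) ∈ piece R (L.length + 1) ((a :: L).sum : ℕ) :=
      word_mem_piece_self (a :: L)
    have hN : norm R (word (a :: L)) ∈ piece R (L.length + 1) ((a :: L).sum : ℕ) := by
      rw [norm_word]
      exact Submodule.sum_mem _ fun i _ => rot_pow_mem_piece i hL
    rw [bar_of_mem_piece hN, hoch_of_mem_piece hL, map_sum]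
    simp only [rot_pow_norm, norm_rot_pow]
    rw [← norm_of_mem_piece (firstFace_mem_piece' hN), ← map_sum, ← map_sum]
    congr 2
    have h := rot_norm (word (a :: L) : WordModule R)
    rw [← h, norm_word, map_sum, ← Finset.sum_range_reflect]
    refine Finset.sum_congr rfl fun i hi => ?_
    rw [← Module.End.mul_apply, ← pow_succ']
    congr 2
    have := Finset.mem_range.1 hi
    simp only [List.length_cons] at this ⊢
    omega

theorem bar_degen {n : ℕ} {w : ℤ} {x : WordModule R} (hx : x ∈ piece R (n + 1) w) :
    bar R (degen R x) + degen R (bar R x) = x := by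
  refine eq_of_mem_piece (f := bar R ∘ₗ degen R + degen R ∘ₗ bar R) (g := LinearMap.id)
    (fun L hn _ => ?_) hx
  cases L with
  | nil => simp at hn
  | cons a L => exact bar_degen_cons a L

theorem connes_apply (x : WordModule R) :
    connes R x = degen R (norm R x) - rot R (degen R (norm R x)) := rfl

theorem hoch_connes (x : WordModule R) : hoch R (connes R x) = -connes R (hoch R x) := by
  refine LinearMap.congr_fun (f := hoch R ∘ₗ connes R) (g := -(connes R ∘ₗ hoch R))
    (hom_ext fun L => ?_) x
  cases L with
  | nil => simp [connes_apply, norm_word, hoch_apply]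
  | cons a L =>
    simp only [LinearMap.comp_apply, LinearMap.neg_apply]
    have hL : word (a :: L) ∈ piece R (L.length + 1) ((a :: L).sum : ℕ) :=
      word_mem_piece_self (a :: L)
    have hN : norm R (word (a :: L)) ∈ piece R (L.length + 1) ((a :: L).sum : ℕ) := by
      rw [norm_word]
      exact Submodule.sum_mem _ fun i _ => rot_pow_mem_piece i hL
    rw [connes_apply, hoch_sub_rot, connes_apply, ← bar_norm,
      eq_sub_of_add_eq (bar_degen hN), map_sub, rot_norm]
    abel

theorem connes_connes (x : WordModule R) : connes R (connes R x) = 0 := by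
  rw [connes_apply, connes_apply x, map_sub (norm R), norm_rot, sub_self]
  simp

/-! ### The internal differential -/

theorem internal_cons' (p : R) (a : ℕ) (x : WordModule R) :
    internal p (cons a x) = (if Odd a then p • cons (a - 1) x else 0) +
      (-1 : R) ^ a • cons a (internal p x) := by
  refine LinearMap.congr_fun (f := internal p ∘ₗ cons a)
    (g := (if Odd a then p • cons (a - 1) else 0) + (-1 : R) ^ a • (cons a ∘ₗ internal p))
    (hom_ext fun L => ?_) x |>.trans ?_
  · split_ifs with h <;> simp [h]
  · split_ifs with h <;> simp

theorem internal_internal (p : R) (x : WordModule R) : internal p (internal p x) = 0 := by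
  refine LinearMap.congr_fun (f := internal p ∘ₗ internal p) (g := 0) (hom_ext fun L => ?_) x
  simp only [LinearMap.comp_apply, LinearMap.zero_apply]
  induction L with
  | nil => simp
  | cons a L ih =>
    rw [internal_cons, map_add, map_smul, internal_cons', ih]
    split_ifs with h
    · rw [map_smul, internal_cons, if_neg (by grind), h.neg_one_pow,
        Even.neg_one_pow (by grind)]
      simp
    · simp

theorem internal_firstFace (p : R) (x : WordModule R) :
    internal p (firstFace R x) = firstFace R (internal p x) := by
  refine LinearMap.congr_fun (f := internal p ∘ₗ firstFace R) (g := firstFace R ∘ₗ internal p)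
    (hom_ext fun L => ?_) x
  simp only [LinearMap.comp_apply]
  match L with
  | [] => simp
  | [a] =>
    simp
    split_ifs <;> simp
  | a :: b :: L =>
    rw [firstFace_cons_cons, internal_cons, internal_cons, internal_cons]
    simp only [map_add, map_smul, firstFace_cons_cons']
    rcases Nat.even_or_odd a with ha | ha <;> rcases Nat.even_or_odd b with hb | hb
    · simp [ha.neg_one_pow, hb.neg_one_pow, (ha.add hb).neg_one_pow, Nat.not_odd_iff_even.2 ha,
        Nat.not_odd_iff_even.2 hb, Nat.not_odd_iff_even.2 (ha.add hb)]
    · have : a + b - 1 = a + (b - 1) := by have := hb.pos; omega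
      simp [ha.neg_one_pow, hb.neg_one_pow, (ha.add_odd hb).neg_one_pow,
        Nat.not_odd_iff_even.2 ha, hb, ha.add_odd hb, this]
    · have : a + b - 1 = a - 1 + b := by have := ha.pos; omega
      simp [ha.neg_one_pow, hb.neg_one_pow, (ha.add_even hb).neg_one_pow,
        Nat.not_odd_iff_even.2 hb, ha, ha.add_even hb, this]
    · have : a - 1 + b = a + (b - 1) := by have := hb.pos; have := ha.pos; omega
      simp [ha.neg_one_pow, hb.neg_one_pow, (ha.add_odd hb).neg_one_pow,
        Nat.not_odd_iff_even.2 (ha.add_odd hb), ha, hb, this]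

theorem internal_bar (p : R) (x : WordModule R) :
    internal p (bar R x) = bar R (internal p x) := by
  refine LinearMap.congr_fun (f := internal p ∘ₗ bar R) (g := bar R ∘ₗ internal p)
    (hom_ext fun L => ?_) x
  simp only [LinearMap.comp_apply]
  induction L with
  | nil => simp
  | cons a L ih =>
    cases L with
    | nil =>
      simp
      split_ifs <;> simp
    | cons b L =>
      have h0 := internal_firstFace p (word (a :: b :: L))
      have h1 : bar R (word (a :: b :: L)) =
          firstFace R (word (a :: b :: L)) - cons a (bar R (word (b :: L))) := by simp
      rw [h1, map_sub, h0, internal_cons', ih]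
      rw [internal_cons p a (b :: L), internal_cons p b L]
      simp only [map_add, map_smul]
      split_ifs <;>
        simp only [map_smul, map_zero, bar_cons_cons', bar_cons_cons, firstFace_cons_cons,
          firstFace_cons_cons', cons_word, zero_add, smul_sub, smul_add] <;> abel

theorem internal_concat (p : R) (M : List ℕ) (z : ℕ) :
    internal p (word (M ++ [z])) = snoc z (internal p (word M)) +
      (-1 : R) ^ M.sum • (if Odd z then p • word (M ++ [z - 1]) else 0) := by
  induction M with
  | nil => simp
  | cons a M ih =>
    simp only [List.cons_append, internal_cons, ih, map_add, map_smul, cons_snoc]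
    split_ifs <;> simp [pow_add, smul_smul, mul_comm, mul_left_comm, add_assoc]

theorem internal_rot (p : R) (x : WordModule R) :
    internal p (rot R x) = rot R (internal p x) := by
  refine LinearMap.congr_fun (f := internal p ∘ₗ rot R) (g := rot R ∘ₗ internal p)
    (hom_ext fun L => ?_) x
  simp only [LinearMap.comp_apply]
  rcases L.eq_nil_or_concat with rfl | ⟨M, z, rfl⟩
  · simp
  rw [List.concat_eq_append, rot_concat, map_smul, internal_cons, internal_concat, map_add,
    rot_snoc z (internal_mem_piece p M) (M.length + z * M.sum + z) ?_, smul_add, add_comm]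
  · congr 1
    · rw [smul_smul, ← pow_add]
    · split_ifs with hz
      · simp only [map_smul, rot_concat, smul_smul]
        rw [mul_right_comm, ← pow_add]
        congr 2
        apply neg_one_pow_of_even_iff
        obtain ⟨k, rfl⟩ := hz
        simp [Nat.even_add, Nat.even_mul]
        grind
      · simp
  · have : (M.length : ℤ) + z * ((M.sum : ℤ) - 1) =
        ((M.length + z * M.sum + z : ℕ) : ℤ) - 2 * z := by
      push_cast
      ring
    rw [this, Int.even_sub, Int.even_coe_nat]
    simp only [even_two_mul, iff_true]

theorem internal_norm (p : R) (x : WordModule R) :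
    internal p (norm R x) = norm R (internal p x) := by
  refine LinearMap.congr_fun (f := internal p ∘ₗ norm R) (g := norm R ∘ₗ internal p)
    (hom_ext fun L => ?_) x
  simp only [LinearMap.comp_apply]
  rw [norm_of_mem_piece (internal_mem_piece p L), norm_word, map_sum]
  refine Finset.sum_congr rfl fun i hi => ?_
  clear hi
  induction i with
  | zero => simp
  | succ i ih => rw [pow_succ', Module.End.mul_apply, Module.End.mul_apply, internal_rot, ih]

theorem internal_degen (p : R) (x : WordModule R) :
    internal p (degen R x) = degen R (internal p x) := by
  refine LinearMap.congr_fun (f := internal p ∘ₗ degen R) (g := degen R ∘ₗ internal p)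
    (hom_ext fun L => ?_) x
  simp only [LinearMap.comp_apply]
  cases L with
  | nil => simp
  | cons a L =>
    rw [degen_cons, internal_cons, internal_cons]
    split_ifs with h h' h' <;> simp_all [degen_cons']

theorem internal_hoch (p : R) (x : WordModule R) :
    internal p (hoch R x) = hoch R (internal p x) := by
  simp only [hoch_apply, map_add, internal_bar, internal_firstFace, internal_rot]

theorem internal_connes (p : R) (x : WordModule R) :
    internal p (connes R x) = connes R (internal p x) := by
  simp only [connes_apply, map_sub, internal_rot, internal_degen, internal_norm]

theorem lengthSign_of_mem_piece {n : ℕ} {w : ℤ} {x : WordModule R} (hx : x ∈ piece R n w) :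
    lengthSign R x = (-1 : R) ^ (n + 1) • x := by
  refine eq_of_mem_piece (f := lengthSign R) (g := (-1 : R) ^ (n + 1) • LinearMap.id)
    (fun L hn _ => ?_) hx
  simp [hn]

theorem degen_mem_piece {n : ℕ} {w : ℤ} {x : WordModule R} (hx : x ∈ piece R n w) :
    degen R x ∈ piece R (n + 1) w := by
  refine map_mem_of_mem_piece (fun L hn hw => ?_) hx
  cases L with
  | nil => simp
  | cons a L =>
    rw [degen_cons]
    exact word_mem_piece (by simpa using hn) (by simpa using hw)

theorem norm_mem_piece {n : ℕ} {w : ℤ} {x : WordModule R} (hx : x ∈ piece R n w) :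
    norm R x ∈ piece R n w := by
  rw [norm_of_mem_piece hx]
  exact Submodule.sum_mem _ fun i _ => rot_pow_mem_piece i hx

theorem connes_mem_piece {n : ℕ} {w : ℤ} {x : WordModule R} (hx : x ∈ piece R n w) :
    connes R x ∈ piece R (n + 1) w := by
  have := degen_mem_piece (norm_mem_piece hx)
  exact Submodule.sub_mem _ this (rot_mem_piece this)

theorem lengthSign_hoch (x : WordModule R) :
    lengthSign R (hoch R x) = -hoch R (lengthSign R x) := by
  refine LinearMap.congr_fun (f := lengthSign R ∘ₗ hoch R) (g := -(hoch R ∘ₗ lengthSign R))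
    (hom_ext fun L => ?_) x
  simp only [LinearMap.comp_apply, LinearMap.neg_apply]
  cases L with
  | nil => simp [hoch_apply]
  | cons a L =>
    rw [lengthSign_of_mem_piece (hoch_mem_piece (word_mem_piece_self (a :: L))), lengthSign_word,
      map_smul, List.length_cons, pow_succ _ (L.length + 1), mul_neg, mul_one, neg_smul, neg_neg]

theorem lengthSign_connes (x : WordModule R) :
    lengthSign R (connes R x) = -connes R (lengthSign R x) := by
  refine LinearMap.congr_fun (f := lengthSign R ∘ₗ connes R) (g := -(connes R ∘ₗ lengthSign R))
    (hom_ext fun L => ?_) x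
  simp only [LinearMap.comp_apply, LinearMap.neg_apply]
  rw [lengthSign_of_mem_piece (connes_mem_piece (word_mem_piece_self L)), lengthSign_word,
      map_smul, pow_succ, mul_neg, mul_one, neg_smul]

theorem lengthSign_internal (p : R) (x : WordModule R) :
    lengthSign R (internal p x) = internal p (lengthSign R x) := by
  refine LinearMap.congr_fun (f := lengthSign R ∘ₗ internal p) (g := internal p ∘ₗ lengthSign R)
    (hom_ext fun L => ?_) x
  simp only [LinearMap.comp_apply]
  rw [lengthSign_of_mem_piece (internal_mem_piece p L), lengthSign_word, map_smul]

theorem total_apply (p : R) (x : WordModule R) :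
    total p x = hoch R x + internal p (lengthSign R x) := rfl

theorem total_total (p : R) (x : WordModule R) : total p (total p x) = 0 := by
  simp only [total_apply, map_add, hoch_hoch, lengthSign_hoch, lengthSign_internal,
    internal_internal, internal_hoch, map_neg]
  abel

theorem total_connes (p : R) (x : WordModule R) : total p (connes R x) = -connes R (total p x) := by
  simp only [total_apply, map_add, hoch_connes, lengthSign_connes, map_neg, internal_connes,
    neg_add]

end HochschildWord

namespace HochschildWord
variable {R : Type u} [CommRing R]

/-! ### The small complex -/

variable (R) in
/-- The coefficient of `x ^ (i + j - 1) dx` in the class of `x ^ i d(x ^ j)` modulo graded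
commutators, that is `∑ₗ (-1) ^ ((j - 1 - l) (i + l + 1))` over `l < j`. -/
def smallCoeff (i j : ℕ) : R :=
  if Even i then (if Even j then 0 else j) else (if Even j then j else 1)

variable (R) in
/-- The coefficient of `x ^ n` in the image of a chain in the small complex. -/
def smallZero (n : ℕ) : WordModule R →ₗ[R] R := Finsupp.lapply [n]

variable (R) in
/-- The coefficient of `x ^ n dx` in the image of a chain in the small complex. -/
def smallOne (n : ℕ) : WordModule R →ₗ[R] R :=
  Finsupp.linearCombination R fun
    | [i, j] => if i + j = n + 1 then smallCoeff R i j else 0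
    | _ => 0

theorem smallZero_singleton (n m : ℕ) :
    smallZero R n (word [m]) = if m = n then 1 else 0 := by
  simp [smallZero, word, Finsupp.single_apply]

theorem smallZero_of_length_ne {n : ℕ} {L : List ℕ} (h : L.length ≠ 1) :
    smallZero R n (word L) = 0 := by
  have : L ≠ [n] := fun e => h (by simp [e])
  simp [smallZero, word, this]

theorem smallZero_eq_zero {n l : ℕ} {w : ℤ} {x : WordModule R} (hx : x ∈ piece R l w)
    (h : l ≠ 1) : smallZero R n x = 0 :=
  eq_of_mem_piece (g := 0) (fun L hL _ => smallZero_of_length_ne (by omega)) hx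

theorem smallOne_pair (n i j : ℕ) :
    smallOne R n (word [i, j]) = if i + j = n + 1 then smallCoeff R i j else 0 := by
  simp [smallOne, word]

theorem smallOne_of_length_ne {n : ℕ} {L : List ℕ} (h : L.length ≠ 2) :
    smallOne R n (word L) = 0 := by
  match L with
  | [] => simp [smallOne, word]
  | [a] => simp [smallOne, word]
  | [a, b] => simp at h
  | a :: b :: c :: L => simp [smallOne, word]

theorem smallOne_eq_zero {n l : ℕ} {w : ℤ} {x : WordModule R} (hx : x ∈ piece R l w)
    (h : l ≠ 2) : smallOne R n x = 0 :=
  eq_of_mem_piece (g := 0) (fun L hL _ => smallOne_of_length_ne (by omega)) hx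

theorem rot_singleton (a : ℕ) : rot R (word [a]) = word [a] := by
  simpa using rot_concat (R := R) [] a

theorem rot_pair (a b : ℕ) : rot R (word [a, b]) = (-1 : R) ^ (1 + b * a) • word [b, a] := by
  simpa using rot_concat (R := R) [a] b

theorem rot_triple (a b c : ℕ) :
    rot R (word [a, b, c]) = (-1 : R) ^ (2 + c * (a + b)) • word [c, a, b] := by
  simpa using rot_concat (R := R) [a, b] c

theorem hoch_pair (i j : ℕ) :
    hoch R (word [i, j]) = (1 + (-1 : R) ^ (1 + j * i)) • word [i + j] := by
  simp only [hoch_apply, bar_cons_cons, bar_singleton, rot_pair, map_smul, firstFace_cons_cons,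
    map_zero, sub_zero, add_smul, one_smul, add_comm j i]

theorem hoch_triple (i j k : ℕ) :
    hoch R (word [i, j, k]) = word [i + j, k] - word [i, j + k] +
      (-1 : R) ^ (2 + k * (i + j)) • word [k + i, j] := by
  simp [hoch_apply, rot_triple]

/-- The sign of the graded commutator `x ^ i x ^ j ± x ^ j x ^ i` in terms of `smallCoeff`: it makes
the boundary of `x ^ n dx` in the small complex equal to `(1 - (-1) ^ n) x ^ (n + 1)`. -/
theorem one_add_neg_one_pow_eq (i j : ℕ) :
    (1 + (-1 : R) ^ (1 + j * i)) = (1 - (-1) ^ (i + j + 1)) * smallCoeff R i j := by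
  rcases Nat.even_or_odd i with hi | hi <;> rcases Nat.even_or_odd j with hj | hj
  · rw [Odd.neg_one_pow (by grind)]
    simp [smallCoeff, hi, hj]
  · rw [Odd.neg_one_pow (by rw [add_comm]; exact Even.add_one (hi.mul_left j)),
      Even.neg_one_pow (by grind)]
    simp
  · rw [Odd.neg_one_pow (by rw [add_comm]; exact Even.add_one (hj.mul_right i)),
      Even.neg_one_pow (by grind)]
    simp
  · rw [Even.neg_one_pow (by rw [add_comm]; exact Odd.add_one (hj.mul hi)),
      Odd.neg_one_pow (by grind)]
    simp [smallCoeff, Nat.not_even_iff_odd.2 hi, Nat.not_even_iff_odd.2 hj]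

/-- `x ^ i d(x ^ j)` modulo graded commutators satisfies the Leibniz rule. -/
theorem smallCoeff_cocycle (i j k : ℕ) :
    smallCoeff R (i + j) k - smallCoeff R i (j + k) +
      (-1) ^ (2 + k * (i + j)) * smallCoeff R (k + i) j = 0 := by
  rcases Nat.even_or_odd i with hi | hi <;> rcases Nat.even_or_odd j with hj | hj <;>
    rcases Nat.even_or_odd k with hk | hk <;>
    simp only [smallCoeff, hi, hj, hk, Nat.even_add, Nat.not_even_iff_odd.2, pow_add, pow_mul,
      Even.neg_one_pow, Odd.neg_one_pow, even_two, if_true, if_false, Nat.cast_add, one_pow,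
      iff_true, iff_false, not_true] <;> ring

theorem hoch_cons_mem_piece (a : ℕ) (L : List ℕ) :
    hoch R (word (a :: L)) ∈ piece R L.length ((a :: L).sum : ℕ) :=
  hoch_mem_piece (word_mem_piece_self (a :: L))

theorem smallZero_hoch_zero (x : WordModule R) : smallZero R 0 (hoch R x) = 0 := by
  refine LinearMap.congr_fun (f := smallZero R 0 ∘ₗ hoch R) (g := 0) (hom_ext fun L => ?_) x
  simp only [LinearMap.comp_apply, LinearMap.zero_apply]
  match L with
  | [] => simp [hoch_apply]
  | [a] => simp [hoch_apply, rot_singleton]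
  | [a, b] =>
    rw [hoch_pair, map_smul, smallZero_singleton]
    split_ifs with h
    · obtain ⟨rfl, rfl⟩ : a = 0 ∧ b = 0 := by omega
      simp
    · simp
  | a :: b :: c :: L =>
    exact smallZero_eq_zero (hoch_cons_mem_piece a (b :: c :: L)) (by simp)

theorem smallZero_hoch_succ (n : ℕ) (x : WordModule R) :
    smallZero R (n + 1) (hoch R x) = (1 - (-1) ^ n) * smallOne R n x := by
  refine LinearMap.congr_fun (f := smallZero R (n + 1) ∘ₗ hoch R)
    (g := (1 - (-1) ^ n : R) • smallOne R n) (hom_ext fun L => ?_) x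
  simp only [LinearMap.comp_apply, LinearMap.smul_apply, smul_eq_mul]
  match L with
  | [] => simp [hoch_apply, smallOne_of_length_ne]
  | [a] => simp [hoch_apply, rot_singleton, smallOne_of_length_ne]
  | [a, b] =>
    rw [hoch_pair, map_smul, smallZero_singleton, smallOne_pair, one_add_neg_one_pow_eq]
    split_ifs with h
    · rw [h]
      simp [pow_succ]
    · simp
  | a :: b :: c :: L =>
    rw [smallOne_of_length_ne (by simp), mul_zero]
    exact smallZero_eq_zero (hoch_cons_mem_piece a (b :: c :: L)) (by simp)

theorem smallOne_hoch (n : ℕ) (x : WordModule R) : smallOne R n (hoch R x) = 0 := by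
  refine LinearMap.congr_fun (f := smallOne R n ∘ₗ hoch R) (g := 0) (hom_ext fun L => ?_) x
  simp only [LinearMap.comp_apply, LinearMap.zero_apply]
  match L with
  | [] => simp [hoch_apply]
  | [a] => simp [hoch_apply, rot_singleton]
  | [a, b] => exact smallOne_eq_zero (hoch_cons_mem_piece a [b]) (by simp)
  | [a, b, c] =>
    rw [hoch_triple]
    simp only [map_add, map_sub, map_smul, smallOne_pair, smul_eq_mul]
    rw [← add_assoc a b c, add_right_comm c a b, add_comm (c + b) a, add_comm c b, ← add_assoc a b c]
    split_ifs with h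
    · rw [smallCoeff_cocycle]
    · simp
  | a :: b :: c :: d :: L =>
    exact smallOne_eq_zero (hoch_cons_mem_piece a (b :: c :: d :: L)) (by simp)

theorem smallZero_internal (p : R) (n : ℕ) (x : WordModule R) :
    smallZero R n (internal p (lengthSign R x)) =
      if Even n then p * smallZero R (n + 1) x else 0 := by
  refine LinearMap.congr_fun (f := smallZero R n ∘ₗ internal p ∘ₗ lengthSign R)
    (g := if Even n then p • smallZero R (n + 1) else 0) (hom_ext fun L => ?_) x |>.trans ?_
  · simp only [LinearMap.comp_apply, lengthSign_word, map_smul]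
    by_cases hL : L.length = 1
    · obtain ⟨a, rfl⟩ := List.length_eq_one_iff.1 hL
      simp only [internal_cons, internal_nil, map_zero, smul_zero, add_zero]
      split_ifs with ha hn hn
      · have := ha.pos
        simp [smallZero_singleton, show a - 1 = n ↔ a = n + 1 by omega]
      · have := ha.pos
        simp [smallZero_singleton, show a - 1 = n ↔ a = n + 1 by omega]
        grind
      · simp [smallZero_singleton]
        grind
      · simp
    · rw [smallZero_eq_zero (internal_mem_piece p L) hL, smul_zero]
      split_ifs <;> simp [smallZero_of_length_ne hL]
  · split_ifs <;> simp

theorem smallOne_internal (p : R) (n : ℕ) (x : WordModule R) :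
    smallOne R n (internal p (lengthSign R x)) =
      if Even n then -(p * smallOne R (n + 1) x) else 0 := by
  refine LinearMap.congr_fun (f := smallOne R n ∘ₗ internal p ∘ₗ lengthSign R)
    (g := if Even n then -(p • smallOne R (n + 1)) else 0) (hom_ext fun L => ?_) x |>.trans ?_
  · simp only [LinearMap.comp_apply, lengthSign_word, map_smul]
    by_cases hL : L.length = 2
    · obtain ⟨a, b, rfl⟩ := List.length_eq_two.1 hL
      simp only [internal_cons, internal_nil, map_zero, smul_zero, add_zero]
      rcases Nat.even_or_odd a with ha | ha <;> rcases Nat.even_or_odd b with hb | hb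
      · have h1 : ∀ k, smallOne R k (word [a, b]) = 0 := by
          simp [smallOne_pair, smallCoeff, ha, hb]
        split_ifs <;> simp_all [Nat.not_odd_iff_even.2 ha, Nat.not_odd_iff_even.2 hb]
      · have h1 : smallOne R n (word [a, b - 1]) = 0 := by
          simp [smallOne_pair, smallCoeff, ha, show Even (b - 1) by grind]
        have h2 : (if Even n then -(p • smallOne R (n + 1)) else 0) (word [a, b]) = 0 := by
          split_ifs with hn
          · rw [LinearMap.neg_apply, LinearMap.smul_apply, smallOne_pair, if_neg (by grind)]
            simp
          · simp
        simp [h1, h2, Nat.not_odd_iff_even.2 ha, hb]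
      · have h1 : smallOne R n (word [a - 1, b]) = 0 := by
          simp [smallOne_pair, smallCoeff, hb, show Even (a - 1) by grind]
        have h2 : (if Even n then -(p • smallOne R (n + 1)) else 0) (word [a, b]) = 0 := by
          split_ifs with hn
          · rw [LinearMap.neg_apply, LinearMap.smul_apply, smallOne_pair, if_neg (by grind)]
            simp
          · simp
        simp [h1, h2, Nat.not_odd_iff_even.2 hb, ha]
      · have e1 : Even (a - 1) := by grind
        have e2 : Even (b - 1) := by grind
        have hpa := ha.pos
        have hpb := hb.pos
        simp only [ha, hb, if_true, cons_word, map_add, map_smul, smallOne_pair, smallCoeff, e1, e2,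
          Nat.not_even_iff_odd.2 ha, Nat.not_even_iff_odd.2 hb, if_false, ha.neg_one_pow,
          show a - 1 + b = n + 1 ↔ a + b = n + 1 + 1 by omega,
          show a + (b - 1) = n + 1 ↔ a + b = n + 1 + 1 by omega]
        split_ifs with h hn hn
        · simp only [LinearMap.neg_apply, LinearMap.smul_apply, smallOne_pair, h, if_true,
            smallCoeff, Nat.not_even_iff_odd.2 ha, Nat.not_even_iff_odd.2 hb, if_false]
          simp [Nat.cast_sub hpb]
          ring
        · grind
        · simp [smallOne_pair, h]
        · simp
    · rw [smallOne_eq_zero (internal_mem_piece p L) hL, smul_zero]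
      split_ifs <;> simp [smallOne_of_length_ne hL]
  · split_ifs <;> simp

theorem smallZero_connes (n : ℕ) (x : WordModule R) : smallZero R n (connes R x) = 0 := by
  refine LinearMap.congr_fun (f := smallZero R n ∘ₗ connes R) (g := 0) (hom_ext fun L => ?_) x
  cases L with
  | nil => simp [connes_apply, norm_word]
  | cons a L => exact smallZero_eq_zero (connes_mem_piece (word_mem_piece_self (a :: L))) (by simp)

theorem smallOne_connes (n : ℕ) (x : WordModule R) :
    smallOne R n (connes R x) = if Even n then (n + 1 : R) * smallZero R (n + 1) x else 0 := by
  refine LinearMap.congr_fun (f := smallOne R n ∘ₗ connes R)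
    (g := if Even n then (n + 1 : R) • smallZero R (n + 1) else 0)
    (hom_ext fun L => ?_) x |>.trans ?_
  · simp only [LinearMap.comp_apply]
    by_cases hL : L.length = 1
    · obtain ⟨a, rfl⟩ := List.length_eq_one_iff.1 hL
      have h : connes R (word [a]) = word [0, a] + word [a, 0] := by
        simp [connes_apply, norm_word, rot_pair]
      rw [h, map_add, smallOne_pair, smallOne_pair, zero_add, add_zero]
      by_cases han : a = n + 1
      · subst han
        simp only [smallCoeff, if_true]
        split_ifs <;> simp_all [smallZero_singleton, Nat.even_add_one]
      · split_ifs <;> simp_all [smallZero_singleton]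
    · have h := connes_mem_piece (R := R) (word_mem_piece_self L)
      rw [smallOne_eq_zero h (by omega)]
      split_ifs <;> simp [smallZero_of_length_ne hL]
  · split_ifs <;> simp

theorem smallZero_total_zero (p : R) (x : WordModule R) :
    smallZero R 0 (total p x) = p * smallZero R 1 x := by
  rw [total_apply, map_add, smallZero_hoch_zero, smallZero_internal]
  simp

theorem smallZero_total_even (p : R) (k : ℕ) (x : WordModule R) :
    smallZero R (2 * (k + 1)) (total p x) =
      2 * smallOne R (2 * k + 1) x + p * smallZero R (2 * (k + 1) + 1) x := by
  rw [total_apply, map_add, smallZero_internal, if_pos (by simp)]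
  rw [show 2 * (k + 1) = 2 * k + 1 + 1 by ring, smallZero_hoch_succ, Odd.neg_one_pow (by simp)]
  ring

theorem smallOne_total_even (p : R) (k : ℕ) (x : WordModule R) :
    smallOne R (2 * k) (total p x) = -(p * smallOne R (2 * k + 1) x) := by
  rw [total_apply, map_add, smallOne_hoch, smallOne_internal, if_pos (by simp), zero_add]

theorem smallZero_total_odd (p : R) (k : ℕ) (x : WordModule R) :
    smallZero R (2 * k + 1) (total p x) = 0 := by
  rw [total_apply, map_add, smallZero_internal, if_neg (by simp), smallZero_hoch_succ,
    Even.neg_one_pow (by simp)]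
  ring

theorem smallOne_total_odd (p : R) (k : ℕ) (x : WordModule R) :
    smallOne R (2 * k + 1) (total p x) = 0 := by
  rw [total_apply, map_add, smallOne_internal, if_neg (by simp), smallOne_hoch, add_zero]

end HochschildWord

namespace HochschildWord
variable {R : Type u} [CommRing R]

/-! ### The contraction onto the small complex -/

variable (R) in
/-- The contracting homotopy
`(a₀, a₁, …) ↦ (a₀ a₁, 1, 1, a₂, …) - ∑ₗ (a₀ x ^ l, x, x ^ (e - 1 - l), a₂, …)`, for `a₁ = x ^ e`
and the sum over `l < e`; it is zero on words with fewer than two letters. -/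
def contract : WordModule R →ₗ[R] WordModule R :=
  ofWords fun
    | a :: c :: L => word ((a + c) :: 0 :: 0 :: L) -
        ∑ l ∈ Finset.range c, word ((a + l) :: 1 :: (c - 1 - l) :: L)
    | _ => 0

@[simp] theorem contract_nil : contract R (word []) = 0 := by simp [contract]

@[simp] theorem contract_singleton (a : ℕ) : contract R (word [a]) = 0 := by simp [contract]

theorem contract_cons_cons (a c : ℕ) (L : List ℕ) :
    contract R (word (a :: c :: L)) = word ((a + c) :: 0 :: 0 :: L) -
      ∑ l ∈ Finset.range c, word ((a + l) :: 1 :: (c - 1 - l) :: L) := by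
  simp [contract]

theorem contract_cons_cons' (a c : ℕ) (x : WordModule R) :
    contract R (cons a (cons c x)) = cons (a + c) (cons 0 (cons 0 x)) -
      ∑ l ∈ Finset.range c, cons (a + l) (cons 1 (cons (c - 1 - l) x)) := by
  refine (LinearMap.congr_fun (f := contract R ∘ₗ cons a ∘ₗ cons c)
    (g := cons (a + c) ∘ₗ cons 0 ∘ₗ cons 0 -
      ∑ l ∈ Finset.range c, cons (a + l) ∘ₗ cons 1 ∘ₗ cons (c - 1 - l))
    (hom_ext fun L => ?_) x).trans ?_
  · simp [contract_cons_cons, LinearMap.sum_apply]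
  · simp [LinearMap.sum_apply]

variable (R) in
/-- The projection onto the copy of the small complex spanned by the words `[n]` and `[n, 1]`. -/
def smallProj : WordModule R →ₗ[R] WordModule R :=
  ofWords fun
    | [a] => word [a]
    | [i, j] => smallCoeff R i j • word [i + j - 1, 1]
    | _ => 0

@[simp] theorem smallProj_singleton (a : ℕ) : smallProj R (word [a]) = word [a] := by
  simp [smallProj]

theorem smallProj_pair (i j : ℕ) :
    smallProj R (word [i, j]) = smallCoeff R i j • word [i + j - 1, 1] := by
  simp [smallProj]

@[simp] theorem smallProj_nil : smallProj R (word []) = 0 := by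
  simp [smallProj]

@[simp] theorem smallProj_cons_cons_cons (a b c : ℕ) (L : List ℕ) :
    smallProj R (word (a :: b :: c :: L)) = 0 := by
  simp [smallProj]

theorem word_apply (L M : List ℕ) : (word L : WordModule R) M = if L = M then 1 else 0 :=
  Finsupp.single_apply

theorem smallProj_apply_singleton (x : WordModule R) (n : ℕ) :
    smallProj R x [n] = smallZero R n x := by
  refine LinearMap.congr_fun (f := Finsupp.lapply [n] ∘ₗ smallProj R) (g := smallZero R n)
    (hom_ext fun M => ?_) x
  match M with
  | [] => simp [smallZero_of_length_ne]
  | [a] => simp [smallZero]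
  | [i, j] => simp [smallProj_pair, smallZero_of_length_ne, word_apply]
  | _ :: _ :: _ :: _ => simp [smallZero_of_length_ne]

theorem smallProj_apply_pair (x : WordModule R) (n : ℕ) :
    smallProj R x [n, 1] = smallOne R n x := by
  refine LinearMap.congr_fun (f := Finsupp.lapply [n, 1] ∘ₗ smallProj R) (g := smallOne R n)
    (hom_ext fun M => ?_) x
  match M with
  | [] => simp [smallOne_of_length_ne]
  | [a] => simp [smallOne_of_length_ne, word_apply]
  | [i, j] =>
    by_cases h : i + j = 0
    · obtain ⟨rfl, rfl⟩ : i = 0 ∧ j = 0 := by omega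
      simp [smallProj_pair, smallOne_pair, smallCoeff]
    · have h1 : i + j - 1 = n ↔ i + j = n + 1 := by omega
      simp [smallProj_pair, smallOne_pair, word_apply, h1]
  | _ :: _ :: _ :: _ => simp [smallOne_of_length_ne]

theorem smallProj_apply_of_ne (x : WordModule R) (L : List ℕ) (h0 : ∀ n, L ≠ [n])
    (h1 : ∀ n, L ≠ [n, 1]) : smallProj R x L = 0 := by
  refine LinearMap.congr_fun (f := Finsupp.lapply L ∘ₗ smallProj R) (g := 0)
    (hom_ext fun M => ?_) x
  match M with
  | [] => simp
  | [a] => simp [word_apply, (h0 a).symm]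
  | [i, j] => simp [smallProj_pair, word_apply, (h1 _).symm]
  | _ :: _ :: _ :: _ => simp

/-- The kernel of `smallProj` is the kernel of the projection to the small complex. -/
theorem smallProj_eq_zero {x : WordModule R} (h0 : ∀ n, smallZero R n x = 0)
    (h1 : ∀ n, smallOne R n x = 0) : smallProj R x = 0 := by
  ext L
  by_cases hL : ∃ n, L = [n]
  · obtain ⟨n, rfl⟩ := hL
    rw [smallProj_apply_singleton, h0]
    rfl
  by_cases hL' : ∃ n, L = [n, 1]
  · obtain ⟨n, rfl⟩ := hL'
    rw [smallProj_apply_pair, h1]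
    rfl
  exact smallProj_apply_of_ne x L (fun n e => hL ⟨n, e⟩) (fun n e => hL' ⟨n, e⟩)

theorem sum_range_neg_one_pow (n : ℕ) :
    ∑ l ∈ Finset.range n, (-1 : R) ^ l = if Even n then 0 else 1 := by
  induction n with
  | zero => simp
  | succ n ih =>
    rw [Finset.sum_range_succ, ih]
    rcases Nat.even_or_odd n with h | h
    · simp [h, h.neg_one_pow, Nat.even_add_one]
    · simp [Nat.not_even_iff_odd.2 h, h.neg_one_pow, Nat.even_add_one]

theorem smallCoeff_eq_sum (a c : ℕ) :
    smallCoeff R a c = ∑ l ∈ Finset.range c, (-1 : R) ^ ((c - 1 - l) * (a + l + 1)) := by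
  rcases Nat.even_or_odd a with ha | ha <;> rcases Nat.even_or_odd c with hc | hc
  · have : ∀ l ∈ Finset.range c, (-1 : R) ^ ((c - 1 - l) * (a + l + 1)) = -(-1) ^ l := by
      intro l hl
      have hl := Finset.mem_range.1 hl
      rw [← neg_one_mul ((-1 : R) ^ l), ← pow_succ']
      apply neg_one_pow_of_even_iff
      rw [Nat.even_mul]
      grind
    rw [Finset.sum_congr rfl this, Finset.sum_neg_distrib, sum_range_neg_one_pow]
    simp [smallCoeff, ha, hc]
  · have : ∀ l ∈ Finset.range c, (-1 : R) ^ ((c - 1 - l) * (a + l + 1)) = 1 := by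
      intro l hl
      have hl := Finset.mem_range.1 hl
      apply Even.neg_one_pow
      rw [Nat.even_mul]
      grind
    rw [Finset.sum_congr rfl this]
    simp [smallCoeff, ha, Nat.not_even_iff_odd.2 hc]
  · have : ∀ l ∈ Finset.range c, (-1 : R) ^ ((c - 1 - l) * (a + l + 1)) = 1 := by
      intro l hl
      have hl := Finset.mem_range.1 hl
      apply Even.neg_one_pow
      rw [Nat.even_mul]
      grind
    rw [Finset.sum_congr rfl this]
    simp [smallCoeff, Nat.not_even_iff_odd.2 ha, hc]
  · have : ∀ l ∈ Finset.range c, (-1 : R) ^ ((c - 1 - l) * (a + l + 1)) = (-1) ^ l := by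
      intro l hl
      have hl := Finset.mem_range.1 hl
      apply neg_one_pow_of_even_iff
      rw [Nat.even_mul]
      grind
    rw [Finset.sum_congr rfl this, sum_range_neg_one_pow]
    simp [smallCoeff, Nat.not_even_iff_odd.2 ha, Nat.not_even_iff_odd.2 hc]

theorem bar_cons_cons_cons (a b c : ℕ) (L : List ℕ) :
    bar R (word (a :: b :: c :: L)) = word ((a + b) :: c :: L) - word (a :: (b + c) :: L) +
      cons a (cons b (bar R (word (c :: L)))) := by
  rw [bar_cons_cons, bar_cons_cons, map_sub, cons_word]
  abel

theorem sum_range_word_telescope (a c : ℕ) (L : List ℕ) :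
    ∑ l ∈ Finset.range c, ((word ((a + l + 1) :: (c - 1 - l) :: L) : WordModule R) -
      word ((a + l) :: (1 + (c - 1 - l)) :: L)) = word ((a + c) :: 0 :: L) - word (a :: c :: L) := by
  have h := Finset.sum_range_sub (fun l => (word ((a + l) :: (c - l) :: L) : WordModule R)) c
  rw [Nat.sub_self, Nat.add_zero, Nat.sub_zero] at h
  rw [← h]
  refine Finset.sum_congr rfl fun l hl => ?_
  have := Finset.mem_range.1 hl
  rw [show 1 + (c - 1 - l) = c - l by omega, show c - 1 - l = c - (l + 1) by omega, add_assoc]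

/-- On words with at least three letters `contract` is a homotopy for the inner faces alone. -/
theorem bar_contract (a c e : ℕ) (L : List ℕ) :
    bar R (contract R (word (a :: c :: e :: L))) + contract R (bar R (word (a :: c :: e :: L))) =
      word (a :: c :: e :: L) := by
  have h1 := sum_range_word_telescope (R := R) a c (e :: L)
  have h2 : ∑ l ∈ Finset.range (c + e), (word ((a + l) :: 1 :: (c + e - 1 - l) :: L) : WordModule R)
      = ∑ l ∈ Finset.range c, (word ((a + l) :: 1 :: (c - 1 - l + e) :: L) : WordModule R) +
        ∑ l ∈ Finset.range e, word ((a + c + l) :: 1 :: (e - 1 - l) :: L) := by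
    rw [Finset.sum_range_add]
    congr 1
    · refine Finset.sum_congr rfl fun l hl => ?_
      have := Finset.mem_range.1 hl
      rw [show c + e - 1 - l = c - 1 - l + e by omega]
    · refine Finset.sum_congr rfl fun l hl => ?_
      rw [show c + e - 1 - (c + l) = e - 1 - l by omega, add_assoc]
  have h3 : ∑ l ∈ Finset.range c, bar R (word ((a + l) :: 1 :: (c - 1 - l) :: e :: L)) =
      word ((a + c) :: 0 :: e :: L) - word (a :: c :: e :: L) +
        (∑ l ∈ Finset.range c, (word ((a + l) :: 1 :: (c - 1 - l + e) :: L) : WordModule R) -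
        ∑ l ∈ Finset.range c, cons (a + l) (cons 1 (cons (c - 1 - l) (bar R (word (e :: L)))))) := by
    rw [← h1, ← Finset.sum_sub_distrib, ← Finset.sum_add_distrib]
    refine Finset.sum_congr rfl fun l _ => ?_
    rw [bar_cons_cons_cons, bar_cons_cons, map_sub, map_sub, cons_word, cons_word]
  rw [contract_cons_cons, map_sub, map_sum, h3, bar_cons_cons_cons, bar_cons_cons_cons,
    map_add, map_sub, contract_cons_cons, contract_cons_cons, contract_cons_cons', h2,
    bar_cons_cons 0]
  simp only [map_sub, cons_word, zero_add, add_zero]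
  rw [add_assoc a c e]
  abel

/-- The cyclic face and the homotopy anticommute on words with at least three letters. -/
theorem firstFace_rot_contract (a c z : ℕ) (M : List ℕ) :
    firstFace R (rot R (contract R (word (a :: c :: (M ++ [z]))))) +
      contract R (firstFace R (rot R (word (a :: c :: (M ++ [z]))))) = 0 := by
  have h1 : rot R (word (a :: c :: (M ++ [z]))) =
      (-1 : R) ^ (M.length + z * (a + c + M.sum)) • word (z :: a :: c :: M) := by
    have := rot_concat (R := R) (a :: c :: M) z
    rw [List.cons_append, List.cons_append] at this
    rw [this]
    congr 1
    apply neg_one_pow_of_even_iff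
    simp only [List.length_cons, List.sum_cons, ← add_assoc, Nat.even_add_one, Nat.even_add]
    simp
  have h2 : ∀ i j k : ℕ, i + j + k = a + c → rot R (word (i :: j :: k :: (M ++ [z]))) =
      -((-1 : R) ^ (M.length + z * (a + c + M.sum)) • word (z :: i :: j :: k :: M)) := by
    intro i j k hs
    have := rot_concat (R := R) (i :: j :: k :: M) z
    rw [List.cons_append, List.cons_append, List.cons_append] at this
    rw [this, ← neg_smul, ← neg_one_mul ((-1 : R) ^ _), ← pow_succ']
    congr 1
    apply neg_one_pow_of_even_iff
    simp only [List.length_cons, List.sum_cons, ← add_assoc, ← hs, Nat.even_add_one, Nat.even_add]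
    simp [-Nat.not_even_iff_odd]
    grind
  have h3 : ∑ l ∈ Finset.range c, rot R (word ((a + l) :: 1 :: (c - 1 - l) :: (M ++ [z]))) =
      -((-1 : R) ^ (M.length + z * (a + c + M.sum)) •
        ∑ l ∈ Finset.range c, word (z :: (a + l) :: 1 :: (c - 1 - l) :: M)) := by
    rw [Finset.smul_sum, ← Finset.sum_neg_distrib]
    refine Finset.sum_congr rfl fun l hl => ?_
    have := Finset.mem_range.1 hl
    exact h2 _ _ _ (by omega)
  rw [h1, contract_cons_cons, map_sub, map_sum, h3, h2 _ _ _ (by omega)]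
  simp only [map_sub, map_neg, map_smul, map_sum, firstFace_cons_cons, contract_cons_cons,
    add_assoc, smul_sub]
  abel

theorem hoch_contract_pair (a c : ℕ) :
    hoch R (contract R (word [a, c])) = word [a, c] - smallProj R (word [a, c]) := by
  have h1 := sum_range_word_telescope (R := R) a c []
  have h2 : ∑ l ∈ Finset.range c, hoch R (word [a + l, 1, c - 1 - l]) =
      word [a + c, 0] - word [a, c] + smallCoeff R a c • word [a + c - 1, 1] := by
    rw [← h1, smallCoeff_eq_sum, Finset.sum_smul, ← Finset.sum_add_distrib]
    refine Finset.sum_congr rfl fun l hl => ?_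
    have := Finset.mem_range.1 hl
    rw [hoch_triple, show c - 1 - l + (a + l) = a + c - 1 by omega, pow_add, neg_one_sq, one_mul]
  rw [contract_cons_cons, map_sub, map_sum, h2, hoch_triple, smallProj_pair]
  simp
  abel

/-- `contract` is a homotopy between the identity and `smallProj`. -/
theorem hoch_contract_add {L : List ℕ} (hL : L ≠ []) :
    hoch R (contract R (word L)) + contract R (hoch R (word L)) =
      word L - smallProj R (word L) := by
  match L with
  | [a] => simp [hoch_apply, rot_singleton]
  | [a, c] => rw [hoch_contract_pair, hoch_pair, map_smul, contract_singleton, smul_zero, add_zero]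
  | a :: c :: e :: L =>
    rcases (e :: L).eq_nil_or_concat with h | ⟨M, z, h⟩
    · simp at h
    · have h1 := bar_contract (R := R) a c e L
      have h2 := firstFace_rot_contract (R := R) a c z M
      rw [← List.concat_eq_append, ← h] at h2
      simp only [hoch_apply, map_add, smallProj_cons_cons_cons, sub_zero]
      rw [add_add_add_comm, h1, h2, add_zero]

/-! ### Acyclicity of the kernel of the projection to the small complex -/

variable (R) in
/-- The span of the words of total degree `m` with more than `N` letters, where a word with `n + 1`
letters of sum `w` has total degree `n + w`. -/
def degreePart (m : ℤ) (N : ℕ) : Submodule R (WordModule R) :=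
  Submodule.span R {x | ∃ L : List ℕ, N < L.length ∧ (L.length : ℤ) + L.sum = m + 1 ∧ x = word L}

theorem map_mem_of_mem_degreePart {M : Type*} [AddCommGroup M] [Module R M] {m : ℤ} {N : ℕ}
    {f : WordModule R →ₗ[R] M} {S : Submodule R M}
    (h : ∀ L : List ℕ, N < L.length → (L.length : ℤ) + L.sum = m + 1 → f (word L) ∈ S)
    {x : WordModule R} (hx : x ∈ degreePart R m N) : f x ∈ S := by
  have : degreePart R m N ≤ S.comap f := by
    refine Submodule.span_le.2 ?_
    rintro _ ⟨L, hn, hw, rfl⟩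
    exact h L hn hw
  exact this hx

theorem piece_le_degreePart {n : ℕ} {w m : ℤ} {N : ℕ} (h : N < n) (hm : (n : ℤ) + w = m + 1) :
    piece R n w ≤ degreePart R m N := by
  refine Submodule.span_le.2 ?_
  rintro _ ⟨L, hn, hw, rfl⟩
  exact Submodule.subset_span ⟨L, by omega, by omega, rfl⟩

theorem hoch_mem_degreePart {m : ℤ} {x : WordModule R} (hx : x ∈ degreePart R m 0) :
    hoch R x ∈ degreePart R (m - 1) 0 := by
  refine map_mem_of_mem_degreePart (fun L hn hw => ?_) hx
  match L with
  | [] => simp at hn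
  | [a] => simp [hoch_apply, rot_singleton]
  | a :: b :: L =>
    refine piece_le_degreePart ?_ ?_ (hoch_cons_mem_piece a (b :: L))
    · simp
    · simp only [List.length_cons, Nat.cast_add, Nat.cast_one] at hw ⊢
      omega

theorem internal_mem_degreePart (p : R) {m : ℤ} {N : ℕ} {x : WordModule R}
    (hx : x ∈ degreePart R m N) : internal p (lengthSign R x) ∈ degreePart R (m - 1) N := by
  refine map_mem_of_mem_degreePart (f := internal p ∘ₗ lengthSign R) (fun L hn hw => ?_) hx
  rw [LinearMap.comp_apply, lengthSign_word, map_smul]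
  exact Submodule.smul_mem _ _ (piece_le_degreePart hn (by omega) (internal_mem_piece p L))

theorem total_mem_degreePart (p : R) {m : ℤ} {x : WordModule R} (hx : x ∈ degreePart R m 0) :
    total p x ∈ degreePart R (m - 1) 0 :=
  Submodule.add_mem _ (hoch_mem_degreePart hx) (internal_mem_degreePart p hx)

theorem connes_mem_degreePart {m : ℤ} {x : WordModule R} (hx : x ∈ degreePart R m 0) :
    connes R x ∈ degreePart R (m + 1) 0 := by
  refine map_mem_of_mem_degreePart (fun L hn hw => ?_) hx
  exact piece_le_degreePart (by omega) (by omega)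
    (connes_mem_piece (word_mem_piece_self L))

theorem contract_mem_degreePart {m : ℤ} {N : ℕ} {x : WordModule R}
    (hx : x ∈ degreePart R m N) : contract R x ∈ degreePart R (m + 1) (N + 1) := by
  refine map_mem_of_mem_degreePart (fun L hn hw => ?_) hx
  match L with
  | [] => simp
  | [a] => simp
  | a :: c :: L =>
    simp only [List.length_cons, List.sum_cons, Nat.cast_add, Nat.cast_one] at hn hw
    rw [contract_cons_cons]
    refine Submodule.sub_mem _ (Submodule.subset_span ⟨_, ?_, ?_, rfl⟩)
      (Submodule.sum_mem _ fun l hl => Submodule.subset_span ⟨_, ?_, ?_, rfl⟩)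
    · simp; omega
    · simp only [List.length_cons, List.sum_cons, Nat.cast_add, Nat.cast_one]; omega
    · simp; omega
    · have := Finset.mem_range.1 hl
      simp only [List.length_cons, List.sum_cons, Nat.cast_add, Nat.cast_one]; omega

/-- The values of `contract` have at least three letters, so their small image is zero. -/
theorem contract_mem_degreePart_two {m : ℤ} {x : WordModule R}
    (hx : x ∈ degreePart R m 0) : contract R x ∈ degreePart R (m + 1) 2 := by
  refine map_mem_of_mem_degreePart (fun L hn hw => ?_) hx
  match L with
  | [] => simp
  | [a] => simp
  | a :: c :: L =>
    exact contract_mem_degreePart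
      (Submodule.subset_span ⟨a :: c :: L, by simp, hw, rfl⟩)

theorem degreePart_mono {m : ℤ} {N N' : ℕ} (h : N ≤ N') :
    degreePart R m N' ≤ degreePart R m N := by
  refine Submodule.span_le.2 ?_
  rintro _ ⟨L, hn, hw, rfl⟩
  exact Submodule.subset_span ⟨L, by omega, hw, rfl⟩

theorem smallZero_eq_zero_of_mem {n : ℕ} {m : ℤ} {x : WordModule R}
    (hx : x ∈ degreePart R m 2) : smallZero R n x = 0 :=
  (Submodule.mem_bot R).1 (map_mem_of_mem_degreePart (fun L hn _ => by
    rw [smallZero_of_length_ne (by omega)]; exact Submodule.zero_mem _) hx)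

theorem smallOne_eq_zero_of_mem {n : ℕ} {m : ℤ} {x : WordModule R}
    (hx : x ∈ degreePart R m 2) : smallOne R n x = 0 :=
  (Submodule.mem_bot R).1 (map_mem_of_mem_degreePart (fun L hn _ => by
    rw [smallOne_of_length_ne (by omega)]; exact Submodule.zero_mem _) hx)

theorem eq_zero_of_mem_degreePart {m : ℤ} {N : ℕ} (h : m + 1 ≤ N) {x : WordModule R}
    (hx : x ∈ degreePart R m N) : x = 0 :=
  (Submodule.mem_bot R).1 (map_mem_of_mem_degreePart (f := LinearMap.id) (fun L hn hw => by
    omega) hx)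

theorem hoch_contract_add_of_mem {m : ℤ} {x : WordModule R} (hx : x ∈ degreePart R m 0)
    (h0 : ∀ n, smallZero R n x = 0) (h1 : ∀ n, smallOne R n x = 0) :
    hoch R (contract R x) + contract R (hoch R x) = x := by
  have h := map_mem_of_mem_degreePart (S := ⊥)
    (f := hoch R ∘ₗ contract R + contract R ∘ₗ hoch R - LinearMap.id + smallProj R)
    (fun L hn hw => by
      have := hoch_contract_add (R := R) (L := L) (List.ne_nil_of_length_pos (by omega))
      simp [this]) hx
  simp only [Submodule.mem_bot, LinearMap.add_apply, LinearMap.sub_apply, LinearMap.comp_apply,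
    smallProj_eq_zero h0 h1, add_zero, LinearMap.id_apply] at h
  exact sub_eq_zero.1 h

/-- The kernel of the projection to the small complex is acyclic for `b ± δ`: the homotopy for `b`
is a homotopy for `b ± δ` up to a term that increases the number of letters and keeps the degree,
hence is nilpotent in each degree. -/
theorem exists_total_eq (p : R) {m : ℤ} {x : WordModule R} (hx : x ∈ degreePart R m 0)
    (h0 : ∀ n, smallZero R n x = 0) (h1 : ∀ n, smallOne R n x = 0) (hd : total p x = 0) :
    ∃ y ∈ degreePart R (m + 1) 0, (∀ n, smallZero R n y = 0) ∧ (∀ n, smallOne R n y = 0) ∧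
      total p y = x := by
  suffices H : ∀ (k N : ℕ) (x : WordModule R), m + 1 ≤ N + k → x ∈ degreePart R m N →
      (∀ n, smallZero R n x = 0) → (∀ n, smallOne R n x = 0) → total p x = 0 →
      ∃ y ∈ degreePart R (m + 1) 0, (∀ n, smallZero R n y = 0) ∧ (∀ n, smallOne R n y = 0) ∧
        total p y = x by
    exact H (m + 1).toNat 0 x (by omega) hx h0 h1 hd
  clear hx h0 h1 hd x
  intro k
  induction k with
  | zero =>
    intro N x hN hx _ _ _
    refine ⟨0, Submodule.zero_mem _, by simp, by simp, ?_⟩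
    rw [map_zero, eq_zero_of_mem_degreePart (by simpa using hN) hx]
  | succ k ih =>
    intro N x hN hx h0 h1 hd
    have hx0 := degreePart_mono (Nat.zero_le N) hx
    have hu0 := degreePart_mono (Nat.zero_le 2) (contract_mem_degreePart_two hx0)
    have key : x - total p (contract R x) =
        -(contract R (internal p (lengthSign R x)) +
          internal p (lengthSign R (contract R x))) := by
      have h := hoch_contract_add_of_mem hx0 h0 h1
      rw [total_apply] at hd
      rw [eq_neg_of_add_eq_zero_left hd, map_neg] at h
      rw [total_apply]
      nth_rw 1 [← h]
      abel
    have e1 : m - 1 + 1 = m := by ring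
    have e2 : m + 1 - 1 = m := by ring
    have hN1 := contract_mem_degreePart (internal_mem_degreePart p hx)
    have hN2 := internal_mem_degreePart p (contract_mem_degreePart hx)
    have h21 := contract_mem_degreePart_two (internal_mem_degreePart p hx0)
    have h22 := internal_mem_degreePart p (contract_mem_degreePart_two hx0)
    rw [e1] at hN1 h21
    rw [e2] at hN2 h22
    have h2 := Submodule.neg_mem _ (Submodule.add_mem _ h21 h22)
    obtain ⟨y, hy, hy0, hy1, hyd⟩ := ih (N + 1) (x - total p (contract R x))
      (by push_cast at hN ⊢; omega) (key ▸ Submodule.neg_mem _ (Submodule.add_mem _ hN1 hN2))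
      (fun n => key ▸ smallZero_eq_zero_of_mem h2) (fun n => key ▸ smallOne_eq_zero_of_mem h2)
      (by rw [map_sub, hd, total_total, sub_zero])
    refine ⟨y + contract R x, Submodule.add_mem _ hy hu0, fun n => ?_, fun n => ?_, ?_⟩
    · rw [map_add, hy0, smallZero_eq_zero_of_mem (contract_mem_degreePart_two hx0), add_zero]
    · rw [map_add, hy1, smallOne_eq_zero_of_mem (contract_mem_degreePart_two hx0), add_zero]
    · rw [map_add, hyd, sub_add_cancel]

end HochschildWord

/-! ### Chains of `R // p` as words -/

namespace KillP

open Polynomial HochschildWord DGCyclic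

variable (R : Type u) [CommRing R]

/-- The chain `(x ^ e₀, …, x ^ eₙ)`. -/
def monomialTensor {n : ℕ} (e : Fin (n + 1) → ℕ) : Tensors R R[X] n :=
  PiTensorProduct.tprod R fun i => (X : R[X]) ^ e i

variable {R} in
theorem tensors_hom_ext {n : ℕ} {M : Type*} [AddCommGroup M] [Module R M]
    {f g : Tensors R R[X] n →ₗ[R] M}
    (h : ∀ e : Fin (n + 1) → ℕ, f (monomialTensor R e) = g (monomialTensor R e)) : f = g := by
  refine PiTensorProduct.ext (Module.Basis.ext_multilinear (fun _ => Polynomial.basisMonomials R)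
    fun e => ?_)
  simpa [monomialTensor, X_pow_eq_monomial] using h e

/-- The chains on `n + 1` factors as a module of words. -/
def tensorsToWord (n : ℕ) : Tensors R R[X] n →ₗ[R] WordModule R :=
  Finsupp.lmapDomain R R List.ofFn ∘ₗ
    (Basis.piTensorProduct fun _ : Fin (n + 1) => Polynomial.basisMonomials R).repr.toLinearMap

@[simp]
theorem tensorsToWord_monomialTensor {n : ℕ} (e : Fin (n + 1) → ℕ) :
    tensorsToWord R n (monomialTensor R e) = word (List.ofFn e) := by
  have h : monomialTensor R e =
      Basis.piTensorProduct (fun _ : Fin (n + 1) => Polynomial.basisMonomials R) e := by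
    simp [monomialTensor, Basis.piTensorProduct_apply, X_pow_eq_monomial]
  rw [h, tensorsToWord, LinearMap.comp_apply, LinearEquiv.coe_coe, Module.Basis.repr_self,
    Finsupp.lmapDomain_apply, Finsupp.mapDomain_single, word]

/-- All chains as a module of words. -/
def toWord : Chains R R[X] →ₗ[R] WordModule R := DirectSum.toModule R ℕ _ (tensorsToWord R)

@[simp]
theorem toWord_lof (n : ℕ) (x : Tensors R R[X] n) :
    toWord R (DirectSum.lof R ℕ (fun n => Tensors R R[X] n) n x) = tensorsToWord R n x := by
  simp [toWord]

variable {R} in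
theorem chains_hom_ext {M : Type*} [AddCommGroup M] [Module R M] {f g : Chains R R[X] →ₗ[R] M}
    (h : ∀ (n : ℕ) (x : Tensors R R[X] n), f (DirectSum.lof R ℕ (fun n => Tensors R R[X] n) n x) =
      g (DirectSum.lof R ℕ (fun n => Tensors R R[X] n) n x)) : f = g := by
  refine DirectSum.linearMap_ext R fun n => ?_
  ext1
  ext a
  exact h n _

/-- The chain of a word. -/
def ofWord : WordModule R →ₗ[R] Chains R R[X] :=
  Finsupp.linearCombination R fun
    | [] => 0
    | a :: L => DirectSum.lof R ℕ (fun n => Tensors R R[X] n) L.length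
        (monomialTensor R (a :: L).get)

theorem ofWord_word (L : List ℕ) (n : ℕ) (h : L.length = n + 1) :
    ofWord R (word L) = DirectSum.lof R ℕ (fun n => Tensors R R[X] n) n
      (monomialTensor R fun i => L.get (i.cast h.symm)) := by
  cases L with
  | nil => simp at h
  | cons a L =>
    obtain rfl : L.length = n := by simpa using h
    simp [ofWord, word]
    rfl

theorem ofWord_toWord (x : Chains R R[X]) : ofWord R (toWord R x) = x := by
  refine LinearMap.congr_fun (f := ofWord R ∘ₗ toWord R) (g := LinearMap.id)
    (chains_hom_ext fun n x => ?_) x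
  refine LinearMap.congr_fun (f := ofWord R ∘ₗ tensorsToWord R n)
    (g := DirectSum.lof R ℕ (fun n => Tensors R R[X] n) n) (tensors_hom_ext fun e => ?_) x
    |> Eq.trans (by simp)
  rw [LinearMap.comp_apply, tensorsToWord_monomialTensor, ofWord_word R _ n (by simp)]
  congr 2
  funext i
  rw [List.get_ofFn]
  rfl

theorem toWord_injective : Function.Injective (toWord R) :=
  Function.LeftInverse.injective (ofWord_toWord R)

/-! ### The operators in terms of words -/

theorem evenPart_X_pow (k : ℕ) :
    evenPart (grading R) (X ^ k : R[X]) = if Even k then X ^ k else 0 := by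
  rw [evenPart, LinearMap.comp_apply]
  have : (DirectSum.decomposeLinearEquiv (grading R)).toLinearMap (X ^ k : R[X]) =
      DirectSum.lof R ℕ (fun n => grading R n) k ⟨X ^ k, X_pow_mem_grading R k⟩ :=
    DirectSum.decompose_of_mem _ (X_pow_mem_grading R k)
  rw [this, DirectSum.toModule_lof]
  split_ifs <;> simp

theorem oddPart_X_pow (k : ℕ) :
    oddPart (grading R) (X ^ k : R[X]) = if Even k then 0 else X ^ k := by
  rw [oddPart, LinearMap.sub_apply, evenPart_X_pow]
  split_ifs <;> simp

theorem gradingInv_X_pow (k : ℕ) :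
    gradingInv (grading R) (X ^ k : R[X]) = (-1 : R) ^ k • X ^ k := by
  rw [gradingInv, LinearMap.sub_apply, evenPart_X_pow, oddPart_X_pow]
  split_ifs with h
  · simp [h.neg_one_pow]
  · simp [(Nat.not_even_iff_odd.1 h).neg_one_pow]

theorem rotationSign_monomialTensor {n : ℕ} (e : Fin (n + 1) → ℕ) :
    rotationSign (grading R) n (monomialTensor R e) =
      (-1 : R) ^ (e (Fin.last n) * ∑ i : Fin n, e i.castSucc) • monomialTensor R e := by
  rw [rotationSign, LinearMap.add_apply, monomialTensor, PiTensorProduct.map_tprod,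
    PiTensorProduct.map_tprod]
  rcases Nat.even_or_odd (e (Fin.last n)) with h | h
  · have h1 : (fun i => (if i = Fin.last n then evenPart (grading R) else LinearMap.id)
        ((X : R[X]) ^ e i)) = fun i => (X : R[X]) ^ e i := by
      funext i
      split_ifs with hi
      · subst hi
        rw [evenPart_X_pow, if_pos h]
      · rfl
    rw [h1, (PiTensorProduct.tprod R).map_coord_zero
      (m := fun i => (if i = Fin.last n then oddPart (grading R) else gradingInv (grading R))
        ((X : R[X]) ^ e i)) (Fin.last n)
      (by simp only [if_true]; rw [oddPart_X_pow, if_pos h]), add_zero, Even.neg_one_pow (h.mul_right _),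
      one_smul]
  · have h1 : (fun i => (if i = Fin.last n then oddPart (grading R) else gradingInv (grading R))
        ((X : R[X]) ^ e i)) = fun i => (if i = Fin.last n then 1 else (-1 : R) ^ e i) •
          (X : R[X]) ^ e i := by
      funext i
      split_ifs with hi
      · subst hi
        rw [oddPart_X_pow, if_neg (Nat.not_even_iff_odd.2 h), one_smul]
      · rw [gradingInv_X_pow]
    rw [h1, (PiTensorProduct.tprod R).map_coord_zero
      (m := fun i => (if i = Fin.last n then evenPart (grading R) else LinearMap.id)
        ((X : R[X]) ^ e i)) (Fin.last n)
      (by simp only [if_true]; rw [evenPart_X_pow, if_neg (Nat.not_even_iff_odd.2 h)]), zero_add,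
      MultilinearMap.map_smul_univ, Fin.prod_univ_castSucc, if_pos rfl, mul_one, pow_mul,
      h.neg_one_pow]
    congr 1
    rw [← Finset.prod_pow_eq_pow_sum]
    exact Finset.prod_congr rfl fun i _ => by rw [if_neg (Fin.castSucc_lt_last i).ne]

theorem cyclicOp_monomialTensor {n : ℕ} (e : Fin (n + 1) → ℕ) :
    tensorsToWord R n (cyclicOp (grading R) n (monomialTensor R e)) =
      rot R (word (List.ofFn e)) := by
  have h : PiTensorProduct.reindex R (fun _ : Fin (n + 1) => R[X]) (finRotate (n + 1))
      (monomialTensor R e) = monomialTensor R fun i => e ((finRotate (n + 1)).symm i) := by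
    rw [monomialTensor, PiTensorProduct.reindex_tprod]
    rfl
  rw [cyclicOp, LinearMap.smul_apply, signedRotation, LinearMap.comp_apply,
    rotationSign_monomialTensor, map_smul, map_smul, LinearEquiv.coe_coe, map_smul, h,
    tensorsToWord_monomialTensor]
  have h0 : (finRotate (n + 1)).symm 0 = Fin.last n := by
    rw [Equiv.symm_apply_eq, finRotate_last]
  have hs : ∀ i : Fin n, (finRotate (n + 1)).symm i.succ = i.castSucc := by
    intro i
    rw [Equiv.symm_apply_eq, finRotate_apply]
    simp
  have h1 : List.ofFn (fun i => e ((finRotate (n + 1)).symm i)) =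
      e (Fin.last n) :: List.ofFn fun i : Fin n => e i.castSucc := by
    simp only [List.ofFn_succ, h0, hs]
  rw [h1, List.ofFn_succ', List.concat_eq_append, rot_concat, smul_smul, ← pow_add,
    List.length_ofFn, List.sum_ofFn]

theorem tensorsToWord_cyclicOp {n : ℕ} (x : Tensors R R[X] n) :
    tensorsToWord R n (cyclicOp (grading R) n x) = rot R (tensorsToWord R n x) := by
  refine LinearMap.congr_fun (f := tensorsToWord R n ∘ₗ cyclicOp (grading R) n)
    (g := rot R ∘ₗ tensorsToWord R n) (tensors_hom_ext fun e => ?_) x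
  simpa using cyclicOp_monomialTensor R e

/-- The exponents of the monomials in a face of a tensor of monomials. -/
def mergeExp {n : ℕ} (i : Fin (n + 1)) (e : Fin (n + 2) → ℕ) (k : Fin (n + 1)) : ℕ :=
  if k < i then e k.castSucc else if k = i then e k.castSucc + e k.succ else e k.succ

theorem face_monomialTensor {n : ℕ} (i : Fin (n + 1)) (e : Fin (n + 2) → ℕ) :
    face R R[X] n i (monomialTensor R e) = monomialTensor R (mergeExp i e) := by
  rw [face, monomialTensor, PiTensorProduct.lift.tprod]
  change PiTensorProduct.tprod R _ = PiTensorProduct.tprod R _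
  congr 1
  funext k
  simp only [mergeAt, mergeExp]
  split_ifs <;> simp [pow_add]

theorem ofFn_mergeExp_zero {n : ℕ} (e : Fin (n + 2) → ℕ) :
    List.ofFn (mergeExp 0 e) = (e 0 + e 1) :: List.ofFn fun i : Fin n => e i.succ.succ := by
  rw [List.ofFn_succ]
  simp [mergeExp]

theorem ofFn_mergeExp_succ {n : ℕ} (i : Fin (n + 1)) (e : Fin (n + 3) → ℕ) :
    List.ofFn (mergeExp i.succ e) = e 0 :: List.ofFn (mergeExp i fun k => e k.succ) := by
  rw [List.ofFn_succ]
  simp [mergeExp]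

theorem sum_mergeExp {n : ℕ} (e : Fin (n + 2) → ℕ) :
    ∑ i : Fin (n + 1), (-1 : R) ^ (i : ℕ) • (word (List.ofFn (mergeExp i e)) : WordModule R) =
      bar R (word (List.ofFn e)) := by
  induction n with
  | zero =>
    rw [Fin.sum_univ_one, Fin.val_zero, pow_zero, one_smul, ofFn_mergeExp_zero]
    simp
  | succ n ih =>
    rw [Fin.sum_univ_succ, ofFn_mergeExp_zero, List.ofFn_succ (f := e),
      List.ofFn_succ (f := fun i => e i.succ), bar_cons_cons]
    have h := ih fun i => e i.succ
    rw [List.ofFn_succ] at h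
    rw [← h, map_sum, sub_eq_add_neg, ← Finset.sum_neg_distrib]
    simp [-List.ofFn_succ, ofFn_mergeExp_succ, pow_succ]

theorem tensorsToWord_face_zero {n : ℕ} (x : Tensors R R[X] (n + 1)) :
    tensorsToWord R n (face R R[X] n 0 x) = firstFace R (tensorsToWord R (n + 1) x) := by
  refine LinearMap.congr_fun (f := tensorsToWord R n ∘ₗ face R R[X] n 0)
    (g := firstFace R ∘ₗ tensorsToWord R (n + 1)) (tensors_hom_ext fun e => ?_) x
  rw [LinearMap.comp_apply, LinearMap.comp_apply, face_monomialTensor,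
    tensorsToWord_monomialTensor, tensorsToWord_monomialTensor, ofFn_mergeExp_zero]
  simp

theorem tensorsToWord_hochschildB {n : ℕ} (x : Tensors R R[X] (n + 1)) :
    tensorsToWord R n (hochschildB (grading R) n x) = hoch R (tensorsToWord R (n + 1) x) := by
  have h1 : hochschildB (grading R) n x =
      (∑ i : Fin (n + 1), (-1 : R) ^ (i : ℕ) • face R R[X] n i) x +
        face R R[X] n 0 (cyclicOp (grading R) (n + 1) x) := by
    simp [hochschildB, cyclicOp]
  rw [h1, map_add, tensorsToWord_face_zero, tensorsToWord_cyclicOp, hoch_apply]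
  congr 1
  refine LinearMap.congr_fun
    (f := tensorsToWord R n ∘ₗ (∑ i : Fin (n + 1), (-1 : R) ^ (i : ℕ) • face R R[X] n i))
    (g := bar R ∘ₗ tensorsToWord R (n + 1)) (tensors_hom_ext fun e => ?_) x
  simp [-List.ofFn_succ, ← sum_mergeExp, face_monomialTensor]

theorem tensorsToWord_extraDegeneracy {n : ℕ} (x : Tensors R R[X] n) :
    tensorsToWord R (n + 1) (extraDegeneracy R R[X] n x) = degen R (tensorsToWord R n x) := by
  refine LinearMap.congr_fun (f := tensorsToWord R (n + 1) ∘ₗ extraDegeneracy R R[X] n)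
    (g := degen R ∘ₗ tensorsToWord R n) (tensors_hom_ext fun e => ?_) x
  have h : extraDegeneracy R R[X] n (monomialTensor R e) =
      monomialTensor R (Fin.cons 0 e : Fin (n + 2) → ℕ) := by
    rw [extraDegeneracy, monomialTensor, PiTensorProduct.lift.tprod, MultilinearMap.curryLeft_apply]
    rw [monomialTensor]
    congr 1
    funext i
    refine Fin.cases ?_ (fun i => ?_) i <;> simp
  simp [h, List.ofFn_succ]

theorem tensorsToWord_normOp {n : ℕ} (x : Tensors R R[X] n) :
    tensorsToWord R n (normOp (grading R) n x) = norm R (tensorsToWord R n x) := by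
  have h : ∀ (i : ℕ) (y : Tensors R R[X] n), tensorsToWord R n ((cyclicOp (grading R) n ^ i) y) =
      (rot R ^ i) (tensorsToWord R n y) := by
    intro i y
    induction i with
    | zero => simp
    | succ i ih => rw [pow_succ', pow_succ', Module.End.mul_apply, Module.End.mul_apply,
        tensorsToWord_cyclicOp, ih]
  refine LinearMap.congr_fun (f := tensorsToWord R n ∘ₗ normOp (grading R) n)
    (g := norm R ∘ₗ tensorsToWord R n) (tensors_hom_ext fun e => ?_) x
  simp [normOp, h, norm_word]

theorem tensorsToWord_connesB {n : ℕ} (x : Tensors R R[X] n) :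
    tensorsToWord R (n + 1) (connesB (grading R) n x) = connes R (tensorsToWord R n x) := by
  simp [connesB, connes_apply, tensorsToWord_cyclicOp, tensorsToWord_extraDegeneracy,
    tensorsToWord_normOp]

variable (p : ℕ)

theorem sum_internal {n : ℕ} (e : Fin n → ℕ) :
    ∑ i : Fin n, (∏ j : Fin n, if j < i then (-1 : R) ^ e j
        else if j = i then (if Odd (e j) then (p : R) else 0) else 1) •
          (word (List.ofFn fun j => if j = i then e j - 1 else e j) : WordModule R) =
      internal (p : R) (word (List.ofFn e)) := by
  induction n with
  | zero => simp
  | succ n ih =>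
    rw [Fin.sum_univ_succ, List.ofFn_succ (f := e), internal_cons, ← ih fun i => e i.succ, map_sum,
      Finset.smul_sum]
    congr 1
    · rw [Fin.prod_univ_succ, List.ofFn_succ]
      simp [Fin.succ_ne_zero]
    · refine Finset.sum_congr rfl fun i _ => ?_
      rw [Fin.prod_univ_succ, List.ofFn_succ, map_smul, smul_smul, cons_word]
      simp [(Fin.succ_ne_zero i).symm]

theorem tensorsToWord_internalDiff {n : ℕ} (x : Tensors R R[X] n) :
    tensorsToWord R n (internalDiff (grading R) (diff R p) n x) =
      internal (p : R) (tensorsToWord R n x) := by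
  refine LinearMap.congr_fun (f := tensorsToWord R n ∘ₗ internalDiff (grading R) (diff R p) n)
    (g := internal (p : R) ∘ₗ tensorsToWord R n) (tensors_hom_ext fun e => ?_) x
  rw [LinearMap.comp_apply, LinearMap.comp_apply, tensorsToWord_monomialTensor, ← sum_internal,
    internalDiff, LinearMap.sum_apply, map_sum]
  refine Finset.sum_congr rfl fun i _ => ?_
  rw [← tensorsToWord_monomialTensor, ← map_smul]
  congr 1
  rw [monomialTensor, monomialTensor, PiTensorProduct.map_tprod, ← MultilinearMap.map_smul_univ]
  congr 1
  funext j
  split_ifs with h1 h2 h3 h4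
  · exact absurd h2 h1.ne
  · exact gradingInv_X_pow R (e j)
  · exact (diffLin_X_pow R p (e j)).trans (by rw [if_pos h4])
  · exact (diffLin_X_pow R p (e j)).trans (by rw [if_neg h4, zero_smul])
  · simp

theorem toWord_totalB (x : Chains R R[X]) :
    toWord R (totalB (grading R) x) = hoch R (toWord R x) := by
  refine LinearMap.congr_fun (f := toWord R ∘ₗ totalB (grading R)) (g := hoch R ∘ₗ toWord R)
    (chains_hom_ext fun n x => ?_) x
  cases n with
  | zero =>
    have h : hoch R ∘ₗ tensorsToWord R 0 = 0 := tensors_hom_ext fun e => by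
      simp [hoch_apply, rot_singleton]
    have h' := LinearMap.congr_fun h x
    simp only [LinearMap.comp_apply, LinearMap.zero_apply] at h'
    simp [totalB, totalBComponent, h']
  | succ n => simp [totalB, totalBComponent, tensorsToWord_hochschildB]

theorem toWord_totalInternal (x : Chains R R[X]) :
    toWord R (totalInternal (grading R) (diff R p) x) =
      internal (p : R) (lengthSign R (toWord R x)) := by
  refine LinearMap.congr_fun (f := toWord R ∘ₗ totalInternal (grading R) (diff R p))
    (g := internal (p : R) ∘ₗ lengthSign R ∘ₗ toWord R) (chains_hom_ext fun n x => ?_) x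
  have h : lengthSign R (tensorsToWord R n x) = (-1 : R) ^ n • tensorsToWord R n x := by
    refine LinearMap.congr_fun (f := lengthSign R ∘ₗ tensorsToWord R n)
      (g := (-1 : R) ^ n • tensorsToWord R n) (tensors_hom_ext fun e => ?_) x
    simp [pow_succ]
  simp [totalInternal, tensorsToWord_internalDiff, h]

theorem toWord_hochschildDiff (x : Chains R R[X]) :
    toWord R (hochschildDiff (grading R) (diff R p) x) = total (p : R) (toWord R x) := by
  rw [hochschildDiff, LinearMap.add_apply, map_add, toWord_totalB, toWord_totalInternal,
    total_apply]

theorem toWord_totalConnes (x : Chains R R[X]) :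
    toWord R (totalConnes (grading R) x) = connes R (toWord R x) := by
  refine LinearMap.congr_fun (f := toWord R ∘ₗ totalConnes (grading R))
    (g := connes R ∘ₗ toWord R) (chains_hom_ext fun n x => ?_) x
  simp [totalConnes, tensorsToWord_connesB]

/-- `toWord` identifies the chains of degree `m` with the span of the non-empty words of degree
`m`. -/
theorem map_chainsOfDegree (m : ℤ) :
    (chainsOfDegree (grading R) m).map (toWord R) = degreePart R m 0 := by
  refine le_antisymm ?_ ?_
  · rw [chainsOfDegree, Submodule.map_span, Submodule.span_le]
    rintro _ ⟨_, ⟨n, e, a, ha, hm, rfl⟩, rfl⟩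
    choose r hr using fun i => Submodule.mem_span_singleton.1 (ha i)
    have h : PiTensorProduct.tprod R a = (∏ i, r i) • monomialTensor R e := by
      rw [monomialTensor, ← MultilinearMap.map_smul_univ]
      congr 1
      funext i
      exact (hr i).symm
    rw [SetLike.mem_coe, toWord_lof, h, map_smul, tensorsToWord_monomialTensor]
    refine Submodule.smul_mem _ _ (Submodule.subset_span ⟨_, by simp, ?_, rfl⟩)
    rw [List.length_ofFn, List.sum_ofFn, ← hm]
    push_cast
    ring
  · refine Submodule.span_le.2 ?_
    rintro _ ⟨L, hL, hm, rfl⟩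
    cases L with
    | nil => simp at hL
    | cons a L =>
      refine ⟨DirectSum.lof R ℕ (fun n => Tensors R R[X] n) L.length
        (monomialTensor R (a :: L).get), Submodule.subset_span
          ⟨L.length, (a :: L).get, _, fun i => X_pow_mem_grading R _, ?_, rfl⟩, ?_⟩
      · have h : (∑ i : Fin (L.length + 1), (a :: L).get i) = (a :: L).sum := by
          refine Eq.trans ?_ (congrArg List.sum (List.ofFn_get (a :: L)))
          exact List.sum_ofFn.symm
        rw [← Nat.cast_sum, h]
        simp only [List.length_cons] at hm
        omega
      · rw [toWord_lof, tensorsToWord_monomialTensor, List.ofFn_get]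

theorem toWord_mem {m : ℤ} {x : Chains R R[X]} (hx : x ∈ chainsOfDegree (grading R) m) :
    toWord R x ∈ degreePart R m 0 :=
  map_chainsOfDegree R m ▸ Submodule.mem_map_of_mem hx

theorem exists_toWord_eq {m : ℤ} {x : WordModule R} (hx : x ∈ degreePart R m 0) :
    ∃ y ∈ chainsOfDegree (grading R) m, toWord R y = x := by
  rwa [← map_chainsOfDegree, Submodule.mem_map] at hx

end KillP

/-! ### Divisibility by integers in a `ℤ_(p)`-algebra -/

namespace KillP

theorem isUnit_natCast (p : ℕ) [Fact p.Prime] (R : Type*) [CommRing R] [Algebra (ZLocAt p) R]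
    {n : ℕ} (hn : ¬ p ∣ n) : IsUnit (n : R) := by
  have h : IsUnit (algebraMap ℤ (ZLocAt p) n) := by
    rw [IsLocalization.AtPrime.isUnit_to_map_iff (ZLocAt p) (Ideal.span {(p : ℤ)})]
    intro hmem
    exact hn (by exact_mod_cast Ideal.mem_span_singleton.1 hmem)
  simpa using h.map (algebraMap (ZLocAt p) R)

section Arithmetic

variable {p : ℕ} [hp : Fact p.Prime]

/-- The product `3 · 5 ⋯ (2 m + 1)` divides `(2 m + 1)!`, whose `p`-adic valuation is less than
`(2 m + 1) / (p - 1) ≤ m + 1 / 2` by Legendre's formula. -/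
theorem padicValNat_prod_odd_le (hodd : Odd p) (m : ℕ) :
    padicValNat p (∏ i ∈ Finset.range m, (2 * i + 3)) ≤ m := by
  have hdvd : ∏ i ∈ Finset.range m, (2 * i + 3) ∣ (2 * m + 1).factorial := by
    induction m with
    | zero => simp
    | succ m ih =>
      rw [Finset.prod_range_succ, show 2 * (m + 1) + 1 = 2 * m + 1 + 1 + 1 by ring,
        Nat.factorial_succ, Nat.factorial_succ, mul_comm]
      exact mul_dvd_mul_left _ (ih.trans (Dvd.intro_left _ rfl))
  have h1 : padicValNat p (∏ i ∈ Finset.range m, (2 * i + 3)) ≤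
      padicValNat p (2 * m + 1).factorial :=
    (padicValNat_dvd_iff_le (Nat.factorial_ne_zero _)).1 (pow_padicValNat_dvd.trans hdvd)
  have h2 := sub_one_mul_padicValNat_factorial (p := p) (2 * m + 1)
  have h3 : 2 ≤ p - 1 := by
    have := hp.out.two_le
    obtain ⟨k, rfl⟩ := hodd
    omega
  have h4 : 2 * padicValNat p (2 * m + 1).factorial ≤
      (p - 1) * padicValNat p (2 * m + 1).factorial := Nat.mul_le_mul_right _ h3
  omega

theorem padicValNat_le_of_not_dvd {n m : ℕ} (hn : n ≠ 0) (h : ¬ p ^ (m + 1) ∣ n) :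
    padicValNat p n ≤ m := by
  by_contra! hlt
  exact h ((padicValNat_dvd_iff_le hn).2 hlt)

/-- Close to a number `n` of high valuation, a number is at most as divisible by `p` as its distance
from `n`. -/
theorem padicValNat_add_two_mul_le (hodd : Odd p) {n i : ℕ} (hi : i ≠ 0)
    (hlt : i < p ^ padicValNat p n) : padicValNat p (n + 2 * i) ≤ padicValNat p i := by
  refine padicValNat_le_of_not_dvd (by omega) fun h => ?_
  have hcop : ∀ j, Nat.Coprime (p ^ j) 2 := fun j => (Nat.coprime_two_right.2 hodd).pow_left j
  rcases le_total (padicValNat p i + 1) (padicValNat p n) with hle | hle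
  · have h1 : p ^ (padicValNat p i + 1) ∣ n := (pow_dvd_pow p hle).trans pow_padicValNat_dvd
    exact pow_succ_padicValNat_not_dvd hi ((hcop _).dvd_of_dvd_mul_left
      ((Nat.dvd_add_right h1).1 h))
  · have h1 : p ^ padicValNat p n ∣ i := (hcop _).dvd_of_dvd_mul_left
      ((Nat.dvd_add_right pow_padicValNat_dvd).1 ((pow_dvd_pow p hle).trans h))
    exact absurd (Nat.le_of_dvd (Nat.pos_of_ne_zero hi) h1) (by omega)

/-- The valuations in `(n + 2) (n + 4) ⋯ (n + 2 m)` are at most those in `m!`, as long as `m` does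
not exceed the valuation of `n`. -/
theorem padicValNat_prod_le (hodd : Odd p) {n m : ℕ} (hm : m ≤ padicValNat p n) :
    padicValNat p (∏ i ∈ Finset.range m, (n + 2 * (i + 1))) ≤ m := by
  have h1 : ∀ m ≤ padicValNat p n, padicValNat p (∏ i ∈ Finset.range m, (n + 2 * (i + 1))) ≤
      padicValNat p m.factorial := by
    intro m
    induction m with
    | zero => simp
    | succ m ih =>
      intro hm
      rw [Finset.prod_range_succ, Nat.factorial_succ, padicValNat.mul
        (Finset.prod_ne_zero_iff.2 fun i _ => by omega) (by omega),
        padicValNat.mul (by omega) (Nat.factorial_ne_zero m), add_comm]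
      refine add_le_add (padicValNat_add_two_mul_le hodd (by omega) ?_) (ih (by omega))
      exact lt_of_le_of_lt hm (Nat.lt_pow_self hp.out.one_lt)
  refine (h1 m hm).trans ?_
  have h2 := sub_one_mul_padicValNat_factorial (p := p) m
  have h3 : 1 * padicValNat p m.factorial ≤ (p - 1) * padicValNat p m.factorial :=
    Nat.mul_le_mul_right _ (by have := hp.out.two_le; omega)
  omega

end Arithmetic

section Ring

theorem eq_zero_of_pow_mul {p : ℕ} {R : Type u} [CommRing R] (htf : ∀ r : R, (p : R) * r = 0 → r = 0) (n : ℕ) {r : R}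
    (h : (p : R) ^ n * r = 0) : r = 0 := by
  induction n with
  | zero => simpa using h
  | succ n ih =>
    rw [pow_succ', mul_assoc] at h
    exact ih (htf _ h)

variable {p : ℕ} [hp : Fact p.Prime] {R : Type u} [CommRing R]

theorem natCast_dvd_pow (hu : ∀ n : ℕ, ¬ p ∣ n → IsUnit (n : R)) {n m : ℕ} (hn : n ≠ 0)
    (h : padicValNat p n ≤ m) : (n : R) ∣ (p : R) ^ m := by
  obtain ⟨e, n', hn', rfl⟩ := Nat.exists_eq_pow_mul_and_not_dvd hn p hp.out.ne_one
  have he : e ≤ m := ((padicValNat_dvd_iff_le hn).1 (Dvd.intro _ rfl)).trans h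
  push_cast
  exact (hu n' hn').mul_right_dvd.2 (pow_dvd_pow _ he)

theorem eq_zero_of_natCast_mul (htf : ∀ r : R, (p : R) * r = 0 → r = 0)
    (hu : ∀ n : ℕ, ¬ p ∣ n → IsUnit (n : R)) {n : ℕ} (hn : n ≠ 0) {r : R}
    (h : (n : R) * r = 0) : r = 0 := by
  obtain ⟨y, hy⟩ := natCast_dvd_pow hu hn le_rfl
  refine eq_zero_of_pow_mul htf (padicValNat p n) ?_
  rw [hy, mul_right_comm, h, zero_mul]

theorem isUnit_two (hodd : Odd p) (hu : ∀ n : ℕ, ¬ p ∣ n → IsUnit (n : R)) :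
    IsUnit (2 : R) := by
  refine hu 2 fun h => ?_
  have := Nat.le_of_dvd two_pos h
  have := hp.out.two_le
  obtain ⟨k, rfl⟩ := hodd
  omega

/-- The sequence `(-p² / 2) ^ m / (c₀ ⋯ cₘ₋₁)`, as long as it is divisible by `p ^ m` because the
denominator divides `p ^ m`. -/
theorem exists_quotient_sequence (hodd : Odd p) (htf : ∀ r : R, (p : R) * r = 0 → r = 0)
    (hu : ∀ n : ℕ, ¬ p ∣ n → IsUnit (n : R)) (c : ℕ → ℕ) (hc : ∀ i, c i ≠ 0) :
    ∃ A : ℕ → R, A 0 = 1 ∧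
      (∀ m, padicValNat p (∏ i ∈ Finset.range m, c i) ≤ m → (p : R) ^ m ∣ A m) ∧
      ∀ m, padicValNat p (∏ i ∈ Finset.range m, c i) ≤ m →
        padicValNat p (∏ i ∈ Finset.range (m + 1), c i) ≤ m + 1 →
        (p : R) ^ 2 * A m + 2 * c m * A (m + 1) = 0 := by
  obtain ⟨t, ht⟩ := isUnit_iff_exists_inv.1 (isUnit_two hodd hu)
  have hprod : ∀ m, ∏ i ∈ Finset.range m, c i ≠ 0 := fun m =>
    Finset.prod_ne_zero_iff.2 fun i _ => hc i
  have hz : ∀ m, ∃ z : R, padicValNat p (∏ i ∈ Finset.range m, c i) ≤ m →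
      (p : R) ^ m = (∏ i ∈ Finset.range m, c i : ℕ) * z := by
    intro m
    by_cases h : padicValNat p (∏ i ∈ Finset.range m, c i) ≤ m
    · obtain ⟨z, hz⟩ := natCast_dvd_pow hu (hprod m) h
      exact ⟨z, fun _ => hz⟩
    · exact ⟨0, fun h' => absurd h' h⟩
  choose z hz using hz
  refine ⟨fun m => (-t) ^ m * (p : R) ^ m * z m, ?_, fun m _ => ⟨(-t) ^ m * z m, by ring⟩,
    fun m h h' => ?_⟩
  · have := hz 0 (by simp)
    simp at this
    simp [← this]
  · refine eq_zero_of_natCast_mul htf hu (hprod (m + 1)) ?_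
    have e1 := hz m h
    have e2 := hz (m + 1) h'
    rw [Finset.prod_range_succ, Nat.cast_mul] at e2 ⊢
    -- both terms are multiples of `p ^ (2 * m + 2)`; they cancel because `2 * t = 1`
    linear_combination (-(p : R) ^ 2 * ((-t) ^ m * (p : R) ^ m) * c m) * e1 -
      (2 * c m * (-t) ^ (m + 1) * (p : R) ^ (m + 1)) * e2 -
      (p : R) ^ (2 * m + 2) * c m * (-t) ^ m * ht

end Ring

/-! ### Power series in `p` in the `p`-adic completion -/

section Completion

variable (p : ℕ) (R : Type u) [CommRing R]

/-- The `p`-adic completion of `R`. -/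
abbrev Completion : Type u := AdicCompletion (Ideal.span {(p : R)}) R

variable {p R}

theorem mem_pow_smul_top (n : ℕ) (r : R) :
    r ∈ (Ideal.span {(p : R)} ^ n • ⊤ : Submodule R R) ↔ (p : R) ^ n ∣ r := by
  rw [smul_eq_mul, Ideal.mul_top, Ideal.span_singleton_pow, Ideal.mem_span_singleton]

variable (p R) in
/-- The convergent sum `∑ pⁿ fₙ`. -/
def powSum : (ℕ → R) →ₗ[R] Completion p R :=
  AdicCompletion.lift _ (fun n => Submodule.mkQ _ ∘ₗ
    ∑ i ∈ Finset.range n, (p : R) ^ i • LinearMap.proj i) (by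
    intro m n hmn
    refine LinearMap.ext fun f => ?_
    simp only [LinearMap.comp_apply]
    refine (Submodule.Quotient.eq _).2 ?_
    rw [mem_pow_smul_top]
    simp only [LinearMap.sum_apply, LinearMap.smul_apply, LinearMap.proj_apply, smul_eq_mul]
    rw [← Finset.sum_range_add_sum_Ico _ hmn, LinearMap.id_apply, add_sub_cancel_left]
    refine Finset.dvd_sum fun i hi => Dvd.dvd.mul_right (pow_dvd_pow _ ?_) _
    exact (Finset.mem_Ico.1 hi).1)

theorem powSum_val (f : ℕ → R) (n : ℕ) : (powSum p R f).val n =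
    Submodule.Quotient.mk (∑ i ∈ Finset.range n, (p : R) ^ i * f i) := by
  have h : (powSum p R f).val n = (Submodule.mkQ _ ∘ₗ
    ∑ i ∈ Finset.range n, (p : R) ^ i • LinearMap.proj i) f := rfl
  simp [h]

theorem completion_mk_eq_zero_iff (n : ℕ) (r : R) :
    (Submodule.Quotient.mk r : R ⧸ (Ideal.span {(p : R)} ^ n • ⊤ : Submodule R R)) = 0 ↔
      (p : R) ^ n ∣ r := by
  rw [Submodule.Quotient.mk_eq_zero, mem_pow_smul_top]

theorem powSum_eq_zero {f : ℕ → R} (h : powSum p R f = 0) (n : ℕ) :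
    (p : R) ^ n ∣ ∑ i ∈ Finset.range n, (p : R) ^ i * f i := by
  rw [← completion_mk_eq_zero_iff, ← powSum_val, h, AdicCompletion.val_zero_apply]

theorem powSum_eq_zero_of {f : ℕ → R}
    (h : ∀ n, (p : R) ^ n ∣ ∑ i ∈ Finset.range n, (p : R) ^ i * f i) : powSum p R f = 0 := by
  refine AdicCompletion.ext fun n => ?_
  rw [powSum_val, AdicCompletion.val_zero_apply, completion_mk_eq_zero_iff]
  exact h n

/-- Splitting off the first term of `∑ pⁿ fₙ`. -/
theorem powSum_eq_of_add (f : ℕ → R) :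
    powSum p R f = AdicCompletion.of _ R (f 0) + (p : R) • powSum p R fun n => f (n + 1) := by
  refine AdicCompletion.ext fun n => ?_
  rw [AdicCompletion.val_add_apply, AdicCompletion.val_smul_apply, powSum_val, powSum_val,
    AdicCompletion.of_apply, Submodule.mkQ_apply, ← Submodule.Quotient.mk_smul,
    ← Submodule.Quotient.mk_add, ← sub_eq_zero, ← Submodule.Quotient.mk_sub,
    completion_mk_eq_zero_iff]
  have h := Finset.sum_range_succ (fun i => (p : R) ^ i * f i) n
  rw [Finset.sum_range_succ'] at h
  refine ⟨-f n, ?_⟩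
  rw [smul_eq_mul, Finset.mul_sum]
  simp only [pow_zero, one_mul, pow_succ'] at h
  simp only [← mul_assoc]
  linear_combination -h

theorem powSum_surjective : Function.Surjective (powSum p R) := by
  intro x
  obtain ⟨g, rfl⟩ := AdicCompletion.mk_surjective _ _ x
  have h : ∀ n, (p : R) ^ n ∣ g (n + 1) - g n := by
    intro n
    have h1 := (AdicCompletion.mk _ _ g).2 (Nat.le_succ n)
    have h2 : (Submodule.Quotient.mk (g (n + 1)) :
        R ⧸ (Ideal.span {(p : R)} ^ n • ⊤ : Submodule R R)) = Submodule.Quotient.mk (g n) := h1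
    rwa [← sub_eq_zero, ← Submodule.Quotient.mk_sub, completion_mk_eq_zero_iff] at h2
  choose f hf using h
  refine ⟨fun n => f n + if n = 0 then g 0 else 0, AdicCompletion.ext fun n => ?_⟩
  rw [powSum_val]
  change _ = Submodule.Quotient.mk (g n)
  rw [← sub_eq_zero, ← Submodule.Quotient.mk_sub, completion_mk_eq_zero_iff]
  cases n with
  | zero => simp
  | succ n =>
    have h1 : ∑ i ∈ Finset.range (n + 1), (p : R) ^ i * (f i + if i = 0 then g 0 else 0) =
        g (n + 1) := by
      simp only [mul_add, ← hf, Finset.sum_add_distrib, Finset.sum_range_sub (fun i => g i)]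
      rw [Finset.sum_eq_single 0 (by intro i _ hi; simp [hi]) (by simp)]
      simp
    rw [h1, sub_self]
    exact dvd_zero _

theorem exists_of_add_smul (x : Completion p R) :
    ∃ (r : R) (y : Completion p R), x = AdicCompletion.of _ R r + (p : R) • y := by
  obtain ⟨f, rfl⟩ := powSum_surjective x
  exact ⟨_, _, powSum_eq_of_add f⟩

theorem dvd_of_of_eq_smul {n : ℕ} {r : R} {y : Completion p R}
    (h : AdicCompletion.of _ R r = (p : R) ^ n • y) : (p : R) ^ n ∣ r := by
  have h1 := congrArg (fun z => AdicCompletion.eval _ R n z) h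
  simp only [AdicCompletion.eval_of, map_smul, Submodule.mkQ_apply] at h1
  rw [← completion_mk_eq_zero_iff, h1]
  obtain ⟨s, hs⟩ := Submodule.Quotient.mk_surjective _ (AdicCompletion.eval _ R n y)
  rw [← hs, ← Submodule.Quotient.mk_smul, completion_mk_eq_zero_iff, smul_eq_mul]
  exact Dvd.intro _ rfl

theorem completion_eq_zero_of_smul (htf : ∀ r : R, (p : R) * r = 0 → r = 0)
    {x : Completion p R} (h : (p : R) • x = 0) : x = 0 := by
  obtain ⟨f, rfl⟩ := powSum_surjective x
  rw [← map_smul] at h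
  refine powSum_eq_zero_of fun n => ?_
  obtain ⟨s, hs⟩ := powSum_eq_zero h (n + 1)
  have h1 : (p : R) ^ n * s = ∑ i ∈ Finset.range (n + 1), (p : R) ^ i * f i := by
    refine sub_eq_zero.1 (htf _ ?_)
    rw [mul_sub, ← mul_assoc, ← pow_succ', ← hs, Finset.mul_sum, sub_eq_zero]
    exact Finset.sum_congr rfl fun i _ => by
      rw [Pi.smul_apply, smul_eq_mul]
      ring
  rw [Finset.sum_range_succ] at h1
  exact ⟨s - f n, by linear_combination -h1⟩

theorem completion_eq_zero_of_forall {x : Completion p R}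
    (h : ∀ n : ℕ, ∃ y : Completion p R, x = (p : R) ^ n • y) : x = 0 := by
  refine AdicCompletion.ext fun n => ?_
  obtain ⟨y, rfl⟩ := h n
  rw [AdicCompletion.val_zero_apply]
  obtain ⟨s, hs⟩ := Submodule.Quotient.mk_surjective _ (y.val n)
  rw [AdicCompletion.val_smul_apply, ← hs, ← Submodule.Quotient.mk_smul, completion_mk_eq_zero_iff,
    smul_eq_mul]
  exact Dvd.intro _ rfl

end Completion

end KillP

/-! ### The cokernel of a bidiagonal matrix -/

namespace KillP

section Bidiagonal

variable (p : ℕ) (R : Type u) [CommRing R] (M : Type u) [AddCommGroup M] [Module R M]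

/-- The bidiagonal map `o ↦ (p o₀, p² o₁ + 2 o₀, p² o₂ + 2 · 3 o₁, p² o₃ + 2 · 5 o₂, …)`. -/
def bidiagonal : (ℕ → M) →ₗ[R] (ℕ → M) :=
  LinearMap.pi fun k => match k with
    | 0 => (p : R) • LinearMap.proj 0
    | k + 1 => (p : R) ^ 2 • LinearMap.proj (k + 1) +
        (2 * ((2 * k + 1 : ℕ) : R)) • LinearMap.proj k

variable {M}

@[simp]
theorem bidiagonal_zero (o : ℕ → M) : bidiagonal p R M o 0 = (p : R) • o 0 := rfl

@[simp]
theorem bidiagonal_succ (o : ℕ → M) (k : ℕ) : bidiagonal p R M o (k + 1) =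
    (p : R) ^ 2 • o (k + 1) + (2 * ((2 * k + 1 : ℕ) : R)) • o k := rfl

variable {p R}

theorem bidiagonal_eq_zero (htf : ∀ r : R, (p : R) * r = 0 → r = 0) {o : ℕ → R}
    (h : bidiagonal p R R o = 0) : o = 0 := by
  funext k
  induction k with
  | zero => exact htf _ (congrFun h 0)
  | succ k ih =>
    have h1 := congrFun h (k + 1)
    rw [bidiagonal_succ, ih, Pi.zero_apply, smul_zero, add_zero] at h1
    exact eq_zero_of_pow_mul htf 2 h1

/-- On the image of `bidiagonal`, the partial sums of a linear form `∑ πᵢ rᵢ` with these coefficients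
telescope to the last term. -/
theorem sum_smul_bidiagonal {π : ℕ → R} (h0 : (p : R) * π 0 + 2 * π 1 = 0)
    (h1 : ∀ k, (p : R) ^ 2 * π (k + 1) + 2 * ((2 * k + 3 : ℕ) : R) * π (k + 2) = 0)
    (o : ℕ → M) (n : ℕ) :
    ∑ i ∈ Finset.range (n + 1), π i • bidiagonal p R M o i =
      ((if n = 0 then (p : R) else (p : R) ^ 2) * π n) • o n := by
  induction n with
  | zero => simp [smul_smul, mul_comm]
  | succ n ih =>
    rw [Finset.sum_range_succ, ih, bidiagonal_succ, smul_add, smul_smul, smul_smul,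
      add_left_comm, ← add_smul, mul_comm (π (n + 1)), if_neg n.succ_ne_zero]
    convert add_zero _
    convert zero_smul R (o n)
    cases n with
    | zero =>
      simp
      linear_combination h0
    | succ n =>
      rw [if_neg n.succ_ne_zero]
      have := h1 n
      push_cast at this ⊢
      linear_combination this

/-- A linear form that satisfies the same recursion on a finite interval only. -/
theorem sum_smul_bidiagonal_add {A : ℕ → R} {k a : ℕ} (h0 : A 0 = 1)
    (h1 : ∀ m < a, (p : R) ^ 2 * A m + 2 * ((2 * k + 1 + 2 * (m + 1) : ℕ) : R) * A (m + 1) = 0)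
    (o : ℕ → M) :
    ∑ m ∈ Finset.range (a + 1), A m • bidiagonal p R M o (k + 1 + m) =
      (2 * ((2 * k + 1 : ℕ) : R)) • o k + ((p : R) ^ 2 * A a) • o (k + 1 + a) := by
  induction a with
  | zero => simp [h0, add_comm]
  | succ a ih =>
    rw [Finset.sum_range_succ, ih fun m hm => h1 m (hm.trans a.lt_succ_self),
      show k + 1 + (a + 1) = k + 1 + a + 1 by ring, bidiagonal_succ, smul_add, smul_smul, smul_smul,
      add_assoc, add_left_comm (((p : R) ^ 2 * A a) • _), ← add_smul, mul_comm (A (a + 1))]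
    convert rfl
    convert (add_zero _).symm
    convert zero_smul R (o (k + 1 + a))
    have := h1 a a.lt_succ_self
    push_cast at this ⊢
    linear_combination this

/-- Surjectivity modulo `p` implies surjectivity, for a linear map to a `p`-adically separated
module that kills the image of `bidiagonal`. The point is that `p²` times a sequence agrees with a
multiple of its shift modulo this image. -/
theorem surjective_of_bidiagonal {T : Type u} [AddCommGroup T] [Module R T] (Φ : (ℕ → R) →ₗ[R] T)
    (hΦ : ∀ o, Φ (bidiagonal p R R o) = 0)
    (hT : ∀ w : T, (∀ n : ℕ, ∃ w', w = (p : R) ^ n • w') → w = 0)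
    (h : ∀ w, ∃ r w', w = Φ r + (p : R) • w') : Function.Surjective Φ := by
  intro w
  have h' : ∀ w, ∃ r w', w = Φ r + (p : R) ^ 2 • w' := by
    intro w
    obtain ⟨r, w', rfl⟩ := h w
    obtain ⟨r', w'', rfl⟩ := h w'
    refine ⟨r + (p : R) • r', w'', ?_⟩
    rw [map_add, map_smul, smul_add, smul_smul, ← pow_two, add_assoc]
  choose ρ η hη using h'
  -- The `j`-th entries of the preimages `s · n` of all `W n` are found together: those of `s · n`
  -- need only earlier entries of `s · (n + 1)`.
  let W : ℕ → T := fun n => η^[n] w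
  let c : ℕ → R := fun j => match j with
    | 0 => -(2 * p)
    | j + 1 => -(2 * ((2 * (j + 1) + 1 : ℕ) : R))
  let s : ℕ → ℕ → R := fun j => Nat.rec (fun n => ρ (W n) 0)
    (fun j f n => ρ (W n) (j + 1) + c j * f (n + 1)) j
  have hs : ∀ n, Φ (fun j => s j n) = Φ (ρ (W n)) + (p : R) ^ 2 • Φ fun j => s j (n + 1) := by
    intro n
    have e : (fun j => s j n) = ρ (W n) + ((p : R) ^ 2 • (fun j => s j (n + 1)) -
        bidiagonal p R R fun j => if j = 0 then p * s 0 (n + 1) else s j (n + 1)) := by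
      funext j
      match j with
      | 0 =>
        simp [s]
        ring
      | 1 =>
        simp [s, c]
        ring
      | j + 2 => simp [s, c]
    rw [e, map_add, map_sub, map_smul, hΦ, sub_zero]
  have hW : ∀ n, w - Φ (fun j => s j 0) = (p : R) ^ (2 * n) • (W n - Φ fun j => s j n) := by
    intro n
    induction n with
    | zero => simp [W]
    | succ n ih =>
      rw [ih, hs n, mul_add, pow_add, mul_smul, mul_one]
      congr 1
      nth_rw 1 [hη (W n)]
      rw [add_sub_add_left_eq_sub, ← smul_sub]
      simp only [W, Function.iterate_succ_apply']
  refine ⟨fun j => s j 0, (sub_eq_zero.1 (hT _ fun n => ?_)).symm⟩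
  refine ⟨(p : R) ^ n • (W n - Φ fun j => s j n), ?_⟩
  rw [hW n, two_mul, pow_add, mul_smul]

/-- An element of `∏ R` that is in the image of `bidiagonal` over the completion is in its image over
`R`: the entries of the preimage can be divided out one after the other. -/
theorem exists_descent (htf : ∀ r : R, (p : R) * r = 0 → r = 0) {s : ℕ → Completion p R}
    {r : ℕ → R} (h : ∀ k, bidiagonal p R _ s k = AdicCompletion.of _ R (r k)) :
    ∃ o, bidiagonal p R R o = r := by
  have hdiv : ∀ (n : ℕ) (y : R) (x : Completion p R), (p : R) ^ n • x = AdicCompletion.of _ R y →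
      ∃ o : R, (p : R) ^ n * o = y ∧ x = AdicCompletion.of _ R o := by
    intro n y x hx
    obtain ⟨o, rfl⟩ := dvd_of_of_eq_smul hx.symm
    refine ⟨o, rfl, ?_⟩
    rw [← smul_eq_mul, map_smul, ← sub_eq_zero, ← smul_sub] at hx
    rw [← sub_eq_zero]
    revert hx
    generalize x - _ = z
    intro hx
    induction n with
    | zero => simpa using hx
    | succ n ih =>
      rw [pow_succ', mul_smul] at hx
      exact ih (completion_eq_zero_of_smul htf hx)
  obtain ⟨o₀, h0, h0'⟩ := hdiv 1 (r 0) (s 0) (by simpa using h 0)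
  have step : ∀ (k : ℕ) (o : R), s k = AdicCompletion.of _ R o → ∃ o' : R,
      s (k + 1) = AdicCompletion.of _ R o' ∧
        (p : R) ^ 2 * o' + 2 * ((2 * k + 1 : ℕ) : R) * o = r (k + 1) := by
    intro k o ho
    obtain ⟨o', h1, h2⟩ := hdiv 2 (r (k + 1) - 2 * ((2 * k + 1 : ℕ) : R) * o) (s (k + 1)) (by
      rw [map_sub, ← smul_eq_mul, map_smul, ← ho, ← h, bidiagonal_succ, add_sub_cancel_right])
    exact ⟨o', h2, by rw [h1]; ring⟩
  choose! g hg hg' using step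
  let o : ℕ → R := fun k => Nat.rec o₀ g k
  have ho : ∀ k, s k = AdicCompletion.of _ R (o k) := fun k => by
    induction k with
    | zero => exact h0'
    | succ k ih => exact hg k _ ih
  refine ⟨o, funext fun k => ?_⟩
  match k with
  | 0 =>
    rw [← h0, pow_one]
    rfl
  | k + 1 => exact hg' k _ (ho k)

variable [Fact p.Prime]

/-- The coefficients of the linear form on `∏ R` with values in the completion, by the conditions of
`sum_smul_bidiagonal`. -/
theorem exists_completion_coefficients (hodd : Odd p) (htf : ∀ r : R, (p : R) * r = 0 → r = 0)
    (hu : ∀ n : ℕ, ¬ p ∣ n → IsUnit (n : R)) :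
    ∃ π : ℕ → R, π 0 = 1 ∧ (∀ k, (p : R) ^ k ∣ π k) ∧ (p : R) * π 0 + 2 * π 1 = 0 ∧
      ∀ k, (p : R) ^ 2 * π (k + 1) + 2 * ((2 * k + 3 : ℕ) : R) * π (k + 2) = 0 := by
  obtain ⟨t, ht⟩ := isUnit_iff_exists_inv.1 (isUnit_two hodd hu)
  obtain ⟨A, h0, hA, hA'⟩ := exists_quotient_sequence hodd htf hu (fun i => 2 * i + 3)
    fun i => by omega
  -- `π₁ = -p / 2`, and from there on the recursion is the one of `exists_quotient_sequence`
  refine ⟨fun k => match k with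
    | 0 => 1
    | k + 1 => -t * p * A k, rfl, fun k => ?_, ?_, fun k => ?_⟩
  · match k with
    | 0 => simp
    | k + 1 =>
      obtain ⟨z, hz⟩ := hA k (padicValNat_prod_odd_le hodd k)
      exact ⟨-t * z, by simp only [hz]; ring⟩
  · simp only [h0]
    linear_combination (-(p : R)) * ht
  · have := hA' k (padicValNat_prod_odd_le hodd k) (padicValNat_prod_odd_le hodd (k + 1))
    linear_combination (-t * p) * this

/-- The coefficients of the linear form on `∏ R` with values in `R / (2 k + 1)`. Its values on the
image of `bidiagonal` are multiples of `2 (2 k + 1)`, the remainder term included: the last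
coefficient is divisible by `p ^ a`, where `a` is the valuation of `2 k + 1`. -/
theorem exists_quotient_coefficients (hodd : Odd p) (htf : ∀ r : R, (p : R) * r = 0 → r = 0)
    (hu : ∀ n : ℕ, ¬ p ∣ n → IsUnit (n : R)) (k : ℕ) :
    ∃ (a : ℕ) (A : ℕ → R) (E : R), A 0 = 1 ∧ (∀ m < a, (p : R) ∣ A (m + 1)) ∧
      ∀ (M : Type u) [AddCommGroup M] [Module R M] (o : ℕ → M),
        ∑ m ∈ Finset.range (a + 1), A m • bidiagonal p R M o (k + 1 + m) =
          (2 * ((2 * k + 1 : ℕ) : R)) • (o k + ((p : R) * E) • o (k + 1 + a)) := by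
  obtain ⟨t, ht⟩ := isUnit_iff_exists_inv.1 (isUnit_two hodd hu)
  obtain ⟨A, h0, hA, hA'⟩ := exists_quotient_sequence hodd htf hu
    (fun i => 2 * k + 1 + 2 * (i + 1)) fun i => by omega
  have hv : ∀ m ≤ padicValNat p (2 * k + 1), _ := fun m hm =>
    padicValNat_prod_le hodd (n := 2 * k + 1) hm
  obtain ⟨z, hz⟩ := natCast_dvd_pow hu (n := 2 * k + 1) (by omega) le_rfl
  obtain ⟨y, hy⟩ := hA _ (hv _ le_rfl)
  refine ⟨padicValNat p (2 * k + 1), A, t * p * z * y, h0, fun m hm => ?_, fun M _ _ o => ?_⟩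
  · exact (dvd_pow_self _ m.succ_ne_zero).trans (hA (m + 1) (hv _ hm))
  · rw [sum_smul_bidiagonal_add h0 (fun m hm => hA' m (hv m hm.le) (hv (m + 1) hm)), smul_add,
      smul_smul]
    congr 2
    rw [hy, hz]
    linear_combination (-(p : R) ^ 2 * ((2 * k + 1 : ℕ) : R) * z * y) * ht

/-- The product `∏ R` modulo the image of `bidiagonal` is `R^∧ × ∏ R / (2 k + 1)`. -/
theorem exists_cokernel_map (hodd : Odd p) (htf : ∀ r : R, (p : R) * r = 0 → r = 0)
    (hu : ∀ n : ℕ, ¬ p ∣ n → IsUnit (n : R)) :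
    ∃ Φ : (ℕ → R) →ₗ[R] Completion p R × (∀ k : ℕ, R ⧸ Ideal.span {((2 * k + 1 : ℕ) : R)}),
      Function.Surjective Φ ∧ ∀ r, Φ r = 0 ↔ ∃ o, bidiagonal p R R o = r := by
  obtain ⟨π, hπ0, hπ, hπ1, hπ2⟩ := exists_completion_coefficients hodd htf hu
  choose ω hω using hπ
  choose a A E hA0 hA hAE using exists_quotient_coefficients (R := R) hodd htf hu
  have hω0 : ω 0 = 1 := by simpa [hπ0] using (hω 0).symm
  let ψ : ℕ → (ℕ → R) →ₗ[R] R := fun k =>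
    ∑ m ∈ Finset.range (a k + 1), A k m • LinearMap.proj (k + 1 + m)
  have hψ : ∀ k r, ψ k r = ∑ m ∈ Finset.range (a k + 1), A k m • r (k + 1 + m) := fun k r => by
    simp [ψ, LinearMap.sum_apply]
  let φ : (ℕ → R) →ₗ[R] Completion p R :=
    powSum p R ∘ₗ LinearMap.pi fun k => ω k • LinearMap.proj k
  have hφ : ∀ r, φ r = powSum p R fun k => ω k * r k := fun r => rfl
  let Φ := φ.prod (LinearMap.pi fun k =>
    (Ideal.span {((2 * k + 1 : ℕ) : R)}).mkQ ∘ₗ ψ k)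
  have hΦ0 : ∀ r, Φ r = 0 ↔ φ r = 0 ∧ ∀ k, ((2 * k + 1 : ℕ) : R) ∣ ψ k r := by
    intro r
    simp only [Φ, LinearMap.prod_apply, Function.prod, Prod.mk_eq_zero, funext_iff, LinearMap.pi_apply,
      LinearMap.comp_apply, Submodule.mkQ_apply, Pi.zero_apply, Submodule.Quotient.mk_eq_zero,
      Ideal.mem_span_singleton]
  have hα : ∀ n, (p : R) ^ (n + 1) ∣ (if n = 0 then (p : R) else (p : R) ^ 2) * π n := by
    intro n
    rw [pow_succ', hω]
    refine mul_dvd_mul ?_ (Dvd.intro _ rfl)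
    split_ifs
    exacts [dvd_rfl, dvd_pow_self _ two_ne_zero]
  have hΦD : ∀ o, Φ (bidiagonal p R R o) = 0 := by
    intro o
    refine (hΦ0 _).2 ⟨?_, fun k => ?_⟩
    · rw [hφ]
      refine powSum_eq_zero_of fun n => ?_
      cases n with
      | zero => simp
      | succ n =>
        have := sum_smul_bidiagonal hπ1 hπ2 o n
        simp only [smul_eq_mul, hω] at this
        simp only [← mul_assoc, this]
        have h := hα n
        rw [hω] at h
        simpa only [mul_assoc] using h.mul_right (o n)
    · rw [hψ, hAE]
      exact ⟨2 * (o k + (p * E k) • o (k + 1 + a k)), by simp only [smul_eq_mul]; ring⟩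
  refine ⟨Φ, surjective_of_bidiagonal Φ hΦD ?_ ?_, fun r => ⟨fun hr => ?_, ?_⟩⟩
  · intro w hw
    refine Prod.ext (completion_eq_zero_of_forall fun n => ?_) (funext fun k => ?_)
    · obtain ⟨w', hw'⟩ := hw n
      exact ⟨w'.1, congrArg Prod.fst hw'⟩
    · obtain ⟨w', hw'⟩ := hw (padicValNat p (2 * k + 1))
      obtain ⟨y, hy⟩ := Submodule.Quotient.mk_surjective _ (w'.2 k)
      rw [hw', Prod.smul_snd, Pi.smul_apply, ← hy, ← Submodule.Quotient.mk_smul, Prod.snd_zero,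
        Pi.zero_apply, Submodule.Quotient.mk_eq_zero, Ideal.mem_span_singleton, smul_eq_mul]
      exact (natCast_dvd_pow hu (by omega) le_rfl).mul_right _
  · rintro ⟨x, y⟩
    obtain ⟨x₀, x', rfl⟩ := exists_of_add_smul x
    choose y' hy' using fun k => Submodule.Quotient.mk_surjective _ (y k)
    let r : ℕ → R := fun k => Nat.casesOn k x₀ y'
    have h1 : ∀ k, ∃ c, ψ k r = y' k + p * c := by
      intro k
      choose! c hc using hA k
      refine ⟨∑ m ∈ Finset.range (a k), c m * r (k + 1 + (m + 1)), ?_⟩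
      rw [hψ, Finset.sum_range_succ', hA0, one_smul, add_zero, add_comm, Finset.mul_sum]
      congr 1
      refine Finset.sum_congr rfl fun m hm => ?_
      rw [hc m (Finset.mem_range.1 hm), smul_eq_mul, mul_assoc]
    choose c hc using h1
    refine ⟨r, (x' - powSum p R fun n => ω (n + 1) * r (n + 1),
      fun k => Submodule.Quotient.mk (-c k)), Prod.ext ?_ (funext fun k => ?_)⟩
    · change _ = φ r + _
      rw [hφ, powSum_eq_of_add, hω0, one_mul, Prod.smul_fst, smul_sub,
        add_add_sub_cancel]
      rfl
    · change y k = Submodule.Quotient.mk (ψ k r) + (p : R) • Submodule.Quotient.mk (-c k)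
      rw [← hy', ← Submodule.Quotient.mk_smul, ← Submodule.Quotient.mk_add, hc, smul_eq_mul]
      congr 1
      ring
  · obtain ⟨h1, h2⟩ := (hΦ0 r).1 hr
    obtain ⟨t, ht⟩ := isUnit_iff_exists_inv.1 (isUnit_two hodd hu)
    choose y hy using h2
    -- `s` solves `sₖ + p Eₖ sₖ₊₁₊ₐ = yₖ / 2` by iteration: `z n k` is the coefficient of `pⁿ` in `sₖ`
    let z : ℕ → ℕ → R := fun n => Nat.rec (fun k => t * y k)
      (fun _ f k => -E k * f (k + 1 + a k)) n
    let s : ℕ → Completion p R := fun k => powSum p R fun n => z n k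
    have hs : ∀ k, s k + ((p : R) * E k) • s (k + 1 + a k) = AdicCompletion.of _ R (t * y k) := by
      intro k
      have e : (fun n => z (n + 1) k) = -E k • fun n => z n (k + 1 + a k) := rfl
      change powSum p R (fun n => z n k) + _ = _
      rw [powSum_eq_of_add, e, map_smul, smul_smul, mul_neg, neg_smul, neg_add_cancel_right]
      rfl
    -- the difference between `r` and the image of `s` is infinitely divisible by `p`
    let d : ℕ → Completion p R := fun k => AdicCompletion.of _ R (r k) - bidiagonal p R _ s k
    have hd : ∀ k, ∑ m ∈ Finset.range (a k + 1), A k m • d (k + 1 + m) = 0 := by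
      intro k
      simp only [d, smul_sub, Finset.sum_sub_distrib, hAE, hs, ← map_smul, ← map_sum, ← hψ, hy,
        ← map_sub]
      rw [smul_eq_mul, show ((2 * k + 1 : ℕ) : R) * y k -
        2 * ((2 * k + 1 : ℕ) : R) * (t * y k) = 0 by
          linear_combination (-((2 * k + 1 : ℕ) : R) * y k) * ht, map_zero]
    have hd' : ∀ n k, ∃ x, d (k + 1) = (p : R) ^ n • x := by
      intro n
      induction n with
      | zero => exact fun k => ⟨d (k + 1), by simp⟩
      | succ n ih =>
        intro k
        choose x hx using ih
        choose! c hc using hA k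
        have h := hd k
        rw [Finset.sum_range_succ', hA0, one_smul, add_zero] at h
        refine ⟨-∑ m ∈ Finset.range (a k), c m • x (k + 1 + m), ?_⟩
        rw [eq_neg_of_add_eq_zero_right h, smul_neg, Finset.smul_sum]
        congr 1
        refine Finset.sum_congr rfl fun m hm => ?_
        rw [hc m (Finset.mem_range.1 hm), show k + 1 + (m + 1) = k + 1 + m + 1 by ring, hx,
          smul_smul, smul_smul]
        congr 1
        ring
    have hd1 : ∀ k, d (k + 1) = 0 := fun k => completion_eq_zero_of_forall fun n => hd' n k
    have hd0 : d 0 = 0 := by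
      refine completion_eq_zero_of_forall fun n => ?_
      have e1 : ∑ i ∈ Finset.range (n + 1), π i • d i = d 0 := by
        rw [Finset.sum_range_succ', hπ0, one_smul,
          Finset.sum_eq_zero fun i _ => by rw [hd1, smul_zero], zero_add]
      simp only [d, smul_sub, Finset.sum_sub_distrib, sum_smul_bidiagonal hπ1 hπ2,
        ← map_smul, ← map_sum] at e1
      rw [hφ] at h1
      obtain ⟨b, hb⟩ := powSum_eq_zero h1 (n + 1)
      simp only [← mul_assoc, ← hω] at hb
      obtain ⟨c, hc⟩ := hα n
      simp only [smul_eq_mul] at e1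
      refine ⟨(p : R) • (AdicCompletion.of _ R b - c • s n), ?_⟩
      change AdicCompletion.of _ R (r 0) - _ = _
      rw [← e1, hb, hc, smul_smul, ← pow_succ, smul_sub, smul_smul, ← smul_eq_mul, map_smul]
    refine exists_descent htf (s := s) fun k => ?_
    cases k with
    | zero => exact (sub_eq_zero.1 hd0).symm
    | succ k => exact (sub_eq_zero.1 (hd1 k)).symm
  · rintro ⟨o, rfl⟩
    exact hΦD o

end Bidiagonal

end KillP

/-! ### The periodic complex of words -/

namespace HochschildWord

variable {R : Type u} [CommRing R]

/-- The differential of the periodic complex of words. -/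
def periodicTotal (p : R) : (ℤ → WordModule R) →ₗ[R] (ℤ → WordModule R) :=
  LinearMap.pi fun j => total p ∘ₗ LinearMap.proj j + connes R ∘ₗ LinearMap.proj (j - 1)

theorem periodicTotal_apply (p : R) (x : ℤ → WordModule R) (j : ℤ) :
    periodicTotal p x j = total p (x j) + connes R (x (j - 1)) := rfl

theorem periodicTotal_periodicTotal (p : R) (x : ℤ → WordModule R) :
    periodicTotal p (periodicTotal p x) = 0 := by
  funext j
  rw [periodicTotal_apply, periodicTotal_apply, periodicTotal_apply, map_add, map_add, total_total,
    total_connes, connes_connes]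
  simp

variable (R) in
/-- The elements of degree `i` of the periodic complex of words. -/
def periodicPart (i : ℤ) : Submodule R (ℤ → WordModule R) :=
  Submodule.pi Set.univ fun j => degreePart R (i + 2 * j) 0

theorem mem_periodicPart {i : ℤ} {x : ℤ → WordModule R} :
    x ∈ periodicPart R i ↔ ∀ j, x j ∈ degreePart R (i + 2 * j) 0 := by
  simp [periodicPart, Submodule.mem_pi]

theorem periodicTotal_mem (p : R) {i i' : ℤ} (h : i' + 1 = i) {x : ℤ → WordModule R}
    (hx : x ∈ periodicPart R i) : periodicTotal p x ∈ periodicPart R i' := by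
  rw [mem_periodicPart] at hx ⊢
  intro j
  refine Submodule.add_mem _ ?_ ?_
  · convert total_mem_degreePart p (hx j) using 1
    · congr 1
      omega
    · rfl
  · convert connes_mem_degreePart (hx (j - 1)) using 1
    · congr 1
      omega
    · rfl

theorem smallZero_eq_zero_of_degree {m : ℤ} {n : ℕ} {x : WordModule R} (hx : x ∈ degreePart R m 0)
    (h : (n : ℤ) ≠ m) : smallZero R n x = 0 :=
  (Submodule.mem_bot R).1 (map_mem_of_mem_degreePart (fun L _ hw => by
    rw [Submodule.mem_bot]
    by_cases hL : L.length = 1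
    · obtain ⟨a, rfl⟩ := List.length_eq_one_iff.1 hL
      rw [smallZero_singleton, if_neg]
      rintro rfl
      simp at hw
      omega
    · exact smallZero_of_length_ne hL) hx)

theorem smallOne_eq_zero_of_degree {m : ℤ} {n : ℕ} {x : WordModule R} (hx : x ∈ degreePart R m 0)
    (h : (n : ℤ) + 2 ≠ m) : smallOne R n x = 0 :=
  (Submodule.mem_bot R).1 (map_mem_of_mem_degreePart (fun L _ hw => by
    rw [Submodule.mem_bot]
    by_cases hL : L.length = 2
    · obtain ⟨a, b, rfl⟩ := List.length_eq_two.1 hL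
      rw [smallOne_pair, if_neg]
      intro hab
      simp at hw
      omega
    · exact smallOne_of_length_ne hL) hx)

/-- The kernel of the projection to the small complex stays acyclic for the periodic differential:
its cycles are bounded column by column, starting where all chains vanish for degree reasons. -/
theorem exists_periodicTotal_eq (p : R) {i : ℤ} {x : ℤ → WordModule R} (hx : x ∈ periodicPart R i)
    (h0 : ∀ n j, smallZero R n (x j) = 0) (h1 : ∀ n j, smallOne R n (x j) = 0)
    (hd : periodicTotal p x = 0) :
    ∃ y ∈ periodicPart R (i + 1), (∀ n j, smallZero R n (y j) = 0) ∧
      (∀ n j, smallOne R n (y j) = 0) ∧ periodicTotal p y = x := by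
  rw [mem_periodicPart] at hx
  let P : ℤ → WordModule R → Prop := fun j y => y ∈ degreePart R (i + 1 + 2 * j) 0 ∧
    (∀ n, smallZero R n y = 0) ∧ (∀ n, smallOne R n y = 0) ∧
    connes R (total p y) = connes R (x j)
  have step : ∀ j y, P j y → ∃ y', P (j + 1) y' ∧ total p y' + connes R y = x (j + 1) := by
    rintro j y ⟨hy, hy0, hy1, hyd⟩
    obtain ⟨y', hy', hy0', hy1', hyd'⟩ := exists_total_eq p (m := i + 2 * (j + 1))
      (x := x (j + 1) - connes R y)
      (Submodule.sub_mem _ (hx (j + 1)) (by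
        convert connes_mem_degreePart hy using 2
        ring))
      (fun n => by rw [map_sub, h0, smallZero_connes, sub_zero])
      (fun n => by
        rw [map_sub, h1, smallOne_connes, hy0, mul_zero, ite_self, sub_zero])
      (by
        have := congrFun hd (j + 1)
        rw [periodicTotal_apply, add_sub_cancel_right, ← hyd] at this
        rw [map_sub, total_connes, sub_neg_eq_add]
        exact this)
    refine ⟨y', ⟨?_, hy0', hy1', ?_⟩, by rw [hyd', sub_add_cancel]⟩
    · convert hy' using 2
      ring
    · rw [hyd', map_sub, connes_connes, sub_zero]
  -- below this column all chains vanish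
  have hneg : ∀ j, j ≤ -|i| - 1 → x j = 0 := fun j hj =>
    eq_zero_of_mem_degreePart (by have := le_abs_self i; have := abs_nonneg i; omega) (hx j)
  generalize -|i| - 1 = b at hneg
  choose! g hg hg' using step
  let y : ℕ → WordModule R := fun n => Nat.rec 0 (fun n z => g (b + n) z) n
  have hy : ∀ n : ℕ, P (b + n) (y n) := by
    intro n
    induction n with
    | zero => exact ⟨Submodule.zero_mem _, fun n => map_zero _, fun n => map_zero _, by
        simp [y, hneg b le_rfl]⟩
    | succ n ih =>
      have := hg _ _ ih
      rw [show b + ((n + 1 : ℕ) : ℤ) = b + n + 1 by push_cast; ring]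
      exact this
  have hz : ∀ j ≤ b, y (j - b).toNat = 0 := by
    intro j hj
    rw [Int.toNat_eq_zero.2 (by omega)]
    rfl
  refine ⟨fun j => y (j - b).toNat, mem_periodicPart.2 fun j => ?_, fun n j => (hy _).2.1 n,
    fun n j => (hy _).2.2.1 n, funext fun j => ?_⟩
  · rcases le_total j b with hj | hj
    · rw [hz j hj]
      exact Submodule.zero_mem _
    · convert (hy (j - b).toNat).1 using 2
      omega
  · rw [periodicTotal_apply]
    rcases le_or_gt j b with hj | hj
    · rw [hz j hj, hz (j - 1) (by omega), hneg j hj, map_zero, map_zero, add_zero]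
    · obtain ⟨n, rfl⟩ : ∃ n : ℕ, j = b + n + 1 := ⟨(j - b - 1).toNat, by omega⟩
      rw [show (b + n + 1 - b).toNat = n + 1 by omega, show (b + n + 1 - 1 - b).toNat = n by omega]
      exact hg' _ _ (hy n)

/-- A periodic chain has zero image in the small complex if its components of the right degree
vanish. -/
theorem small_eq_zero {l : ℤ} {ε : ℕ} (hε : ε ≤ 1) {x : ℤ → WordModule R}
    (hx : x ∈ periodicPart R (2 * l + ε))
    (h0 : ∀ k : ℕ, smallZero R (2 * k + ε) (x (k - l)) = 0)
    (h1 : ∀ k : ℕ, smallOne R (2 * k + ε) (x (k + 1 - l)) = 0) :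
    (∀ n j, smallZero R n (x j) = 0) ∧ ∀ n j, smallOne R n (x j) = 0 := by
  rw [mem_periodicPart] at hx
  refine ⟨fun n j => ?_, fun n j => ?_⟩
  · by_cases h : (n : ℤ) = 2 * l + ε + 2 * j
    · obtain ⟨k, hk⟩ : ∃ k : ℕ, (k : ℤ) = j + l := ⟨(j + l).toNat, by omega⟩
      obtain rfl : n = 2 * k + ε := by omega
      obtain rfl : j = k - l := by omega
      exact h0 k
    · exact smallZero_eq_zero_of_degree (hx j) h
  · by_cases h : (n : ℤ) + 2 = 2 * l + ε + 2 * j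
    · obtain ⟨k, hk⟩ : ∃ k : ℕ, (k : ℤ) = j + l - 1 := ⟨(j + l - 1).toNat, by omega⟩
      obtain rfl : n = 2 * k + ε := by omega
      obtain rfl : j = k + 1 - l := by omega
      exact h1 k
    · exact smallOne_eq_zero_of_degree (hx j) h

theorem word_mem_degreePart {m : ℤ} {L : List ℕ} (h : 0 < L.length)
    (hm : (L.length : ℤ) + L.sum = m + 1) : (word L : WordModule R) ∈ degreePart R m 0 :=
  Submodule.subset_span ⟨L, h, hm, rfl⟩

/-- The projection to the small complex is onto: `xⁿ` and `xⁿ dx` lift to `[n]` and `[n, 1]`. -/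
theorem exists_small_eq (l : ℤ) (ε : ℕ) (u w : ℕ → R) :
    ∃ x ∈ periodicPart R (2 * l + ε), (∀ k : ℕ, smallZero R (2 * k + ε) (x (k - l)) = u k) ∧
      ∀ k : ℕ, smallOne R (2 * k + ε) (x (k + 1 - l)) = w k := by
  let f : ℤ → WordModule R := fun j => match j with
    | Int.ofNat 0 => u 0 • word [ε]
    | Int.ofNat (k + 1) => u (k + 1) • word [2 * (k + 1) + ε] + w k • word [2 * k + ε, 1]
    | Int.negSucc _ => 0
  have f0 : f 0 = u 0 • word [ε] := rfl
  have f1 : ∀ k : ℕ, f (k + 1) =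
    u (k + 1) • word [2 * (k + 1) + ε] + w k • word [2 * k + ε, 1] := fun k => rfl
  refine ⟨fun j => f (j + l), mem_periodicPart.2 fun j => ?_, fun k => ?_, fun k => ?_⟩
  · generalize hj : j + l = j'
    obtain rfl : j = j' - l := by omega
    match j' with
    | Int.ofNat 0 =>
      exact Submodule.smul_mem _ _ (word_mem_degreePart (by simp) (by simp; ring))
    | Int.ofNat (k + 1) =>
      exact Submodule.add_mem _
        (Submodule.smul_mem _ _ (word_mem_degreePart (by simp) (by simp; ring)))
        (Submodule.smul_mem _ _ (word_mem_degreePart (by simp) (by simp; ring)))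
    | Int.negSucc _ => exact Submodule.zero_mem _
  · simp only [sub_add_cancel]
    cases k with
    | zero => simp [f0, smallZero_singleton]
    | succ k =>
      rw [Nat.cast_succ, f1, map_add, map_smul, map_smul, smallZero_singleton, if_pos rfl,
        smallZero_of_length_ne (by simp)]
      simp
  · simp only [sub_add_cancel]
    rw [f1, map_add, map_smul, map_smul, smallOne_of_length_ne (by simp), smallOne_pair,
      if_pos rfl]
    simp [smallCoeff]

/-- The sequence `u₀`, `2 wₖ + p uₖ₊₁` formed from the coefficients `uₖ` of `x ^ (2 k)` and `wₖ` of
`x ^ (2 k) dx` of a periodic chain of degree `2 l`. The combination is chosen such that the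
coefficients of `x ^ (2 k + 1) dx` cancel on boundaries. -/
def evenClass (p : R) (l : ℤ) : (ℤ → WordModule R) →ₗ[R] (ℕ → R) :=
  LinearMap.pi fun k => match k with
    | 0 => smallZero R 0 ∘ₗ LinearMap.proj (-l)
    | k + 1 => (2 : R) • (smallOne R (2 * k) ∘ₗ LinearMap.proj ((k : ℤ) + 1 - l)) +
        p • (smallZero R (2 * (k + 1)) ∘ₗ LinearMap.proj ((k : ℤ) + 1 - l))

theorem evenClass_zero (p : R) (l : ℤ) (x : ℤ → WordModule R) :
    evenClass p l x 0 = smallZero R 0 (x (-l)) := rfl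

theorem evenClass_succ (p : R) (l : ℤ) (x : ℤ → WordModule R) (k : ℕ) :
    evenClass p l x (k + 1) = 2 * smallOne R (2 * k) (x (k + 1 - l)) +
      p * smallZero R (2 * (k + 1)) (x (k + 1 - l)) := rfl

section Boundary

variable (p : R) (l : ℤ) (y : ℤ → WordModule R)

theorem smallZero_periodicTotal_zero :
    smallZero R 0 (periodicTotal p y (-l)) = p * smallZero R 1 (y (-l)) := by
  rw [periodicTotal_apply, map_add, smallZero_total_zero, smallZero_connes, add_zero]

theorem smallZero_periodicTotal_succ (k : ℕ) :
    smallZero R (2 * (k + 1)) (periodicTotal p y (k + 1 - l)) =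
      2 * smallOne R (2 * k + 1) (y (k + 1 - l)) +
        p * smallZero R (2 * (k + 1) + 1) (y (k + 1 - l)) := by
  rw [periodicTotal_apply, map_add, smallZero_total_even, smallZero_connes, add_zero]

theorem smallOne_periodicTotal (k : ℕ) :
    smallOne R (2 * k) (periodicTotal p y (k + 1 - l)) =
      ((2 * k + 1 : ℕ) : R) * smallZero R (2 * k + 1) (y (k - l)) -
        p * smallOne R (2 * k + 1) (y (k + 1 - l)) := by
  rw [periodicTotal_apply, map_add, smallOne_total_even, smallOne_connes, if_pos (by simp),
    show (k : ℤ) + 1 - l - 1 = k - l by ring]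
  push_cast
  ring

end Boundary

theorem evenClass_periodicTotal (p : ℕ) (l : ℤ) (y : ℤ → WordModule R) :
    evenClass (p : R) l (periodicTotal (p : R) y) =
      KillP.bidiagonal p R R fun k => smallZero R (2 * k + 1) (y (k - l)) := by
  funext k
  cases k with
  | zero => simp [evenClass_zero, smallZero_periodicTotal_zero]
  | succ k =>
    rw [evenClass_succ, smallOne_periodicTotal, smallZero_periodicTotal_succ,
      KillP.bidiagonal_succ]
    push_cast
    simp only [smul_eq_mul]
    ring

variable {p : ℕ}

theorem exists_eq_periodicTotal_of_odd (h2 : IsUnit (2 : R))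
    (htf : ∀ r : R, (p : R) * r = 0 → r = 0) {l : ℤ} {x : ℤ → WordModule R}
    (hx : x ∈ periodicPart R (2 * l + 1)) (hd : periodicTotal (p : R) x = 0) :
    ∃ y ∈ periodicPart R (2 * l + 1 + 1), periodicTotal (p : R) y = x := by
  have h := evenClass_periodicTotal (p := p) l x
  rw [hd, map_zero] at h
  have ho := congrFun (KillP.bidiagonal_eq_zero htf h.symm)
  have hq : ∀ k : ℕ, smallOne R (2 * k + 1) (x (k + 1 - l)) = 0 := by
    intro k
    have h' := smallZero_periodicTotal_succ (p : R) l x k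
    have h'' := ho (k + 1)
    push_cast at h''
    rw [hd, h'', Pi.zero_apply, map_zero, Pi.zero_apply, mul_zero, add_zero] at h'
    exact h2.mul_right_eq_zero.1 h'.symm
  obtain ⟨h0, h1⟩ := small_eq_zero (ε := 1) le_rfl (by exact_mod_cast hx) ho hq
  obtain ⟨y, hy, -, -, rfl⟩ := exists_periodicTotal_eq _ hx h0 h1 hd
  exact ⟨y, hy, rfl⟩

theorem exists_eq_periodicTotal_of_even (h2 : IsUnit (2 : R)) {l : ℤ} {x : ℤ → WordModule R}
    (hx : x ∈ periodicPart R (2 * l)) (hd : periodicTotal (p : R) x = 0) {o : ℕ → R}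
    (ho : KillP.bidiagonal p R R o = evenClass (p : R) l x) :
    ∃ y ∈ periodicPart R (2 * l + 1), periodicTotal (p : R) y = x := by
  obtain ⟨t, ht⟩ := isUnit_iff_exists_inv.1 h2
  obtain ⟨y, hy, hyo, hyq⟩ := exists_small_eq l 1 o fun k =>
    t * (smallZero R (2 * (k + 1)) (x (k + 1 - l)) - p * o (k + 1))
  rw [Nat.cast_one] at hy
  have hm : x - periodicTotal (p : R) y ∈ periodicPart R (2 * l) :=
    Submodule.sub_mem _ hx (periodicTotal_mem _ rfl hy)
  have hd' : periodicTotal (p : R) (x - periodicTotal (p : R) y) = 0 := by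
    rw [map_sub, hd, periodicTotal_periodicTotal, sub_zero]
  obtain ⟨h0, h1⟩ := small_eq_zero (ε := 0) zero_le_one (by simpa using hm) (fun k => by
    rw [Pi.sub_apply, map_sub, add_zero, sub_eq_zero]
    cases k with
    | zero =>
      have h := congrFun ho 0
      have h' := hyo 0
      rw [KillP.bidiagonal_zero, evenClass_zero, smul_eq_mul] at h
      simp only [Nat.cast_zero, zero_sub, mul_zero, zero_add] at h' ⊢
      rw [smallZero_periodicTotal_zero, h', h]
    | succ k =>
      have h' := hyo (k + 1)
      rw [Nat.cast_succ] at h' ⊢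
      rw [smallZero_periodicTotal_succ, h', hyq]
      linear_combination (-(smallZero R (2 * (k + 1)) (x (k + 1 - l)) - p * o (k + 1))) * ht)
    fun k => by
      rw [Pi.sub_apply, map_sub, add_zero]
      have h := congrFun ho (k + 1)
      rw [KillP.bidiagonal_succ, evenClass_succ, smul_eq_mul, smul_eq_mul] at h
      refine h2.mul_right_eq_zero.1 ?_
      rw [smallOne_periodicTotal, hyo, hyq]
      linear_combination -h + p * (smallZero R (2 * (k + 1)) (x (k + 1 - l)) - p * o (k + 1)) * ht
  obtain ⟨z, hz, -, -, hz'⟩ := exists_periodicTotal_eq _ hm h0 h1 hd'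
  exact ⟨z + y, Submodule.add_mem _ hz hy, by rw [map_add, hz', sub_add_cancel]⟩

theorem exists_cycle_evenClass_eq (h2 : IsUnit (2 : R)) (l : ℤ) (r : ℕ → R) :
    ∃ x ∈ periodicPart R (2 * l), periodicTotal (p : R) x = 0 ∧ evenClass (p : R) l x = r := by
  obtain ⟨t, ht⟩ := isUnit_iff_exists_inv.1 h2
  obtain ⟨x, hx, hx0, hx1⟩ := exists_small_eq l 0 (fun k => if k = 0 then r 0 else 0)
    fun k => t * r (k + 1)
  rw [Nat.cast_zero, add_zero] at hx
  have hm : periodicTotal (p : R) x ∈ periodicPart R (2 * (l - 1) + 1) :=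
    periodicTotal_mem _ (by ring) hx
  obtain ⟨h0, h1⟩ := small_eq_zero (ε := 1) le_rfl (by exact_mod_cast hm) (fun k => by
    rw [periodicTotal_apply, map_add, smallZero_total_odd, smallZero_connes, add_zero])
    fun k => by
      rw [periodicTotal_apply, map_add, smallOne_total_odd, smallOne_connes, if_neg (by simp),
        add_zero]
  -- the lift `x` need not be a cycle, but its boundary bounds an element with zero small image
  obtain ⟨y, hy, hy0, hy1, hyx⟩ := exists_periodicTotal_eq _ hm h0 h1
    (periodicTotal_periodicTotal _ _)
  rw [show 2 * (l - 1) + 1 + 1 = 2 * l by ring] at hy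
  refine ⟨x - y, Submodule.sub_mem _ hx hy, by rw [map_sub, hyx, sub_self], funext fun k => ?_⟩
  cases k with
  | zero =>
    have h := hx0 0
    simp only [Nat.cast_zero, zero_sub, mul_zero, add_zero, if_true] at h
    rw [evenClass_zero, Pi.sub_apply, map_sub, hy0, sub_zero, h]
  | succ k =>
    have h := hx0 (k + 1)
    have h' := hx1 k
    rw [Nat.cast_succ, if_neg k.succ_ne_zero, add_zero] at h
    rw [add_zero] at h'
    rw [evenClass_succ, Pi.sub_apply, map_sub, map_sub, hy0, hy1, sub_zero, sub_zero, h, h']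
    linear_combination r (k + 1) * ht

end HochschildWord

/-! ### The periodic cyclic homology of `R // p` -/

namespace KillP

open HochschildWord DGCyclic Polynomial

variable (R : Type u) [CommRing R]

/-- Periodic chains of `R // p` as families of words. -/
def periodicToWord : (ℤ → Chains R R[X]) →ₗ[R] (ℤ → WordModule R) :=
  LinearMap.pi fun j => toWord R ∘ₗ LinearMap.proj j

theorem periodicToWord_injective : Function.Injective (periodicToWord R) := fun _ _ h =>
  funext fun j => toWord_injective R (congrFun h j)

theorem periodicToWord_periodicDiff (p : ℕ) (x : ℤ → Chains R R[X]) :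
    periodicToWord R (periodicDiff (grading R) (diff R p) x) =
      periodicTotal (p : R) (periodicToWord R x) := by
  funext j
  change toWord R (hochschildDiff (grading R) (diff R p) (x j) +
    totalConnes (grading R) (x (j - 1))) = _
  rw [map_add, toWord_hochschildDiff, toWord_totalConnes]
  rfl

theorem periodicToWord_mem {i : ℤ} {x : ℤ → Chains R R[X]}
    (hx : x ∈ periodicChains (grading R) i) : periodicToWord R x ∈ periodicPart R i :=
  mem_periodicPart.2 fun j => toWord_mem R ((Submodule.mem_pi.1 hx) j trivial)

theorem exists_periodicToWord_eq {i : ℤ} {x : ℤ → WordModule R} (hx : x ∈ periodicPart R i) :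
    ∃ y ∈ periodicChains (grading R) i, periodicToWord R y = x := by
  choose y hy hyx using fun j => exists_toWord_eq R (mem_periodicPart.1 hx j)
  exact ⟨y, Submodule.mem_pi.2 fun j _ => hy j, funext hyx⟩

variable {R}

theorem mem_periodicBoundaries {p : ℕ} {i : ℤ} {x : ℤ → Chains R R[X]}
    (h : ∃ y ∈ periodicPart R (i + 1), periodicTotal (p : R) y = periodicToWord R x) :
    x ∈ periodicBoundaries (grading R) (diff R p) i := by
  obtain ⟨y, hy, hyx⟩ := h
  obtain ⟨z, hz, rfl⟩ := exists_periodicToWord_eq R hy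
  rw [← periodicToWord_periodicDiff] at hyx
  exact ⟨z, hz, periodicToWord_injective R hyx⟩

theorem periodicTotal_periodicToWord {p : ℕ} {i : ℤ} {x : ℤ → Chains R R[X]}
    (hx : x ∈ periodicCycles (grading R) (diff R p) i) :
    periodicTotal (p : R) (periodicToWord R x) = 0 := by
  rw [← periodicToWord_periodicDiff, LinearMap.mem_ker.1 hx.2, map_zero]

theorem subsingleton_HP_of_odd {p : ℕ} (h2 : IsUnit (2 : R))
    (htf : ∀ r : R, (p : R) * r = 0 → r = 0) {i : ℤ} (hi : Odd i) :
    Subsingleton (HPKillP R p i) := by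
  obtain ⟨l, rfl⟩ := hi
  refine Submodule.Quotient.subsingleton_iff.2 (eq_top_iff.2 fun x _ => ?_)
  exact mem_periodicBoundaries (exists_eq_periodicTotal_of_odd h2 htf
    (periodicToWord_mem R x.2.1) (periodicTotal_periodicToWord x.2))

/-- In even degrees the periodic cyclic homology of `R // p` is the cokernel of `bidiagonal`. -/
theorem nonempty_HP_equiv_of_even {p : ℕ} (h2 : IsUnit (2 : R)) {M : Type*} [AddCommGroup M]
    [Module R M] {Φ : (ℕ → R) →ₗ[R] M} (hΦ : Function.Surjective Φ)
    (hker : ∀ r, Φ r = 0 ↔ ∃ o, bidiagonal p R R o = r) {i : ℤ} (hi : Even i) :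
    Nonempty (HPKillP R p i ≃ₗ[R] M) := by
  obtain ⟨l, rfl⟩ := hi
  rw [← two_mul]
  let Λ : ↥(periodicCycles (grading R) (diff R p) (2 * l)) →ₗ[R] M :=
    Φ ∘ₗ evenClass (p : R) l ∘ₗ periodicToWord R ∘ₗ Submodule.subtype _
  have hΛ : Function.Surjective Λ := by
    intro m
    obtain ⟨r, rfl⟩ := hΦ m
    obtain ⟨x, hx, hx0, rfl⟩ := exists_cycle_evenClass_eq (p := p) h2 l r
    obtain ⟨z, hz, rfl⟩ := exists_periodicToWord_eq R hx
    rw [← periodicToWord_periodicDiff] at hx0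
    exact ⟨⟨z, hz, periodicToWord_injective R (hx0.trans (map_zero _).symm)⟩, rfl⟩
  have hk : (periodicBoundaries (grading R) (diff R p) (2 * l)).submoduleOf
      (periodicCycles (grading R) (diff R p) (2 * l)) = LinearMap.ker Λ := by
    ext x
    rw [LinearMap.mem_ker]
    change x.1 ∈ periodicBoundaries (grading R) (diff R p) (2 * l) ↔
      Φ (evenClass (p : R) l (periodicToWord R x.1)) = 0
    rw [hker]
    constructor
    · rintro ⟨y, -, hy⟩
      rw [← hy, periodicToWord_periodicDiff, evenClass_periodicTotal]
      exact ⟨_, rfl⟩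
    · rintro ⟨o, ho⟩
      exact mem_periodicBoundaries (exists_eq_periodicTotal_of_even h2
        (periodicToWord_mem R x.2.1) (periodicTotal_periodicToWord x.2) ho)
  exact ⟨(Submodule.quotEquivOfEq _ _ hk).trans (Λ.quotKerEquivOfSurjective hΛ)⟩

end KillP

end

/-- For an odd prime `p` and a `p`-torsion-free commutative `ℤ_(p)`-algebra `R`, the module
`HPᵢ(R // p)` over `R` vanishes for `i` odd, and is isomorphic to
`R^∧ × R/1 × R/3 × R/5 × ⋯` for `i` even. -/
theorem theorem1 (p : ℕ) [Fact p.Prime] (hp : Odd p) (R : Type*) [CommRing R]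
    [Algebra (ZLocAt p) R] (htf : ∀ r : R, (p : R) * r = 0 → r = 0) :
    (∀ i : ℤ, Odd i → Subsingleton (HPKillP R p i)) ∧
    (∀ i : ℤ, Even i → Nonempty (HPKillP R p i ≃ₗ[R]
      (AdicCompletion (Ideal.span {(p : R)}) R ×
        (∀ k : ℕ, R ⧸ Ideal.span {((2 * k + 1 : ℕ) : R)})))) := by
  have hu : ∀ n : ℕ, ¬ p ∣ n → IsUnit (n : R) := fun n hn => KillP.isUnit_natCast p R hn
  have h2 : IsUnit (2 : R) := KillP.isUnit_two hp hu
  obtain ⟨Φ, hΦ, hker⟩ := KillP.exists_cokernel_map hp htf hu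
  exact ⟨fun i hi => KillP.subsingleton_HP_of_odd h2 htf hi,
    fun i hi => KillP.nonempty_HP_equiv_of_even h2 hΦ hker hi⟩
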